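/- Let $\mathbb{L}^4$ be $\mathbb{R}^4$ with the Lorentzian metric $\langle x,y\rangle=-x_0y_0+x_1y_1+x_2y_2+x_3y_3$. Let $\Sigma$ be a connected smooth surface and $\psi:\Sigma\to\mathbb{L}^4$ a spacelike immersion, i.e. a smooth map whose induced metric $g=\langle d\psi,d\psi\rangle$ is Riemannian. Let $\mathbf{H}=\tfrac12\operatorname{tr}_g \mathrm{II}$ be its mean curvature vector, where $\mathrm{II}$ is the second fundamental form with values in the normal bundle. Suppose that $\mathbf{H}$ is parallel in the normal bundle, $\nabla^{\perp}\mathbf{H}\equiv 0$, and that $\psi$ is not maximal, i.e. $\mathbf{H}$ does not vanish identically. Then $\psi(\Sigma)$ is contained in a totally umbilical affine hyperquadric $\mathbb{Q}^3$ of $\mathbb{L}^4$, namely in an affine hyperplane $\{x:\langle n,x\rangle=c\}$ with $n\neq 0$, $c\in\mathbb{R}$, or in a hyperquadric $\{x\neq a:\langle x-a,x-a\rangle=\rho\}$ with $a\in\mathbb{L}^4$, $\rho\in\mathbb{R}$. (Degenerate hyperplanes, and light cones $\rho=0$, are included. The hyperquadrics with nondegenerate induced metric are the spacelike and timelike affine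 hyperplanes, isometric to $\mathbb{R}^3$ and $\mathbb{L}^3$, and the translates of the de Sitter spaces $\mathbb{S}^3_1(r^2)$ and of the two-sheeted hyperbolic spaces $\pm\mathbb{H}^3(-r^2)$.) Moreover, $\mathbb{Q}^3$ can be chosen so that, if its induced metric is nondegenerate, $\psi$ is a surface of constant mean curvature in this three-dimensional space form: $|\langle\mathbf{H},\nu\rangle|$ takes the same value at all points of $\Sigma$, where $\nu$ is a unit normal vector of $\psi$ tangent to $\mathbb{Q}^3$. -/

import Mathlib

open scoped Manifold ContDiff

noncomputable section

namespace Minkowski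

/-- The vector space underlying the Lorentz-Minkowski space, with coordinates
`(x₀, x₁, x₂, x₃)`. -/
abbrev L4 : Type := Fin 4 → ℝ

/-- The model plane of surfaces. -/
abbrev Plane : Type := EuclideanSpace ℝ (Fin 2)

/-- The Lorentzian product `-x₀y₀ + x₁y₁ + x₂y₂ + x₃y₃`. -/
def lor (x y : L4) : ℝ := -(x 0 * y 0) + x 1 * y 1 + x 2 * y 2 + x 3 * y 3

section Surface

variable {S : Type*} [TopologicalSpace S] [ChartedSpace Plane S]

/-- The differential of `f` at `x`, applied to the tangent vector with coordinates `v` in the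
preferred chart at `x` (which identifies `TangentSpace (𝓡 2) x` with the plane). -/
def diff (f : S → L4) (x : S) (v : Plane) : L4 :=
  mfderiv (𝓡 2) 𝓘(ℝ, L4) f x v

/-- A smooth map whose induced metric `(v, w) ↦ ⟨dψ v, dψ w⟩` is Riemannian; in particular, it is
an immersion. -/
structure IsSpacelike (ψ : S → L4) : Prop where
  smooth : ContMDiff (𝓡 2) 𝓘(ℝ, L4) ∞ ψ
  pos : ∀ (x : S) (v : Plane), v ≠ 0 → 0 < lor (diff ψ x v) (diff ψ x v)

/-- The coordinate tangent vectors. -/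
def coordVec (i : Fin 2) : Plane := EuclideanSpace.single i 1

/-- The matrix `gᵢⱼ` of the induced metric at `x` in the preferred chart at `x`. -/
def gram (ψ : S → L4) (x : S) : Matrix (Fin 2) (Fin 2) ℝ :=
  Matrix.of fun i j => lor (diff ψ x (coordVec i)) (diff ψ x (coordVec j))

/-- The component `w^⊥ = w - ∑ gⁱʲ ⟨w, ∂ⱼψ⟩ ∂ᵢψ` of `w` normal to the surface at `x`. -/
def normalPart (ψ : S → L4) (x : S) (w : L4) : L4 :=
  w - ∑ i, ∑ j, ((gram ψ x)⁻¹ i j * lor w (diff ψ x (coordVec j))) • diff ψ x (coordVec i)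

/-- The second derivative of `ψ` at `x`, read in the preferred chart at `x`. -/
def hessian (ψ : S → L4) (x : S) (v w : Plane) : L4 :=
  fderiv ℝ (fderiv ℝ (ψ ∘ (chartAt Plane x).symm)) (chartAt Plane x x) v w

/-- The second fundamental form `II(v, w)`, the normal part of the second derivative (it does not
depend on the chart). -/
def secondForm (ψ : S → L4) (x : S) (v w : Plane) : L4 :=
  normalPart ψ x (hessian ψ x v w)

/-- The mean curvature vector `H = ½ tr_g II = ½ ∑ gⁱʲ II(∂ᵢ, ∂ⱼ)`. -/
def meanCurv (ψ : S → L4) (x : S) : L4 :=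
  (1 / 2 : ℝ) • ∑ i, ∑ j, (gram ψ x)⁻¹ i j • secondForm ψ x (coordVec i) (coordVec j)

/-- The normal connection `∇^⊥_v ξ`, the normal part of the derivative of the normal field `ξ`. -/
def normalConn (ψ ξ : S → L4) (x : S) (v : Plane) : L4 :=
  normalPart ψ x (diff ξ x v)

/-- The mean curvature vector is parallel in the normal bundle, `∇^⊥ H ≡ 0`. -/
def HasParallelMeanCurv (ψ : S → L4) : Prop :=
  ∀ (x : S) (v : Plane), normalConn ψ (meanCurv ψ) x v = 0

/-- The mean curvature vector vanishes identically. -/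
def IsMaximal (ψ : S → L4) : Prop :=
  ∀ x : S, meanCurv ψ x = 0

end Surface

/-- An equation `q(x) = B(x, x) + l(x) + c = 0` of degree at most two. -/
structure Hyperquadric where
  form : LinearMap.BilinForm ℝ L4
  symm : ∀ x y : L4, form x y = form y x
  lin : L4 →ₗ[ℝ] ℝ
  const : ℝ

namespace Hyperquadric

/-- The function `q`. -/
def eval (Q : Hyperquadric) (x : L4) : ℝ := Q.form x x + Q.lin x + Q.const

/-- The differential `dq_x`. -/
def deriv (Q : Hyperquadric) (x v : L4) : ℝ := 2 * Q.form x v + Q.lin v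

/-- The hypersurface `{q = 0}`, without the points at which `dq` vanishes (such as the vertex of a
light cone). -/
def locus (Q : Hyperquadric) : Set L4 := {x | Q.eval x = 0 ∧ ∃ v, Q.deriv x v ≠ 0}

/-- The hypersurface is totally umbilical: at each of its points the second fundamental form, which
with respect to the normal `grad q` is `-Hess q = -2B` on the tangent space `ker dq_x`, is a
multiple of the induced metric. (The metric induced on the hypersurface may be degenerate.) -/
def IsTotallyUmbilical (Q : Hyperquadric) : Prop :=
  ∀ x ∈ Q.locus, ∃ μ : ℝ, ∀ v w : L4, Q.deriv x v = 0 → Q.deriv x w = 0 →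
    2 * Q.form v w = μ * lor v w

end Hyperquadric

/-- The affine hyperplane `⟨n, x⟩ = c`. -/
def hyperplane (n : L4) (c : ℝ) : Set L4 := {x | lor n x = c}

/-- The hyperquadric `⟨x - a, x - a⟩ = ρ` with centre `a`: for `ρ = 1/r²` the de Sitter space
`a + 𝕊³₁(r²)`, for `ρ = -1/r²` the two sheets of the hyperbolic space `a ± ℍ³(-r²)`, for `ρ = 0` the
light cone at `a` without its vertex. -/
def centralQuadric (a : L4) (ρ : ℝ) : Set L4 := {x | x ≠ a ∧ lor (x - a) (x - a) = ρ}

section Surface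

variable {S : Type*} [TopologicalSpace S] [ChartedSpace Plane S]

/-- `ν` is, at the point `x`, a unit normal of the surface `ψ` regarded as a surface in `Q`: it is
tangent to `Q`, orthogonal to the surface, and of square `1` or `-1`. -/
structure IsUnitNormalIn (ψ : S → L4) (Q : Hyperquadric) (x : S) (ν : L4) : Prop where
  tangent : Q.deriv (ψ x) ν = 0
  normal : ∀ v : Plane, lor ν (diff ψ x v) = 0
  unit : |lor ν ν| = 1

/-- The mean curvature of `ψ` as a surface in `Q` is constant. The mean curvature with respect to
the unit normal `ν` is `⟨H, ν⟩`, up to the sign `⟨ν, ν⟩`; since `ν` is only determined up to its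
sign, the absolute value is taken. (Where `Q` is degenerate there is no unit normal.) -/
def HasConstantMeanCurvIn (ψ : S → L4) (Q : Hyperquadric) : Prop :=
  ∃ h : ℝ, ∀ (x : S) (ν : L4), IsUnitNormalIn ψ Q x ν → |lor (meanCurv ψ x) ν| = h

end Surface

end Minkowski

end

/-! Let `ξ` be a parallel normal field with `⟨H, ξ⟩ = m`; here `m` is constant. By the Weingarten
equation, `W = ξ + m f` has differential `df ∘ B`, where `B = m - A_ξ` is, up to sign, the traceless
part of the shape operator `A_ξ`. That such a `W` exists is the Codazzi equation for `B`. In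
isothermal coordinates it says that the Hopf differential of `ξ` is holomorphic. The theorem follows
once some nonzero `ξ` has `B = 0`: then `W` is a constant `A`, and `A - m f` is normal to the
surface. If `m ≠ 0`, the surface lies on a quadric centred at `A / m`; if `m = 0`, it lies in a
hyperplane orthogonal to `A`.

Such a `ξ` exists locally for two reasons. Where `H ≠ 0`, the field `H` and a suitably scaled null
normal field `ν` form a parallel frame of the normal bundle. By the Ricci equation their shape
operators then commute, and commuting traceless symmetric endomorphisms of a plane are proportional.
Integrability forces the factor to be constant (`CodazziField.exists_const`), so `H` or some `ν - l
H` is umbilical on a small ball.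

Isothermal coordinates are not used. In an arbitrary chart the null direction of the metric is `L =
∂₁ + (s + it)∂₂`, and Codazzi becomes `L w = ` terms of order zero in a complex coefficient `w` of
`B`. Unique continuation for this equation comes from the Carleman estimate `carleman`. It
propagates `B = 0` from small balls to larger ones and makes the set of admissible pairs `(A, m)`
locally constant, which globalises the local result (`IsSpacelike.exists_umbilical`).

Two further points are needed. `H` vanishes nowhere, because a parallel field with a zero is locally
zero. The mean curvature in the quadric is constant because, in an orthogonal frame of the normal
plane containing `A - mψ`, it is determined by the constants `⟨H, H⟩`, `⟨H, A - mψ⟩` and `⟨A - mψ, A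
- mψ⟩`. -/

namespace Minkowski

open MeasureTheory Set Filter Topology

/-! ### Partial derivatives and integration by parts in the plane -/

section PartialDerivatives

variable {E : Type*} [NormedAddCommGroup E] [NormedSpace ℝ E]

/-- The partial derivative in the `i`-th coordinate direction. -/
noncomputable def pd (i : Fin 2) (F : Plane → E) (x : Plane) : E := fderiv ℝ F x (coordVec i)

theorem contDiffOn_pd {F : Plane → E} {Ω : Set Plane} (hF : ContDiffOn ℝ ∞ F Ω) (hΩ : IsOpen Ω)
    (i : Fin 2) : ContDiffOn ℝ ∞ (pd i F) Ω :=
  (hF.fderiv_of_isOpen hΩ (by simp)).clm_apply contDiffOn_const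

theorem differentiableAt_of_contDiffOn {F : Plane → E} {Ω : Set Plane} (hF : ContDiffOn ℝ ∞ F Ω)
    (hΩ : IsOpen Ω) {x : Plane} (hx : x ∈ Ω) : DifferentiableAt ℝ F x :=
  (hF.contDiffAt (hΩ.mem_nhds hx)).differentiableAt (by simp)

theorem pd_congr {F G : Plane → E} {x : Plane} (h : F =ᶠ[𝓝 x] G) (i : Fin 2) :
    pd i F x = pd i G x := by
  simp only [pd, h.fderiv_eq]

theorem pd_eq_zero {F : Plane → E} {x : Plane} (h : ∀ᶠ y in 𝓝 x, F y = 0) (i : Fin 2) :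
    pd i F x = 0 := by
  have : F =ᶠ[𝓝 x] fun _ => 0 := h
  rw [pd_congr this]; simp [pd]

theorem pd_eq_zero_of_eqOn {F : Plane → E} {Ω : Set Plane} (hΩ : IsOpen Ω) {c : E}
    (h : ∀ y ∈ Ω, F y = c) {x : Plane} (hx : x ∈ Ω) (i : Fin 2) : pd i F x = 0 := by
  have : F =ᶠ[𝓝 x] fun _ => c := by
    filter_upwards [hΩ.mem_nhds hx] with y hy using h y hy
  rw [pd_congr this]; simp [pd]

theorem fderiv_eq_pd {F : Plane → E} (x v : Plane) :
    fderiv ℝ F x v = v 0 • pd 0 F x + v 1 • pd 1 F x := by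
  have hv : v = v 0 • coordVec 0 + v 1 • coordVec 1 := by
    ext i; fin_cases i <;> simp [coordVec]
  conv_lhs => rw [hv]
  simp [pd]

theorem pd_add {F G : Plane → E} {x : Plane} (hF : DifferentiableAt ℝ F x)
    (hG : DifferentiableAt ℝ G x) (i : Fin 2) :
    pd i (fun y => F y + G y) x = pd i F x + pd i G x := by
  simp [pd, fderiv_fun_add hF hG]

theorem pd_sub {F G : Plane → E} {x : Plane} (hF : DifferentiableAt ℝ F x)
    (hG : DifferentiableAt ℝ G x) (i : Fin 2) :
    pd i (fun y => F y - G y) x = pd i F x - pd i G x := by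
  simp [pd, fderiv_fun_sub hF hG]

theorem pd_neg {F : Plane → E} {x : Plane} (i : Fin 2) :
    pd i (fun y => - F y) x = - pd i F x := by
  simp [pd]

theorem pd_smul {a : Plane → ℝ} {F : Plane → E} {x : Plane} (ha : DifferentiableAt ℝ a x)
    (hF : DifferentiableAt ℝ F x) (i : Fin 2) :
    pd i (fun y => a y • F y) x = a x • pd i F x + pd i a x • F x := by
  simp [pd, fderiv_fun_smul ha hF]

theorem pd_const_smul {F : Plane → E} {x : Plane} (hF : DifferentiableAt ℝ F x) (c : ℝ)
    (i : Fin 2) : pd i (fun y => c • F y) x = c • pd i F x := by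
  simp [pd, fderiv_fun_const_smul hF]

theorem pd_const (c : E) (x : Plane) (i : Fin 2) : pd i (fun _ => c) x = 0 := by
  simp [pd]

theorem pd_mul {a b : Plane → ℝ} {x : Plane} (ha : DifferentiableAt ℝ a x)
    (hb : DifferentiableAt ℝ b x) (i : Fin 2) :
    pd i (fun y => a y * b y) x = a x * pd i b x + pd i a x * b x := by
  simp [pd, fderiv_fun_mul ha hb, mul_comm]

theorem pd_comm {F : Plane → E} {Ω : Set Plane} (hF : ContDiffOn ℝ ∞ F Ω) (hΩ : IsOpen Ω)
    {x : Plane} (hx : x ∈ Ω) (i j : Fin 2) : pd i (pd j F) x = pd j (pd i F) x := by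
  have hF' := hF.contDiffAt (hΩ.mem_nhds hx)
  have hd : DifferentiableAt ℝ (fderiv ℝ F) x :=
    (hF'.fderiv_right (m := 1) (by norm_cast)).differentiableAt (by simp)
  have key : ∀ i j, pd i (pd j F) x = fderiv ℝ (fderiv ℝ F) x (coordVec i) (coordVec j) := by
    intro i j
    unfold pd
    rw [fderiv_clm_apply hd (by fun_prop)]
    simp
  rw [key, key]
  have h2 : (2 : WithTop ℕ∞) ≤ ∞ := by norm_cast
  exact (hF'.isSymmSndFDerivAt (by simpa using h2)) _ _

/-- A function smooth on an open set and zero off a compact subset of it is smooth. -/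
theorem contDiff_of_eq_zero_off_compact {F : Plane → E} {Ω K : Set Plane} (hF : ContDiffOn ℝ ∞ F Ω)
    (hΩ : IsOpen Ω) (hK : IsCompact K) (hKΩ : K ⊆ Ω) (h0 : ∀ x ∉ K, F x = 0) : ContDiff ℝ ∞ F := by
  rw [contDiff_iff_contDiffAt]
  intro x
  by_cases hx : x ∈ K
  · exact hF.contDiffAt (hΩ.mem_nhds (hKΩ hx))
  · have : F =ᶠ[𝓝 x] fun _ => 0 := by
      filter_upwards [hK.isClosed.isOpen_compl.mem_nhds hx] with y hy using h0 y hy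
    exact contDiffAt_const.congr_of_eventuallyEq this

theorem integrable_of_eq_zero_off_compact {F : Plane → E} {Ω K : Set Plane}
    (hF : ContDiffOn ℝ ∞ F Ω)
    (hΩ : IsOpen Ω) (hK : IsCompact K) (hKΩ : K ⊆ Ω) (h0 : ∀ x ∉ K, F x = 0) : Integrable F :=
  (contDiff_of_eq_zero_off_compact hF hΩ hK hKΩ h0).continuous.integrable_of_hasCompactSupport
    (HasCompactSupport.intro hK fun x hx => h0 x hx)

theorem pd_eq_zero_off_compact {F : Plane → E} {K : Set Plane} (hK : IsCompact K)
    (h0 : ∀ x ∉ K, F x = 0) (i : Fin 2) : ∀ x ∉ K, pd i F x = 0 := fun x hx =>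
  pd_eq_zero (by filter_upwards [hK.isClosed.isOpen_compl.mem_nhds hx] with y hy using h0 y hy) i

theorem integral_pd_eq_zero {F : Plane → ℝ} {Ω K : Set Plane} (hF : ContDiffOn ℝ ∞ F Ω)
    (hΩ : IsOpen Ω) (hK : IsCompact K) (hKΩ : K ⊆ Ω) (h0 : ∀ x ∉ K, F x = 0) (i : Fin 2) :
    ∫ x, pd i F x = 0 := by
  have hc := contDiff_of_eq_zero_off_compact hF hΩ hK hKΩ h0
  have i1 := integrable_of_eq_zero_off_compact (contDiffOn_pd hF hΩ i) hΩ hK hKΩ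
    (pd_eq_zero_off_compact hK h0 i)
  have i2 := integrable_of_eq_zero_off_compact hF hΩ hK hKΩ h0
  -- Integration by parts against the constant function 1.
  have := integral_mul_fderiv_eq_neg_fderiv_mul_of_integrable (μ := (volume : Measure Plane))
    (f := fun _ => (1 : ℝ)) (g := F) (v := coordVec i) (by simp) (by simp only [one_mul]; exact i1)
    (by simpa using i2) (fun _ _ => differentiableAt_const _)
    (fun x _ => hc.differentiable (by simp) x)
  simpa [pd] using this

end PartialDerivatives

/-! ### The Carleman estimate -/

section Carleman

/-- The elliptic quadratic form `((φ₁ + sφ₂)² + t²φ₂²) / t`, the square of the gradient of `φ` for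
the conformal structure with null direction `∂₁ + (s + it)∂₂`. -/
noncomputable def gradSq (s t φ : Plane → ℝ) (x : Plane) : ℝ :=
  (pd 0 φ x + s x * pd 1 φ x) ^ 2 / t x + t x * pd 1 φ x ^ 2

/-- The components of the gradient of `φ` for the conformal structure. -/
noncomputable def gradFst (s t φ : Plane → ℝ) (x : Plane) : ℝ :=
  (pd 0 φ x + s x * pd 1 φ x) / t x

noncomputable def gradSnd (s t φ : Plane → ℝ) (x : Plane) : ℝ :=
  s x * ((pd 0 φ x + s x * pd 1 φ x) / t x) + t x * pd 1 φ x

/-- The Laplacian `∂₁c₁ + ∂₂c₂` of `φ` for the conformal structure. -/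
noncomputable def lapl (s t φ : Plane → ℝ) (x : Plane) : ℝ :=
  pd 0 (gradFst s t φ) x + pd 1 (gradSnd s t φ) x

/-- The square of the modulus of `L(p + iq)`, where `L = ∂₁ + (s + it)∂₂`. -/
noncomputable def dbarSq (s t p q : Plane → ℝ) (x : Plane) : ℝ :=
  (pd 0 p x + s x * pd 1 p x - t x * pd 1 q x) ^ 2 +
    (pd 0 q x + s x * pd 1 q x + t x * pd 1 p x) ^ 2

variable {Ω K : Set Plane} {s t φ p q : Plane → ℝ}

theorem contDiffOn_gradFst (hΩ : IsOpen Ω) (hs : ContDiffOn ℝ ∞ s Ω) (ht : ContDiffOn ℝ ∞ t Ω)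
    (hφ : ContDiffOn ℝ ∞ φ Ω) (hpos : ∀ x ∈ Ω, 0 < t x) : ContDiffOn ℝ ∞ (gradFst s t φ) Ω :=
  ((contDiffOn_pd hφ hΩ 0).add (hs.mul (contDiffOn_pd hφ hΩ 1))).div ht fun x hx => (hpos x hx).ne'

theorem contDiffOn_gradSnd (hΩ : IsOpen Ω) (hs : ContDiffOn ℝ ∞ s Ω) (ht : ContDiffOn ℝ ∞ t Ω)
    (hφ : ContDiffOn ℝ ∞ φ Ω) (hpos : ∀ x ∈ Ω, 0 < t x) : ContDiffOn ℝ ∞ (gradSnd s t φ) Ω :=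
  (hs.mul (contDiffOn_gradFst hΩ hs ht hφ hpos)).add (ht.mul (contDiffOn_pd hφ hΩ 1))

theorem contDiffOn_lapl (hΩ : IsOpen Ω) (hs : ContDiffOn ℝ ∞ s Ω) (ht : ContDiffOn ℝ ∞ t Ω)
    (hφ : ContDiffOn ℝ ∞ φ Ω) (hpos : ∀ x ∈ Ω, 0 < t x) : ContDiffOn ℝ ∞ (lapl s t φ) Ω :=
  (contDiffOn_pd (contDiffOn_gradFst hΩ hs ht hφ hpos) hΩ 0).add
    (contDiffOn_pd (contDiffOn_gradSnd hΩ hs ht hφ hpos) hΩ 1)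

theorem contDiffOn_dbarSq (hΩ : IsOpen Ω) (hs : ContDiffOn ℝ ∞ s Ω) (ht : ContDiffOn ℝ ∞ t Ω)
    (hp : ContDiffOn ℝ ∞ p Ω) (hq : ContDiffOn ℝ ∞ q Ω) : ContDiffOn ℝ ∞ (dbarSq s t p q) Ω := by
  have h0 := contDiffOn_pd hp hΩ 0
  have h1 := contDiffOn_pd hp hΩ 1
  have h2 := contDiffOn_pd hq hΩ 0
  have h3 := contDiffOn_pd hq hΩ 1
  exact (((h0.add (hs.mul h1)).sub (ht.mul h3)).pow 2).add
    (((h2.add (hs.mul h3)).add (ht.mul h1)).pow 2)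

theorem pd_exp_two_mul {x : Plane} (hφ : DifferentiableAt ℝ φ x) (i : Fin 2) :
    pd i (fun y => Real.exp (2 * φ y)) x = 2 * pd i φ x * Real.exp (2 * φ x) := by
  have h : DifferentiableAt ℝ (fun y => 2 * φ y) x := hφ.const_mul 2
  simp [pd, fderiv_exp h, fderiv_const_mul hφ]
  ring

/-- A Carleman estimate for `L = ∂₁ + (s + it)∂₂` with an arbitrary weight `φ`. -/
theorem carleman (hΩ : IsOpen Ω) (hs : ContDiffOn ℝ ∞ s Ω) (ht : ContDiffOn ℝ ∞ t Ω)
    (hφ : ContDiffOn ℝ ∞ φ Ω) (hpos : ∀ x ∈ Ω, 0 < t x)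
    (hp : ContDiffOn ℝ ∞ p Ω) (hq : ContDiffOn ℝ ∞ q Ω) (hK : IsCompact K) (hKΩ : K ⊆ Ω)
    (hp0 : ∀ x ∉ K, p x = 0) (hq0 : ∀ x ∉ K, q x = 0) :
    ∫ x, 2 * Real.exp (2 * φ x) * lapl s t φ x * (p x ^ 2 + q x ^ 2) ≤
      ∫ x, Real.exp (2 * φ x) * (dbarSq s t p q x / t x) := by
  set c := gradFst s t φ with hc
  set d := gradSnd s t φ with hd
  have hcs : ContDiffOn ℝ ∞ c Ω := contDiffOn_gradFst hΩ hs ht hφ hpos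
  have hds : ContDiffOn ℝ ∞ d Ω := contDiffOn_gradSnd hΩ hs ht hφ hpos
  have hls : ContDiffOn ℝ ∞ (lapl s t φ) Ω := contDiffOn_lapl hΩ hs ht hφ hpos
  have hes : ContDiffOn ℝ ∞ (fun x => Real.exp (2 * φ x)) Ω := (contDiffOn_const.mul hφ).exp
  have hps := fun i => contDiffOn_pd hp hΩ i
  have hqs := fun i => contDiffOn_pd hq hΩ i
  have hp0' := fun i => pd_eq_zero_off_compact hK hp0 i
  have hq0' := fun i => pd_eq_zero_off_compact hK hq0 i
  -- With `w = p + iq`, the difference `(|L w|² - |L̄ w|²) / t` is four times a Jacobian of `p` and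
  -- `q`, hence a divergence whatever `s` and `t` are; this is why `t` is divided out. The second
  -- summands of `F` and `G` are `-2 |w|²` times the gradient of `φ`; their divergence produces the
  -- Laplacian.
  let F : Plane → ℝ := fun x => Real.exp (2 * φ x) *
    (2 * (q x * pd 1 p x - p x * pd 1 q x) - 2 * (c x * (p x * p x + q x * q x)))
  let G : Plane → ℝ := fun x => Real.exp (2 * φ x) *
    (2 * (p x * pd 0 q x - q x * pd 0 p x) - 2 * (d x * (p x * p x + q x * q x)))
  have hn : ContDiffOn ℝ ∞ (fun x => p x * p x + q x * q x) Ω := (hp.mul hp).add (hq.mul hq)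
  have hF : ContDiffOn ℝ ∞ F Ω := hes.mul
    ((contDiffOn_const.mul ((hq.mul (hps 1)).sub (hp.mul (hqs 1)))).sub
      (contDiffOn_const.mul (hcs.mul hn)))
  have hG : ContDiffOn ℝ ∞ G Ω := hes.mul
    ((contDiffOn_const.mul ((hp.mul (hqs 0)).sub (hq.mul (hps 0)))).sub
      (contDiffOn_const.mul (hds.mul hn)))
  have hF0 : ∀ x ∉ K, F x = 0 := fun x hx => by simp [F, hp0 x hx, hq0 x hx]
  have hG0 : ∀ x ∉ K, G x = 0 := fun x hx => by simp [G, hp0 x hx, hq0 x hx]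
  have iF := integral_pd_eq_zero hF hΩ hK hKΩ hF0 0
  have iG := integral_pd_eq_zero hG hΩ hK hKΩ hG0 1
  have jF := integrable_of_eq_zero_off_compact (contDiffOn_pd hF hΩ 0) hΩ hK hKΩ
    (pd_eq_zero_off_compact hK hF0 0)
  have jG := integrable_of_eq_zero_off_compact (contDiffOn_pd hG hΩ 1) hΩ hK hKΩ
    (pd_eq_zero_off_compact hK hG0 1)
  have jL : Integrable fun x => 2 * Real.exp (2 * φ x) * lapl s t φ x * (p x ^ 2 + q x ^ 2) :=
    integrable_of_eq_zero_off_compact (((contDiffOn_const.mul hes).mul hls).mul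
      ((hp.pow 2).add (hq.pow 2))) hΩ hK hKΩ fun x hx => by simp [hp0 x hx, hq0 x hx]
  have jR : Integrable fun x => Real.exp (2 * φ x) * (dbarSq s t p q x / t x) :=
    integrable_of_eq_zero_off_compact (hes.mul ((contDiffOn_dbarSq hΩ hs ht hp hq).div ht
      fun x hx => (hpos x hx).ne')) hΩ hK hKΩ fun x hx => by
        simp [dbarSq, hp0' _ x hx, hq0' _ x hx]
  have key : ∫ x, (2 * Real.exp (2 * φ x) * lapl s t φ x * (p x ^ 2 + q x ^ 2) +
      (pd 0 F x + pd 1 G x)) ≤ ∫ x, Real.exp (2 * φ x) * (dbarSq s t p q x / t x) := by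
    refine integral_mono (jL.add (jF.add jG)) jR fun x => ?_
    by_cases hx : x ∈ K
    swap
    · simp [hp0 x hx, hq0 x hx, dbarSq, hp0' _ x hx, hq0' _ x hx,
        pd_eq_zero_off_compact hK hF0 0 x hx, pd_eq_zero_off_compact hK hG0 1 x hx]
    have hxΩ := hKΩ hx
    have D : ∀ {f : Plane → ℝ}, ContDiffOn ℝ ∞ f Ω → DifferentiableAt ℝ f x :=
      fun h => differentiableAt_of_contDiffOn h hΩ hxΩ
    have dp := D hp
    have dq := D hq
    have dps := fun i => D (hps i)
    have dqs := fun i => D (hqs i)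
    have dc := D hcs
    have dd := D hds
    have dn := D hn
    have eF : pd 0 F x = Real.exp (2 * φ x) * (2 * ((q x * pd 0 (pd 1 p) x + pd 0 q x * pd 1 p x) -
        (p x * pd 0 (pd 1 q) x + pd 0 p x * pd 1 q x)) - 2 * (c x * (2 * p x * pd 0 p x +
        2 * q x * pd 0 q x) + pd 0 c x * (p x ^ 2 + q x ^ 2))) +
        2 * pd 0 φ x * Real.exp (2 * φ x) *
        (2 * (q x * pd 1 p x - p x * pd 1 q x) - 2 * (c x * (p x * p x + q x * q x))) := by
      rw [pd_mul (D hes) (by fun_prop), pd_exp_two_mul (D hφ), pd_sub (by fun_prop) (by fun_prop),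
        pd_mul (by fun_prop) (by fun_prop), pd_mul (by fun_prop) (by fun_prop),
        pd_mul (by fun_prop) (by fun_prop), pd_sub (by fun_prop) (by fun_prop),
        pd_mul (by fun_prop) (by fun_prop), pd_mul (by fun_prop) (by fun_prop),
        pd_add (by fun_prop) (by fun_prop),
        pd_mul (by fun_prop) (by fun_prop), pd_mul (by fun_prop) (by fun_prop), pd_const]
      ring
    have eG : pd 1 G x = Real.exp (2 * φ x) * (2 * ((p x * pd 0 (pd 1 q) x + pd 1 p x * pd 0 q x) -
        (q x * pd 0 (pd 1 p) x + pd 1 q x * pd 0 p x)) - 2 * (d x * (2 * p x * pd 1 p x +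
        2 * q x * pd 1 q x) + pd 1 d x * (p x ^ 2 + q x ^ 2))) +
        2 * pd 1 φ x * Real.exp (2 * φ x) *
        (2 * (p x * pd 0 q x - q x * pd 0 p x) - 2 * (d x * (p x * p x + q x * q x))) := by
      rw [pd_comm hp hΩ hxΩ 0 1, pd_comm hq hΩ hxΩ 0 1,
        pd_mul (D hes) (by fun_prop), pd_exp_two_mul (D hφ), pd_sub (by fun_prop) (by fun_prop),
        pd_mul (by fun_prop) (by fun_prop), pd_mul (by fun_prop) (by fun_prop),
        pd_mul (by fun_prop) (by fun_prop), pd_sub (by fun_prop) (by fun_prop),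
        pd_mul (by fun_prop) (by fun_prop), pd_mul (by fun_prop) (by fun_prop),
        pd_add (by fun_prop) (by fun_prop),
        pd_mul (by fun_prop) (by fun_prop), pd_mul (by fun_prop) (by fun_prop), pd_const]
      ring
    have ht0 := hpos x hxΩ
    -- After completing the square, what remains is `e^{2φ} |L̄ w + 2 (L̄ φ) w|² / t`, which is
    -- nonnegative.
    have hmain : Real.exp (2 * φ x) * (dbarSq s t p q x / t x) -
        (2 * Real.exp (2 * φ x) * lapl s t φ x * (p x ^ 2 + q x ^ 2) + (pd 0 F x + pd 1 G x)) =
        Real.exp (2 * φ x) / t x *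
        ((pd 0 p x + s x * pd 1 p x + t x * pd 1 q x + (2 * (pd 0 φ x + s x * pd 1 φ x) * p x +
          2 * t x * pd 1 φ x * q x)) ^ 2 +
         (pd 0 q x + s x * pd 1 q x - t x * pd 1 p x + (2 * (pd 0 φ x + s x * pd 1 φ x) * q x -
          2 * t x * pd 1 φ x * p x)) ^ 2) := by
      rw [eF, eG]
      simp only [lapl, ← hc, ← hd]
      rw [hc, hd]
      simp only [gradFst, gradSnd, dbarSq]
      field_simp
      ring
    have : 0 ≤ Real.exp (2 * φ x) / t x *
        ((pd 0 p x + s x * pd 1 p x + t x * pd 1 q x + (2 * (pd 0 φ x + s x * pd 1 φ x) * p x +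
          2 * t x * pd 1 φ x * q x)) ^ 2 +
         (pd 0 q x + s x * pd 1 q x - t x * pd 1 p x + (2 * (pd 0 φ x + s x * pd 1 φ x) * q x -
          2 * t x * pd 1 φ x * p x)) ^ 2) := by positivity
    change _ ≤ _
    linarith
  have jFG : Integrable fun x => pd 0 F x + pd 1 G x := jF.add jG
  rw [integral_add jL jFG, integral_add jF jG, iF, iG] at key
  simpa using key

end Carleman

/-! ### Unique continuation for perturbed Cauchy-Riemann equations -/

section UniqueContinuation

/-- The square of the Euclidean distance to `x₀`. -/
noncomputable def sqDist (x₀ x : Plane) : ℝ := (x 0 - x₀ 0) ^ 2 + (x 1 - x₀ 1) ^ 2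

theorem sqDist_eq (x₀ x : Plane) : sqDist x₀ x = dist x x₀ ^ 2 := by
  rw [EuclideanSpace.dist_eq, Real.sq_sqrt (by positivity)]
  simp [sqDist, Real.dist_eq, sq_abs]

theorem contDiff_sqDist (x₀ : Plane) : ContDiff ℝ ∞ (sqDist x₀) := by
  unfold sqDist; fun_prop

theorem hasFDerivAt_coord (i : Fin 2) (x : Plane) :
    HasFDerivAt (fun y : Plane => y i) (EuclideanSpace.proj i : Plane →L[ℝ] ℝ) x :=
  (EuclideanSpace.proj i : Plane →L[ℝ] ℝ).hasFDerivAt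

theorem pd_sqDist (x₀ x : Plane) (i : Fin 2) : pd i (sqDist x₀) x = 2 * (x i - x₀ i) := by
  have h := (((hasFDerivAt_coord 0 x).sub_const (x₀ 0)).pow 2).add
    (((hasFDerivAt_coord 1 x).sub_const (x₀ 1)).pow 2)
  have h' : fderiv ℝ (sqDist x₀) x = _ := h.fderiv
  rw [pd, h']
  fin_cases i <;> simp [coordVec]

variable {Ω : Set Plane} {s t p q : Plane → ℝ}

theorem contDiffOn_gradSq {φ : Plane → ℝ} (hΩ : IsOpen Ω) (hs : ContDiffOn ℝ ∞ s Ω)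
    (ht : ContDiffOn ℝ ∞ t Ω)
    (hφ : ContDiffOn ℝ ∞ φ Ω) (hpos : ∀ x ∈ Ω, 0 < t x) : ContDiffOn ℝ ∞ (gradSq s t φ) Ω :=
  ((((contDiffOn_pd hφ hΩ 0).add (hs.mul (contDiffOn_pd hφ hΩ 1))).pow 2).div ht
    fun x hx => (hpos x hx).ne').add (ht.mul ((contDiffOn_pd hφ hΩ 1).pow 2))

theorem gradSq_sqDist_pos {x₀ x : Plane} (ht : 0 < t x) (hx : x ≠ x₀) :
    0 < gradSq s t (sqDist x₀) x := by
  unfold gradSq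
  by_cases h1 : x 1 = x₀ 1
  · have h0 : x 0 ≠ x₀ 0 := fun h0 => hx (by ext i; fin_cases i <;> assumption)
    have : 0 < (2 * (x 0 - x₀ 0)) ^ 2 := by
      have := sub_ne_zero.2 h0
      positivity
    simp only [pd_sqDist, h1, sub_self, mul_zero, add_zero]
    positivity
  · have := sub_ne_zero.2 h1
    simp only [pd_sqDist]
    positivity

theorem pd_weight {g : Plane → ℝ} {x : Plane} (hg : DifferentiableAt ℝ g x) (a k : ℝ) (i : Fin 2) :
    pd i (fun y => a * Real.exp (-k * g y)) x = -(k * a * Real.exp (-k * g x)) * pd i g x := by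
  have h : DifferentiableAt ℝ (fun y => -k * g y) x := hg.const_mul _
  simp only [pd]
  rw [fderiv_const_mul (by fun_prop), fderiv_exp h, fderiv_const_mul hg]
  simp
  ring

/-- Chain rule for the divergence. The term quadratic in `k` carries the squared gradient of `g`, so
it wins for large `k` wherever `g` has no critical point. -/
theorem lapl_weight {g : Plane → ℝ} (hΩ : IsOpen Ω) (hs : ContDiffOn ℝ ∞ s Ω)
    (ht : ContDiffOn ℝ ∞ t Ω) (hg : ContDiff ℝ ∞ g) (hpos : ∀ x ∈ Ω, 0 < t x) (a k : ℝ)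
    {x : Plane} (hx : x ∈ Ω) :
    lapl s t (fun y => a * Real.exp (-k * g y)) x =
      a * (k * Real.exp (-k * g x) * (k * gradSq s t g x - lapl s t g x)) := by
  have hgd : ∀ y, DifferentiableAt ℝ g y := fun y => hg.differentiable (by simp) y
  have hF := contDiffOn_gradFst hΩ hs ht hg.contDiffOn hpos
  have hS := contDiffOn_gradSnd hΩ hs ht hg.contDiffOn hpos
  have h1 : gradFst s t (fun y => a * Real.exp (-k * g y)) =
      fun y => (-(k * a) * Real.exp (-k * g y)) * gradFst s t g y := by
    ext y
    simp only [gradFst, pd_weight (hgd y)]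
    ring
  have h2 : gradSnd s t (fun y => a * Real.exp (-k * g y)) =
      fun y => (-(k * a) * Real.exp (-k * g y)) * gradSnd s t g y := by
    ext y
    simp only [gradSnd, pd_weight (hgd y)]
    ring
  have hE : DifferentiableAt ℝ (fun y => -(k * a) * Real.exp (-k * g y)) x := by
    have := hgd x
    fun_prop
  rw [lapl, h1, h2, pd_mul hE (differentiableAt_of_contDiffOn hF hΩ hx),
    pd_mul hE (differentiableAt_of_contDiffOn hS hΩ hx), pd_weight (hgd x), pd_weight (hgd x)]
  have := hpos x hx
  simp only [lapl, gradSq]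
  have e1 : gradFst s t g x = (pd 0 g x + s x * pd 1 g x) / t x := rfl
  have e2 : gradSnd s t g x = s x * ((pd 0 g x + s x * pd 1 g x) / t x) + t x * pd 1 g x := rfl
  rw [e1, e2]
  field_simp
  ring

/-- The functions `a exp (-k |x - x₀|²)` with `k` large are subharmonic on an annulus. -/
theorem exists_subharmonic_weight (hΩ : IsOpen Ω) (hs : ContDiffOn ℝ ∞ s Ω)
    (ht : ContDiffOn ℝ ∞ t Ω) (hpos : ∀ x ∈ Ω, 0 < t x) {x₀ : Plane} {r R : ℝ} (hr : 0 < r)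
    (hB : Metric.closedBall x₀ R ⊆ Ω) :
    ∃ k > 0, ∃ d > 0, ∀ a ≥ 0, ∀ x ∈ Metric.closedBall x₀ R \ Metric.ball x₀ r,
      a * d ≤ lapl s t (fun y => a * Real.exp (-k * sqDist x₀ y)) x := by
  have hA : IsCompact (Metric.closedBall x₀ R \ Metric.ball x₀ r) :=
    (isCompact_closedBall x₀ R).diff Metric.isOpen_ball
  have hAΩ : Metric.closedBall x₀ R \ Metric.ball x₀ r ⊆ Ω := sdiff_subset.trans hB
  have hρ := (contDiff_sqDist x₀).contDiffOn (s := Ω)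
  obtain ⟨c, hc, hcA⟩ := hA.exists_forall_le' (a := 0)
    ((contDiffOn_gradSq hΩ hs ht hρ hpos).continuousOn.mono hAΩ) fun x hx =>
      gradSq_sqDist_pos (hpos x (hAΩ hx)) fun h => hx.2 (by simpa [h] using hr)
  obtain ⟨M, hM⟩ := hA.bddAbove_image
    ((contDiffOn_lapl hΩ hs ht hρ hpos).continuousOn.mono hAΩ)
  have hM' : ∀ x ∈ Metric.closedBall x₀ R \ Metric.ball x₀ r, lapl s t (sqDist x₀) x ≤ |M| :=
    fun x hx => (hM (mem_image_of_mem _ hx)).trans (le_abs_self M)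
  have hk : 0 < (|M| + 1) / c := by positivity
  -- This `k` makes `k |∇ρ|² - Δρ ≥ |M| + 1 - |M| = 1`, where `ρ` is the squared distance. The
  -- remaining factor `k exp (-kρ)` is smallest at `ρ = R²`, which gives `d`.
  refine ⟨(|M| + 1) / c, hk, (|M| + 1) / c * Real.exp (-((|M| + 1) / c) * R ^ 2), by positivity,
    fun a ha x hx => ?_⟩
  rw [lapl_weight hΩ hs ht (contDiff_sqDist x₀) hpos _ _ (hAΩ hx)]
  set k := (|M| + 1) / c
  have h1 : 1 ≤ k * gradSq s t (sqDist x₀) x - lapl s t (sqDist x₀) x := by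
    have := mul_le_mul_of_nonneg_left (hcA x hx) hk.le
    have h2 : k * c = |M| + 1 := by simp only [k]; field_simp
    have := hM' x hx
    linarith
  have h2 : sqDist x₀ x ≤ R ^ 2 := by
    rw [sqDist_eq]
    exact pow_le_pow_left₀ dist_nonneg (Metric.mem_closedBall.1 hx.1) 2
  have h3 : Real.exp (-k * R ^ 2) ≤ Real.exp (-k * sqDist x₀ x) := by
    apply Real.exp_le_exp.2
    nlinarith
  refine mul_le_mul_of_nonneg_left ?_ ha
  calc k * Real.exp (-k * R ^ 2) ≤ k * Real.exp (-k * sqDist x₀ x) * 1 := by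
        rw [mul_one]; exact mul_le_mul_of_nonneg_left h3 hk.le
    _ ≤ _ := mul_le_mul_of_nonneg_left h1 (by positivity)

/-- Unique continuation for the inequality `|L(p + iq)|² ≤ κ |p + iq|²`, where
`L = ∂₁ + (s + it)∂₂`, `t > 0`, from a ball to a larger concentric ball. -/
theorem unique_continuation_aux (hΩ : IsOpen Ω) (hs : ContDiffOn ℝ ∞ s Ω)
    (ht : ContDiffOn ℝ ∞ t Ω) (hpos : ∀ x ∈ Ω, 0 < t x) (hp : ContDiffOn ℝ ∞ p Ω)
    (hq : ContDiffOn ℝ ∞ q Ω) {x₀ : Plane} {r R R' κ : ℝ} (hr : 0 < r) (hR' : 0 < R') (hR : R' < R)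
    (hκ : 0 ≤ κ) (hB : Metric.closedBall x₀ R ⊆ Ω)
    (hL : ∀ x ∈ Metric.closedBall x₀ R, dbarSq s t p q x ≤ κ * (p x ^ 2 + q x ^ 2))
    (h0 : ∀ x ∈ Metric.ball x₀ r, p x = 0 ∧ q x = 0) :
    ∫ x in Metric.ball x₀ R', p x ^ 2 + q x ^ 2 = 0 := by
  obtain ⟨k, hk, d, hd, hlap⟩ := exists_subharmonic_weight hΩ hs ht hpos hr hB
  have hKc : IsCompact (Metric.closedBall x₀ R) := isCompact_closedBall x₀ R
  obtain ⟨t₀, ht₀, htB⟩ := hKc.exists_forall_le' (a := 0) (ht.continuousOn.mono hB)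
    fun x hx => hpos x (hB hx)
  -- The cutoff changes the equation only outside the ball of radius `R'`, where the radially
  -- decreasing weight is smallest.
  let χ : ContDiffBump x₀ := ⟨R', R, hR', hR⟩
  let u : Plane → ℝ := fun x => χ x * p x
  let v : Plane → ℝ := fun x => χ x * q x
  have hχ : ContDiffOn ℝ ∞ (fun x => χ x) Ω := χ.contDiff.contDiffOn
  have hu : ContDiffOn ℝ ∞ u Ω := hχ.mul hp
  have hv : ContDiffOn ℝ ∞ v Ω := hχ.mul hq
  have hχ0 : ∀ x ∉ Metric.closedBall x₀ R, χ x = 0 := fun x hx =>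
    χ.zero_of_le_dist (by rw [Metric.mem_closedBall, not_le] at hx; exact hx.le)
  have hu0 : ∀ x ∉ Metric.closedBall x₀ R, u x = 0 := fun x hx => by simp [u, hχ0 x hx]
  have hv0 : ∀ x ∉ Metric.closedBall x₀ R, v x = 0 := fun x hx => by simp [v, hχ0 x hx]
  have hur : ∀ x ∈ Metric.ball x₀ r, u x = 0 ∧ v x = 0 := fun x hx => by
    simp [u, v, (h0 x hx).1, (h0 x hx).2]
  have huR : ∀ x ∈ Metric.ball x₀ R', u x = p x ∧ v x = q x := fun x hx => by
    have : χ x = 1 := χ.one_of_mem_closedBall (Metric.ball_subset_closedBall hx)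
    simp [u, v, this]
  have hLu : ∀ x ∈ Metric.ball x₀ R', dbarSq s t u v x ≤ κ * (u x ^ 2 + v x ^ 2) := by
    intro x hx
    have e1 : u =ᶠ[𝓝 x] p := by
      filter_upwards [Metric.isOpen_ball.mem_nhds hx] with y hy using (huR y hy).1
    have e2 : v =ᶠ[𝓝 x] q := by
      filter_upwards [Metric.isOpen_ball.mem_nhds hx] with y hy using (huR y hy).2
    have := hL x (Metric.ball_subset_closedBall (Metric.ball_subset_ball hR.le hx))
    simpa only [dbarSq, pd_congr e1, pd_congr e2, e1.eq_of_nhds, e2.eq_of_nhds] using this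
  have hdu0 : ∀ x ∉ Metric.closedBall x₀ R, dbarSq s t u v x = 0 := fun x hx => by
    simp [dbarSq, pd_eq_zero_off_compact hKc hu0 _ x hx, pd_eq_zero_off_compact hKc hv0 _ x hx]
  set E : Plane → ℝ := fun x => dbarSq s t u v x / t x with hE
  have hEs : ContDiffOn ℝ ∞ E Ω :=
    (contDiffOn_dbarSq hΩ hs ht hu hv).div ht fun x hx => (hpos x hx).ne'
  have hE0 : ∀ x ∉ Metric.closedBall x₀ R, E x = 0 := fun x hx => by simp [hE, hdu0 x hx]
  have iE : Integrable E := integrable_of_eq_zero_off_compact hEs hΩ hKc hB hE0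
  have hn : ContDiffOn ℝ ∞ (fun x => u x ^ 2 + v x ^ 2) Ω := (hu.pow 2).add (hv.pow 2)
  have hn0 : ∀ x ∉ Metric.closedBall x₀ R, u x ^ 2 + v x ^ 2 = 0 := fun x hx => by
    simp [hu0 x hx, hv0 x hx]
  have hEnn : ∀ x, 0 ≤ E x := by
    intro x
    by_cases hx : x ∈ Metric.closedBall x₀ R
    · have := hpos x (hB hx)
      simp only [hE, dbarSq]
      positivity
    · rw [hE0 x hx]
  set J : ℝ := ∫ x in Metric.ball x₀ R', p x ^ 2 + q x ^ 2 with hJ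
  have hJnn : 0 ≤ J := integral_nonneg fun x => by positivity
  -- the Carleman estimate with weight `a exp (-k |x - x₀|²)`
  have main : ∀ a : ℝ, 0 ≤ a → κ / t₀ ≤ 2 * (a * d) → (2 * (a * d) - κ / t₀) * J ≤ ∫ x, E x := by
    intro a ha hka
    set φ : Plane → ℝ := fun y => a * Real.exp (-k * sqDist x₀ y) with hφd
    have hφ : ContDiff ℝ ∞ φ := contDiff_const.mul ((contDiff_const.mul (contDiff_sqDist x₀)).exp)
    have hes : ContDiffOn ℝ ∞ (fun x => Real.exp (2 * φ x)) Ω :=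
      (contDiff_const.mul hφ).exp.contDiffOn
    have hC := carleman hΩ hs ht hφ.contDiffOn hpos hu hv hKc hB hu0 hv0
    -- The value of the weight on the sphere of radius `R'`: a lower bound inside and an upper bound
    -- outside.
    set b : ℝ := Real.exp (2 * (a * Real.exp (-k * R' ^ 2))) with hb
    have hb0 : 0 < b := Real.exp_pos _
    have hball : ∀ x ∈ Metric.ball x₀ R', b ≤ Real.exp (2 * φ x) := by
      intro x hx
      have : sqDist x₀ x ≤ R' ^ 2 := by
        rw [sqDist_eq]
        exact pow_le_pow_left₀ dist_nonneg (Metric.mem_ball.1 hx).le 2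
      have : Real.exp (-k * R' ^ 2) ≤ Real.exp (-k * sqDist x₀ x) :=
        Real.exp_le_exp.2 (by nlinarith)
      exact Real.exp_le_exp.2 (mul_le_mul_of_nonneg_left (mul_le_mul_of_nonneg_left this ha)
        (by norm_num))
    have hcompl : ∀ x ∉ Metric.ball x₀ R', Real.exp (2 * φ x) ≤ b := by
      intro x hx
      have : R' ^ 2 ≤ sqDist x₀ x := by
        rw [sqDist_eq]
        rw [Metric.mem_ball, not_lt] at hx
        exact pow_le_pow_left₀ hR'.le hx 2
      have : Real.exp (-k * sqDist x₀ x) ≤ Real.exp (-k * R' ^ 2) :=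
        Real.exp_le_exp.2 (by nlinarith)
      exact Real.exp_le_exp.2 (mul_le_mul_of_nonneg_left (mul_le_mul_of_nonneg_left this ha)
        (by norm_num))
    set N : Plane → ℝ := fun x => Real.exp (2 * φ x) * (u x ^ 2 + v x ^ 2) with hN
    have iN : Integrable N := integrable_of_eq_zero_off_compact (hes.mul hn) hΩ hKc hB
      fun x hx => by simp only [hN, hn0 x hx, mul_zero]
    have hNnn : ∀ x, 0 ≤ N x := fun x => by simp only [hN]; positivity
    have lower : 2 * (a * d) * ∫ x, N x ≤
        ∫ x, 2 * Real.exp (2 * φ x) * lapl s t φ x * (u x ^ 2 + v x ^ 2) := by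
      rw [← integral_const_mul]
      refine integral_mono (iN.const_mul _) (integrable_of_eq_zero_off_compact
        (((contDiffOn_const.mul hes).mul (contDiffOn_lapl hΩ hs ht hφ.contDiffOn hpos)).mul hn)
        hΩ hKc hB fun x hx => by simp only [hn0 x hx, mul_zero]) fun x => ?_
      change 2 * (a * d) * (Real.exp (2 * φ x) * (u x ^ 2 + v x ^ 2)) ≤
        2 * Real.exp (2 * φ x) * lapl s t φ x * (u x ^ 2 + v x ^ 2)
      by_cases hx : x ∈ Metric.closedBall x₀ R
      · by_cases hxr : x ∈ Metric.ball x₀ r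
        · simp [(hur x hxr).1, (hur x hxr).2]
        · have := hlap a ha x ⟨hx, hxr⟩
          have h2 : 0 ≤ 2 * Real.exp (2 * φ x) * (u x ^ 2 + v x ^ 2) := by positivity
          nlinarith [mul_le_mul_of_nonneg_left this h2]
      · rw [hn0 x hx]; simp
    -- Inside the ball of radius `R'` the differential inequality applies. Outside, no control of
    -- the equation is needed, since the weight is at most `b`.
    have upper : ∫ x, Real.exp (2 * φ x) * (dbarSq s t u v x / t x) ≤
        κ / t₀ * (∫ x, N x) + b * ∫ x, E x := by
      rw [← integral_const_mul, ← integral_const_mul,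
        ← integral_add (iN.const_mul _) (iE.const_mul _)]
      refine integral_mono (integrable_of_eq_zero_off_compact (hes.mul hEs) hΩ hKc hB
        fun x hx => by simp [hdu0 x hx]) ((iN.const_mul _).add (iE.const_mul _)) fun x => ?_
      change Real.exp (2 * φ x) * E x ≤ κ / t₀ * N x + b * E x
      by_cases hx : x ∈ Metric.ball x₀ R'
      · have hxR := Metric.ball_subset_closedBall (Metric.ball_subset_ball hR.le hx)
        have h1 : E x ≤ κ / t₀ * (u x ^ 2 + v x ^ 2) := by
          have h2 := hLu x hx
          have h3 := htB x hxR
          have h4 : 0 ≤ κ * (u x ^ 2 + v x ^ 2) := by positivity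
          calc E x ≤ κ * (u x ^ 2 + v x ^ 2) / t x :=
                div_le_div_of_nonneg_right h2 (hpos x (hB hxR)).le
            _ ≤ κ * (u x ^ 2 + v x ^ 2) / t₀ := div_le_div_of_nonneg_left h4 ht₀ h3
            _ = _ := by ring
        have h5 := mul_le_mul_of_nonneg_left h1 (Real.exp_pos (2 * φ x)).le
        have h6 := mul_nonneg hb0.le (hEnn x)
        simp only [hN]
        linarith
      · have h5 := mul_le_mul_of_nonneg_right (hcompl x hx) (hEnn x)
        have h6 : 0 ≤ κ / t₀ * N x := mul_nonneg (by positivity) (hNnn x)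
        linarith
    have hJN : b * J ≤ ∫ x, N x := by
      rw [hJ, ← integral_const_mul]
      refine (setIntegral_mono_on ?_ iN.integrableOn measurableSet_ball fun x hx => ?_).trans
        (setIntegral_le_integral iN (Eventually.of_forall hNnn))
      · have hc : ContinuousOn (fun x => b * (p x ^ 2 + q x ^ 2)) (Metric.closedBall x₀ R) :=
          (continuousOn_const.mul ((hp.continuousOn.pow 2).add (hq.continuousOn.pow 2))).mono hB
        exact (hc.integrableOn_compact hKc).mono_set
          ((Metric.ball_subset_ball hR.le).trans Metric.ball_subset_closedBall)
      · simp only [hN, (huR x hx).1, (huR x hx).2]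
        exact mul_le_mul_of_nonneg_right (hball x hx) (by positivity)
    have h7 : (2 * (a * d) - κ / t₀) * (b * J) ≤ b * ∫ x, E x := by
      have := mul_le_mul_of_nonneg_left hJN (sub_nonneg.2 hka)
      nlinarith
    refine le_of_mul_le_mul_left ?_ hb0
    linarith
  by_contra hne
  have hJpos : 0 < J := lt_of_le_of_ne hJnn (Ne.symm hne)
  have hIE : 0 ≤ ∫ x, E x := integral_nonneg hEnn
  have hκt : 0 ≤ κ / t₀ := by positivity
  -- With this `a`, the factor `2ad - κ/t₀` equals `(∫ E)/J + 1`, and the estimate reads `∫ E + J ≤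
  -- ∫ E`, contradicting `J > 0`.
  have := main (((∫ x, E x) / J + 1 + κ / t₀) / (2 * d)) (by positivity)
    (by field_simp; have : 0 ≤ (∫ x, E x) / J := by positivity
        field_simp at this ⊢; nlinarith)
  have h8 : 2 * (((∫ x, E x) / J + 1 + κ / t₀) / (2 * d) * d) = (∫ x, E x) / J + 1 + κ / t₀ := by
    field_simp
  rw [h8] at this
  have h9 : (∫ x, E x) / J * J = ∫ x, E x := by field_simp
  nlinarith

theorem unique_continuation (hΩ : IsOpen Ω) (hs : ContDiffOn ℝ ∞ s Ω)
    (ht : ContDiffOn ℝ ∞ t Ω) (hpos : ∀ x ∈ Ω, 0 < t x) (hp : ContDiffOn ℝ ∞ p Ω)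
    (hq : ContDiffOn ℝ ∞ q Ω) {x₀ : Plane} {r R κ : ℝ} (hr : 0 < r)
    (hκ : 0 ≤ κ) (hB : Metric.closedBall x₀ R ⊆ Ω)
    (hL : ∀ x ∈ Metric.closedBall x₀ R, dbarSq s t p q x ≤ κ * (p x ^ 2 + q x ^ 2))
    (h0 : ∀ x ∈ Metric.ball x₀ r, p x = 0 ∧ q x = 0) :
    ∀ x ∈ Metric.ball x₀ R, p x = 0 ∧ q x = 0 := by
  intro x hx
  obtain ⟨R', hxR', hR'⟩ := exists_between (Metric.mem_ball.1 hx)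
  have hR'0 : 0 < R' := dist_nonneg.trans_lt hxR'
  have hint := unique_continuation_aux hΩ hs ht hpos hp hq hr hR'0 hR' hκ hB hL h0
  have hsub : Metric.ball x₀ R' ⊆ Metric.closedBall x₀ R :=
    (Metric.ball_subset_ball hR'.le).trans Metric.ball_subset_closedBall
  have hc : ContinuousOn (fun x => p x ^ 2 + q x ^ 2) (Metric.closedBall x₀ R) :=
    ((hp.continuousOn.pow 2).add (hq.continuousOn.pow 2)).mono hB
  have hi : IntegrableOn (fun x => p x ^ 2 + q x ^ 2) (Metric.ball x₀ R') :=
    (hc.integrableOn_compact (isCompact_closedBall x₀ R)).mono_set hsub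
  have hae := (setIntegral_eq_zero_iff_of_nonneg_ae
    (Eventually.of_forall fun x => by positivity) hi).1 hint
  have heq : EqOn (fun x => p x ^ 2 + q x ^ 2) 0 (Metric.ball x₀ R') :=
    Measure.eqOn_open_of_ae_eq hae Metric.isOpen_ball (hc.mono hsub) continuousOn_const
  have := heq (Metric.mem_ball.2 hxR')
  simp only [Pi.zero_apply] at this
  constructor <;> nlinarith [sq_nonneg (p x), sq_nonneg (q x)]

end UniqueContinuation

/-! ### Lorentzian linear algebra of spacelike planes and their normals -/

section LinearAlgebra

theorem lor_comm (x y : L4) : lor x y = lor y x := by unfold lor; ring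

theorem lor_add_left (x y z : L4) : lor (x + y) z = lor x z + lor y z := by
  simp only [lor, Pi.add_apply]; ring

theorem lor_add_right (x y z : L4) : lor x (y + z) = lor x y + lor x z := by
  simp only [lor, Pi.add_apply]; ring

theorem lor_sub_left (x y z : L4) : lor (x - y) z = lor x z - lor y z := by
  simp only [lor, Pi.sub_apply]; ring

theorem lor_sub_right (x y z : L4) : lor x (y - z) = lor x y - lor x z := by
  simp only [lor, Pi.sub_apply]; ring

theorem lor_smul_left (c : ℝ) (x y : L4) : lor (c • x) y = c * lor x y := by
  simp only [lor, Pi.smul_apply, smul_eq_mul]; ring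

theorem lor_smul_right (c : ℝ) (x y : L4) : lor x (c • y) = c * lor x y := by
  simp only [lor, Pi.smul_apply, smul_eq_mul]; ring

theorem lor_neg_left (x y : L4) : lor (-x) y = -lor x y := by
  simp only [lor, Pi.neg_apply]; ring

theorem lor_zero_left (y : L4) : lor 0 y = 0 := by simp [lor]

theorem lor_zero_right (y : L4) : lor y 0 = 0 := by simp [lor]

theorem eq_zero_of_lor_eq_zero {x : L4} (h : ∀ y, lor x y = 0) : x = 0 := by
  ext i
  have := h (Pi.single i 1)
  fin_cases i <;> simpa [lor] using this

/-- The Gram determinant of two vectors. -/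
def gramDet (a b : L4) : ℝ := lor a a * lor b b - lor a b ^ 2

/-- The coefficient of `a` in the component of `w` in the plane spanned by `a` and `b`. -/
noncomputable def tanFst (a b w : L4) : ℝ := (lor w a * lor b b - lor w b * lor a b) / gramDet a b

/-- The coefficient of `b` in the component of `w` in the plane spanned by `a` and `b`. -/
noncomputable def tanSnd (a b w : L4) : ℝ := (lor w b * lor a a - lor w a * lor a b) / gramDet a b

/-- The component of `w` orthogonal to `a` and `b`. -/
noncomputable def perp (a b w : L4) : L4 := w - (tanFst a b w • a + tanSnd a b w • b)

variable {a b : L4}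

theorem lor_perp_fst (h : gramDet a b ≠ 0) (w : L4) : lor (perp a b w) a = 0 := by
  simp only [perp, lor_sub_left, lor_add_left, lor_smul_left, tanFst, tanSnd, lor_comm b a]
  field_simp
  unfold gramDet
  ring

theorem lor_perp_snd (h : gramDet a b ≠ 0) (w : L4) : lor (perp a b w) b = 0 := by
  simp only [perp, lor_sub_left, lor_add_left, lor_smul_left, tanFst, tanSnd]
  field_simp
  unfold gramDet
  ring

/-- A vector orthogonal to `a`, `b` and to everything orthogonal to `a` and `b` vanishes. -/
theorem eq_zero_of_orthogonal (h : gramDet a b ≠ 0) {x : L4} (ha : lor x a = 0) (hb : lor x b = 0)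
    (hN : ∀ n, lor n a = 0 → lor n b = 0 → lor x n = 0) : x = 0 := by
  refine eq_zero_of_lor_eq_zero fun y => ?_
  have hy : y = perp a b y + (tanFst a b y • a + tanSnd a b y • b) := by simp [perp]
  rw [hy, lor_add_right, lor_add_right, lor_smul_right, lor_smul_right, ha, hb,
    hN _ (lor_perp_fst h y) (lor_perp_snd h y)]
  ring

theorem eq_tan_of_orthogonal (h : gramDet a b ≠ 0) {x : L4}
    (hN : ∀ n, lor n a = 0 → lor n b = 0 → lor x n = 0) :
    x = tanFst a b x • a + tanSnd a b x • b := by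
  rw [← sub_eq_zero]
  refine eq_zero_of_orthogonal h (lor_perp_fst h x) (lor_perp_snd h x) fun n ha hb => ?_
  rw [lor_sub_left, lor_add_left, lor_smul_left, lor_smul_left, hN n ha hb, lor_comm a, lor_comm b,
    ha, hb]
  ring

theorem tanFst_comb (h : gramDet a b ≠ 0) (x y : ℝ) : tanFst a b (x • a + y • b) = x := by
  simp only [tanFst, lor_add_left, lor_smul_left, lor_comm b a]
  field_simp
  unfold gramDet
  ring

theorem tanSnd_comb (h : gramDet a b ≠ 0) (x y : ℝ) : tanSnd a b (x • a + y • b) = y := by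
  simp only [tanSnd, lor_add_left, lor_smul_left, lor_comm b a]
  field_simp
  unfold gramDet
  ring

theorem tanFst_add (x y : L4) : tanFst a b (x + y) = tanFst a b x + tanFst a b y := by
  simp only [tanFst, lor_add_left]; ring

theorem tanSnd_add (x y : L4) : tanSnd a b (x + y) = tanSnd a b x + tanSnd a b y := by
  simp only [tanSnd, lor_add_left]; ring

theorem tanFst_smul (c : ℝ) (x : L4) : tanFst a b (c • x) = c * tanFst a b x := by
  simp only [tanFst, lor_smul_left]; ring

theorem tanSnd_smul (c : ℝ) (x : L4) : tanSnd a b (c • x) = c * tanSnd a b x := by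
  simp only [tanSnd, lor_smul_left]; ring

/-- A vector orthogonal to a basis vanishes. -/
theorem eq_zero_of_orthogonal_basis {v : Fin 4 → L4} (hv : LinearIndependent ℝ v) {x : L4}
    (hx : ∀ i, lor x (v i) = 0) : x = 0 := by
  have hspan : Submodule.span ℝ (range v) = ⊤ :=
    hv.span_eq_top_of_card_eq_finrank (by simp)
  let l : L4 →ₗ[ℝ] ℝ :=
    { toFun := lor x
      map_add' := lor_add_right x
      map_smul' := fun c y => by simp [lor_smul_right] }
  have hl : l = 0 := LinearMap.ext_on_range hspan fun i => hx i
  exact eq_zero_of_lor_eq_zero fun y => LinearMap.congr_fun hl y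

theorem eq_zero_of_orthogonal_frame {n m : L4} (h : gramDet a b ≠ 0)
    (hna : lor n a = 0) (hnb : lor n b = 0) (hma : lor m a = 0) (hmb : lor m b = 0)
    (hind : ∀ x y : ℝ, x • n + y • m = 0 → x = 0 ∧ y = 0) {w : L4} (ha : lor w a = 0)
    (hb : lor w b = 0) (hn : lor w n = 0) (hm : lor w m = 0) : w = 0 := by
  refine eq_zero_of_orthogonal_basis (v := ![a, b, n, m]) ?_ fun i => by
    fin_cases i <;> assumption
  rw [Fintype.linearIndependent_iff]
  intro c hc
  simp only [Fin.sum_univ_four, Matrix.cons_val] at hc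
  have ea := congrArg (fun z => lor z a) hc
  have eb := congrArg (fun z => lor z b) hc
  simp only [lor_add_left, lor_smul_left, hna, hnb, hma, hmb, lor_zero_left, lor_comm b a] at ea eb
  have c0 : c 0 = 0 := by
    refine (mul_eq_zero.1 (?_ : gramDet a b * c 0 = 0)).resolve_left h
    unfold gramDet
    linear_combination lor b b * ea - lor a b * eb
  have c1 : c 1 = 0 := by
    refine (mul_eq_zero.1 (?_ : gramDet a b * c 1 = 0)).resolve_left h
    unfold gramDet
    linear_combination lor a a * eb - lor a b * ea
  rw [c0, c1] at hc
  obtain ⟨c2, c3⟩ := hind (c 2) (c 3) (by simpa using hc)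
  intro i
  fin_cases i <;> assumption

theorem indep_of_gramDet_ne_zero {n m : L4} (h : gramDet n m ≠ 0) (x y : ℝ)
    (hxy : x • n + y • m = 0) : x = 0 ∧ y = 0 := by
  have en := congrArg (fun z => lor z n) hxy
  have em := congrArg (fun z => lor z m) hxy
  simp only [lor_add_left, lor_smul_left, lor_zero_left, lor_comm m n] at en em
  unfold gramDet at h
  constructor
  · refine (mul_eq_zero.1 (?_ : (lor n n * lor m m - lor n m ^ 2) * x = 0)).resolve_left h
    linear_combination lor m m * en - lor n m * em
  · refine (mul_eq_zero.1 (?_ : (lor n n * lor m m - lor n m ^ 2) * y = 0)).resolve_left h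
    linear_combination lor n n * em - lor n m * en

/-- The Lorentzian vector product. -/
def cross (a b c : L4) : L4 :=
  ![-(a 1 * (b 2 * c 3 - b 3 * c 2) - a 2 * (b 1 * c 3 - b 3 * c 1) + a 3 * (b 1 * c 2 - b 2 * c 1)),
    -(a 0 * (b 2 * c 3 - b 3 * c 2) - a 2 * (b 0 * c 3 - b 3 * c 0) + a 3 * (b 0 * c 2 - b 2 * c 0)),
    a 0 * (b 1 * c 3 - b 3 * c 1) - a 1 * (b 0 * c 3 - b 3 * c 0) + a 3 * (b 0 * c 1 - b 1 * c 0),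
    -(a 0 * (b 1 * c 2 - b 2 * c 1) - a 1 * (b 0 * c 2 - b 2 * c 0) + a 2 * (b 0 * c 1 - b 1 * c 0))]

theorem lor_cross_fst (a b c : L4) : lor (cross a b c) a = 0 := by
  simp only [lor, cross, Matrix.cons_val]; ring

theorem lor_cross_snd (a b c : L4) : lor (cross a b c) b = 0 := by
  simp only [lor, cross, Matrix.cons_val]; ring

theorem lor_cross_trd (a b c : L4) : lor (cross a b c) c = 0 := by
  simp only [lor, cross, Matrix.cons_val]; ring

theorem lor_cross_cross (a b c : L4) : lor (cross a b c) (cross a b c) =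
    -(lor a a * (lor b b * lor c c - lor b c ^ 2) - lor a b * (lor a b * lor c c - lor b c * lor a c)
      + lor a c * (lor a b * lor b c - lor b b * lor a c)) := by
  simp only [lor, cross, Matrix.cons_val]; ring

/-- The timelike axis. -/
def timeAxis : L4 := Pi.single 0 1

/-- The time axis has square `-1` and its component in the spacelike plane has nonnegative square,
so the orthogonal component has square at most `-1`. -/
theorem lor_perp_timeAxis_neg (ha : 0 < lor a a) (h : 0 < gramDet a b) :
    lor (perp a b timeAxis) (perp a b timeAxis) < 0 := by
  have e : lor (perp a b timeAxis) (perp a b timeAxis) = -1 -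
      (lor timeAxis a ^ 2 * lor b b - 2 * lor timeAxis a * lor timeAxis b * lor a b +
        lor timeAxis b ^ 2 * lor a a) / gramDet a b := by
    have h1 : lor timeAxis timeAxis = -1 := by simp [lor, timeAxis]
    conv_lhs => rw [perp, lor_sub_right, lor_add_right, lor_smul_right, lor_smul_right]
    rw [← perp, lor_perp_fst h.ne', lor_perp_snd h.ne', perp]
    simp only [lor_sub_left, lor_add_left, lor_smul_left, tanFst, tanSnd, h1, lor_comm a timeAxis,
      lor_comm b timeAxis]
    field_simp
    ring
  have h2 : 0 ≤ lor timeAxis a ^ 2 * lor b b - 2 * lor timeAxis a * lor timeAxis b * lor a b +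
        lor timeAxis b ^ 2 * lor a a := by
    have h3 : 0 ≤ lor a a * (lor timeAxis a ^ 2 * lor b b -
        2 * lor timeAxis a * lor timeAxis b * lor a b + lor timeAxis b ^ 2 * lor a a) := by
      have : lor a a * (lor timeAxis a ^ 2 * lor b b -
        2 * lor timeAxis a * lor timeAxis b * lor a b + lor timeAxis b ^ 2 * lor a a) =
        (lor a a * lor timeAxis b - lor a b * lor timeAxis a) ^ 2 +
          gramDet a b * lor timeAxis a ^ 2 := by unfold gramDet; ring
      rw [this]; positivity
    exact nonneg_of_mul_nonneg_right h3 ha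
  rw [e]
  have := div_nonneg h2 h.le
  linarith

/-- For `ε = 1` and `ε = -1`, the two null directions orthogonal to a spacelike plane. -/
noncomputable def nullNormal (ε : ℝ) (a b : L4) : L4 :=
  √(gramDet a b) • perp a b timeAxis + ε • cross a b (perp a b timeAxis)

theorem lor_nullNormal_fst (h : 0 < gramDet a b) (ε : ℝ) : lor (nullNormal ε a b) a = 0 := by
  simp [nullNormal, lor_add_left, lor_smul_left, lor_perp_fst h.ne', lor_cross_fst]

theorem lor_nullNormal_snd (h : 0 < gramDet a b) (ε : ℝ) : lor (nullNormal ε a b) b = 0 := by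
  simp [nullNormal, lor_add_left, lor_smul_left, lor_perp_snd h.ne', lor_cross_snd]

theorem lor_cross_perp (h : 0 < gramDet a b) :
    lor (cross a b (perp a b timeAxis)) (cross a b (perp a b timeAxis)) =
      -(gramDet a b * lor (perp a b timeAxis) (perp a b timeAxis)) := by
  rw [lor_cross_cross, lor_comm a (perp _ _ _), lor_comm b (perp _ _ _), lor_perp_fst h.ne',
    lor_perp_snd h.ne']
  unfold gramDet
  ring

/-- The vectors `T = perp a b timeAxis` and `C = cross a b T` are orthogonal and `⟨C, C⟩ = -gramDet
a b * ⟨T, T⟩`, so the squares of the two summands cancel. -/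
theorem lor_nullNormal_self (h : 0 < gramDet a b) {ε : ℝ} (hε : ε ^ 2 = 1) :
    lor (nullNormal ε a b) (nullNormal ε a b) = 0 := by
  have h1 := Real.mul_self_sqrt h.le
  simp only [nullNormal, lor_add_left, lor_smul_left, lor_add_right, lor_smul_right,
    lor_comm (perp a b timeAxis) (cross _ _ _), lor_cross_trd, lor_cross_perp h]
  linear_combination lor (perp a b timeAxis) (perp a b timeAxis) * h1 -
    gramDet a b * lor (perp a b timeAxis) (perp a b timeAxis) * hε

/-- The two null directions span the normal plane, on which the product is nondegenerate, so no
nonzero normal vector is orthogonal to both. One of them can thus be scaled to have product 1 with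
the mean curvature vector, even where that vector is itself null. -/
theorem exists_lor_nullNormal_ne_zero (ha : 0 < lor a a) (h : 0 < gramDet a b) {n : L4}
    (hna : lor n a = 0) (hnb : lor n b = 0) (hn : n ≠ 0) :
    ∃ ε : ℝ, ε ^ 2 = 1 ∧ lor n (nullNormal ε a b) ≠ 0 := by
  by_contra! hcon
  have h1 := hcon 1 (by norm_num)
  have h2 := hcon (-1) (by norm_num)
  simp only [nullNormal, lor_add_right, lor_smul_right] at h1 h2
  have hs : 0 < √(gramDet a b) := Real.sqrt_pos.2 h
  have ht : lor n (perp a b timeAxis) = 0 :=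
    (mul_eq_zero.1 (by linarith : √(gramDet a b) * lor n (perp a b timeAxis) = 0)).resolve_left hs.ne'
  have hc : lor n (cross a b (perp a b timeAxis)) = 0 := by linarith
  have hT := lor_perp_timeAxis_neg ha h
  refine hn (eq_zero_of_orthogonal_frame h.ne' (lor_perp_fst h.ne' timeAxis)
    (lor_perp_snd h.ne' timeAxis) (lor_cross_fst a b _) (lor_cross_snd a b _)
    (indep_of_gramDet_ne_zero ?_) hna hnb ht hc)
  rw [gramDet, lor_cross_perp h, lor_comm _ (cross _ _ _), lor_cross_trd]
  have := mul_pos h (mul_pos_of_neg_of_neg hT hT)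
  nlinarith

/-- Expansion of a normal vector in a frame `n, m` of the normal plane with `⟨n, m⟩ = 1` and
`⟨m, m⟩ = 0`. -/
theorem eq_comb_of_normal {n m : L4} (h : gramDet a b ≠ 0)
    (hna : lor n a = 0) (hnb : lor n b = 0) (hma : lor m a = 0) (hmb : lor m b = 0)
    (hnm : lor n m = 1) (hmm : lor m m = 0) {w : L4} (ha : lor w a = 0) (hb : lor w b = 0) :
    w = lor w m • n + (lor w n - lor n n * lor w m) • m := by
  rw [← sub_eq_zero]
  refine eq_zero_of_orthogonal_frame h hna hnb hma hmb
    (indep_of_gramDet_ne_zero (by simp [gramDet, hnm, hmm])) ?_ ?_ ?_ ?_ <;>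
  simp only [lor_sub_left, lor_add_left, lor_smul_left, ha, hb, hna, hnb, hma, hmb, hnm, hmm,
    lor_comm m n] <;> ring

end LinearAlgebra

/-! ### Smoothness and product rules for Lorentzian expressions -/

section Calculus

variable {F G : Plane → L4} {Ω : Set Plane} {x : Plane}

theorem contDiffOn_lor (hF : ContDiffOn ℝ ∞ F Ω) (hG : ContDiffOn ℝ ∞ G Ω) :
    ContDiffOn ℝ ∞ (fun x => lor (F x) (G x)) Ω := by
  have hF' := contDiffOn_pi.1 hF
  have hG' := contDiffOn_pi.1 hG
  exact ((((hF' 0).mul (hG' 0)).neg.add ((hF' 1).mul (hG' 1))).add ((hF' 2).mul (hG' 2))).add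
    ((hF' 3).mul (hG' 3))

theorem pd_apply (hF : DifferentiableAt ℝ F x) (i : Fin 2) (j : Fin 4) :
    pd i (fun y => F y j) x = pd i F x j := by
  have := (hasFDerivAt_pi'.1 hF.hasFDerivAt) j
  simp [pd, this.fderiv]

theorem pd_lor (hF : DifferentiableAt ℝ F x) (hG : DifferentiableAt ℝ G x) (i : Fin 2) :
    pd i (fun y => lor (F y) (G y)) x = lor (pd i F x) (G x) + lor (F x) (pd i G x) := by
  have hF' := differentiableAt_pi.1 hF
  have hG' := differentiableAt_pi.1 hG
  simp only [lor]
  have h0 := hF' 0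
  have h1 := hF' 1
  have h2 := hF' 2
  have h3 := hF' 3
  have k0 := hG' 0
  have k1 := hG' 1
  have k2 := hG' 2
  have k3 := hG' 3
  rw [pd_add (by fun_prop) (by fun_prop), pd_add (by fun_prop) (by fun_prop),
    pd_add (by fun_prop) (by fun_prop), pd_neg, pd_mul h0 k0, pd_mul h1 k1, pd_mul h2 k2,
    pd_mul h3 k3]
  simp only [pd_apply hF, pd_apply hG]
  ring

theorem contDiffOn_gramDet (hF : ContDiffOn ℝ ∞ F Ω) (hG : ContDiffOn ℝ ∞ G Ω) :
    ContDiffOn ℝ ∞ (fun x => gramDet (F x) (G x)) Ω :=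
  ((contDiffOn_lor hF hF).mul (contDiffOn_lor hG hG)).sub ((contDiffOn_lor hF hG).pow 2)

variable {w : Plane → L4}

theorem contDiffOn_tanFst (hF : ContDiffOn ℝ ∞ F Ω) (hG : ContDiffOn ℝ ∞ G Ω)
    (hw : ContDiffOn ℝ ∞ w Ω) (h : ∀ x ∈ Ω, gramDet (F x) (G x) ≠ 0) :
    ContDiffOn ℝ ∞ (fun x => tanFst (F x) (G x) (w x)) Ω :=
  (((contDiffOn_lor hw hF).mul (contDiffOn_lor hG hG)).sub
    ((contDiffOn_lor hw hG).mul (contDiffOn_lor hF hG))).div (contDiffOn_gramDet hF hG) h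

theorem contDiffOn_tanSnd (hF : ContDiffOn ℝ ∞ F Ω) (hG : ContDiffOn ℝ ∞ G Ω)
    (hw : ContDiffOn ℝ ∞ w Ω) (h : ∀ x ∈ Ω, gramDet (F x) (G x) ≠ 0) :
    ContDiffOn ℝ ∞ (fun x => tanSnd (F x) (G x) (w x)) Ω :=
  (((contDiffOn_lor hw hG).mul (contDiffOn_lor hF hF)).sub
    ((contDiffOn_lor hw hF).mul (contDiffOn_lor hF hG))).div (contDiffOn_gramDet hF hG) h

theorem contDiffOn_perp (hF : ContDiffOn ℝ ∞ F Ω) (hG : ContDiffOn ℝ ∞ G Ω)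
    (hw : ContDiffOn ℝ ∞ w Ω) (h : ∀ x ∈ Ω, gramDet (F x) (G x) ≠ 0) :
    ContDiffOn ℝ ∞ (fun x => perp (F x) (G x) (w x)) Ω :=
  hw.sub (((contDiffOn_tanFst hF hG hw h).smul hF).add ((contDiffOn_tanSnd hF hG hw h).smul hG))

theorem contDiffOn_cross (hF : ContDiffOn ℝ ∞ F Ω) (hG : ContDiffOn ℝ ∞ G Ω)
    (hw : ContDiffOn ℝ ∞ w Ω) : ContDiffOn ℝ ∞ (fun x => cross (F x) (G x) (w x)) Ω := by
  have hF' := contDiffOn_pi.1 hF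
  have hG' := contDiffOn_pi.1 hG
  have hw' := contDiffOn_pi.1 hw
  rw [contDiffOn_pi]
  intro i
  fin_cases i <;> simp only [cross, Fin.zero_eta, Fin.mk_one, Fin.reduceFinMk, Matrix.cons_val] <;>
    fun_prop

theorem contDiffOn_nullNormal (hF : ContDiffOn ℝ ∞ F Ω) (hG : ContDiffOn ℝ ∞ G Ω)
    (h : ∀ x ∈ Ω, gramDet (F x) (G x) ≠ 0) (ε : ℝ) :
    ContDiffOn ℝ ∞ (fun x => nullNormal ε (F x) (G x)) Ω := by
  have h1 := contDiffOn_perp hF hG (contDiffOn_const (c := timeAxis)) h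
  exact (((contDiffOn_gramDet hF hG).sqrt h).smul h1).add
    ((contDiffOn_cross hF hG h1).const_smul ε)

end Calculus

/-! ### Codazzi fields and their unique continuation -/

section Patch

/-- A smooth parametrised spacelike surface. -/
structure SpacelikePatch (Ω : Set Plane) (f : Plane → L4) : Prop where
  isOpen : IsOpen Ω
  smooth : ContDiffOn ℝ ∞ f Ω
  pos_fst : ∀ x ∈ Ω, 0 < lor (pd 0 f x) (pd 0 f x)
  pos_snd : ∀ x ∈ Ω, 0 < lor (pd 1 f x) (pd 1 f x)
  pos_det : ∀ x ∈ Ω, 0 < gramDet (pd 0 f x) (pd 1 f x)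

/-- `n` is orthogonal to the surface `f` at `x`. -/
def IsNormal (f : Plane → L4) (x : Plane) (n : L4) : Prop :=
  lor n (pd 0 f x) = 0 ∧ lor n (pd 1 f x) = 0

/-- `v` is orthogonal to all normal vectors of the surface `f` at `x`. -/
def IsTangent (f : Plane → L4) (x : Plane) (v : L4) : Prop :=
  ∀ n, IsNormal f x n → lor v n = 0

/-- A map `W` whose differential is `df ∘ B` for a symmetric traceless endomorphism `B` of the
tangent bundle of the surface `f`. -/
structure CodazziField (Ω : Set Plane) (f W : Plane → L4) : Prop where
  smooth : ContDiffOn ℝ ∞ W Ω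
  tangent : ∀ x ∈ Ω, ∀ i, IsTangent f x (pd i W x)
  symm : ∀ x ∈ Ω, lor (pd 0 W x) (pd 1 f x) = lor (pd 1 W x) (pd 0 f x)
  trace : ∀ x ∈ Ω, lor (pd 1 f x) (pd 1 f x) * lor (pd 0 W x) (pd 0 f x) -
    2 * lor (pd 0 f x) (pd 1 f x) * lor (pd 0 W x) (pd 1 f x) +
    lor (pd 0 f x) (pd 0 f x) * lor (pd 1 W x) (pd 1 f x) = 0

/-- The real part of the coefficient of the null direction `∂₁ + (s + it)∂₂` of the metric. -/
noncomputable def nullRe (f : Plane → L4) (x : Plane) : ℝ :=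
  -(lor (pd 0 f x) (pd 1 f x) / lor (pd 1 f x) (pd 1 f x))

/-- The imaginary part of the coefficient of the null direction `∂₁ + (s + it)∂₂`. -/
noncomputable def nullIm (f : Plane → L4) (x : Plane) : ℝ :=
  √(gramDet (pd 0 f x) (pd 1 f x)) / lor (pd 1 f x) (pd 1 f x)

/-- The coefficient of `∂₁ f` in `∂ᵢ W`. -/
noncomputable def fstCoeff (f W : Plane → L4) (i : Fin 2) (x : Plane) : ℝ :=
  tanFst (pd 0 f x) (pd 1 f x) (pd i W x)

variable {Ω : Set Plane} {f W V : Plane → L4} {x : Plane}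

theorem SpacelikePatch.mono (hf : SpacelikePatch Ω f) {U : Set Plane} (hU : IsOpen U)
    (h : U ⊆ Ω) : SpacelikePatch U f :=
  ⟨hU, hf.smooth.mono h, fun x hx => hf.pos_fst x (h hx), fun x hx => hf.pos_snd x (h hx),
    fun x hx => hf.pos_det x (h hx)⟩

theorem SpacelikePatch.contDiffOn_pd (hf : SpacelikePatch Ω f) (i : Fin 2) :
    ContDiffOn ℝ ∞ (pd i f) Ω := Minkowski.contDiffOn_pd hf.smooth hf.isOpen i

theorem SpacelikePatch.contDiffOn_pd_pd (hf : SpacelikePatch Ω f) (i j : Fin 2) :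
    ContDiffOn ℝ ∞ (pd i (pd j f)) Ω := Minkowski.contDiffOn_pd (hf.contDiffOn_pd j) hf.isOpen i

theorem SpacelikePatch.contDiffOn_nullRe (hf : SpacelikePatch Ω f) :
    ContDiffOn ℝ ∞ (nullRe f) Ω :=
  ((contDiffOn_lor (hf.contDiffOn_pd 0) (hf.contDiffOn_pd 1)).div
    (contDiffOn_lor (hf.contDiffOn_pd 1) (hf.contDiffOn_pd 1)) fun x hx =>
      (hf.pos_snd x hx).ne').neg

theorem SpacelikePatch.contDiffOn_nullIm (hf : SpacelikePatch Ω f) :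
    ContDiffOn ℝ ∞ (nullIm f) Ω :=
  ((contDiffOn_gramDet (hf.contDiffOn_pd 0) (hf.contDiffOn_pd 1)).sqrt fun x hx =>
    (hf.pos_det x hx).ne').div (contDiffOn_lor (hf.contDiffOn_pd 1) (hf.contDiffOn_pd 1))
    fun x hx => (hf.pos_snd x hx).ne'

theorem SpacelikePatch.nullIm_pos (hf : SpacelikePatch Ω f) (hx : x ∈ Ω) : 0 < nullIm f x :=
  div_pos (Real.sqrt_pos.2 (hf.pos_det x hx)) (hf.pos_snd x hx)

theorem SpacelikePatch.nullRe_mul (hf : SpacelikePatch Ω f) (hx : x ∈ Ω) :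
    nullRe f x * lor (pd 1 f x) (pd 1 f x) = -lor (pd 0 f x) (pd 1 f x) := by
  have := (hf.pos_snd x hx).ne'
  unfold nullRe
  field_simp

theorem SpacelikePatch.nullSq_mul (hf : SpacelikePatch Ω f) (hx : x ∈ Ω) :
    (nullRe f x ^ 2 + nullIm f x ^ 2) * lor (pd 1 f x) (pd 1 f x) =
      lor (pd 0 f x) (pd 0 f x) := by
  have := (hf.pos_snd x hx).ne'
  unfold nullRe nullIm
  rw [div_pow, Real.sq_sqrt (hf.pos_det x hx).le]
  field_simp
  unfold gramDet
  ring

theorem CodazziField.mono (hW : CodazziField Ω f W) {U : Set Plane} (h : U ⊆ Ω) :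
    CodazziField U f W :=
  ⟨hW.smooth.mono h, fun x hx => hW.tangent x (h hx), fun x hx => hW.symm x (h hx),
    fun x hx => hW.trace x (h hx)⟩

/-- A symmetric traceless endomorphism of a plane has two free entries. Tracelessness gives the
lower right one; symmetry gives the lower left one, using that `s + it` is a root of the quadratic
equation for null directions. -/
theorem CodazziField.pd_eq (hW : CodazziField Ω f W) (hf : SpacelikePatch Ω f) (hx : x ∈ Ω) :
    pd 0 W x = fstCoeff f W 0 x • pd 0 f x + (2 * nullRe f x * fstCoeff f W 0 x +
      (nullRe f x ^ 2 + nullIm f x ^ 2) * fstCoeff f W 1 x) • pd 1 f x ∧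
    pd 1 W x = fstCoeff f W 1 x • pd 0 f x + (-fstCoeff f W 0 x) • pd 1 f x := by
  have hD := (hf.pos_det x hx).ne'
  have h0 := eq_tan_of_orthogonal hD fun n ha hb => hW.tangent x hx 0 n ⟨ha, hb⟩
  have h1 := eq_tan_of_orthogonal hD fun n ha hb => hW.tangent x hx 1 n ⟨ha, hb⟩
  have hs := hW.symm x hx
  have ht := hW.trace x hx
  have e1 := hf.nullRe_mul hx
  have e2 := hf.nullSq_mul hx
  have hg := (hf.pos_snd x hx).ne'
  change pd 0 W x = fstCoeff f W 0 x • _ + _ at h0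
  change pd 1 W x = fstCoeff f W 1 x • _ + _ at h1
  set r0 := tanSnd (pd 0 f x) (pd 1 f x) (pd 0 W x)
  set r1 := tanSnd (pd 0 f x) (pd 1 f x) (pd 1 W x)
  set p0 := fstCoeff f W 0 x
  set p1 := fstCoeff f W 1 x
  -- By symmetry the mixed term splits evenly; the left side is then the Gram determinant times the
  -- trace `p0 + r1`.
  have ht' : lor (pd 1 f x) (pd 1 f x) * lor (pd 0 W x) (pd 0 f x) -
    lor (pd 0 f x) (pd 1 f x) * lor (pd 0 W x) (pd 1 f x) -
    lor (pd 0 f x) (pd 1 f x) * lor (pd 1 W x) (pd 0 f x) +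
    lor (pd 0 f x) (pd 0 f x) * lor (pd 1 W x) (pd 1 f x) = 0 := by
    linear_combination ht + lor (pd 0 f x) (pd 1 f x) * hs
  rw [h0, h1] at ht' hs
  simp only [lor_add_left, lor_smul_left, lor_comm (pd 1 f x) (pd 0 f x)] at ht' hs
  unfold gramDet at hD
  have hr1 : r1 = -p0 := by
    have : (lor (pd 0 f x) (pd 0 f x) * lor (pd 1 f x) (pd 1 f x) -
      lor (pd 0 f x) (pd 1 f x) ^ 2) * (r1 + p0) = 0 := by linear_combination ht'
    linarith [(mul_eq_zero.1 this).resolve_left hD]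
  have hr0 : r0 = 2 * nullRe f x * p0 + (nullRe f x ^ 2 + nullIm f x ^ 2) * p1 := by
    rw [hr1] at hs
    apply mul_right_cancel₀ hg
    linear_combination hs - 2 * p0 * e1 - p1 * e2
  rw [← hr1, ← hr0]
  exact ⟨h0, h1⟩

theorem contDiffOn_fstCoeff (hf : SpacelikePatch Ω f) (hW : ContDiffOn ℝ ∞ W Ω) (i : Fin 2) :
    ContDiffOn ℝ ∞ (fstCoeff f W i) Ω :=
  contDiffOn_tanFst (hf.contDiffOn_pd 0) (hf.contDiffOn_pd 1) (contDiffOn_pd hW hf.isOpen i)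
    fun x hx => (hf.pos_det x hx).ne'

/-- The Codazzi equation for the traceless endomorphism defined by `W`, written as a perturbed
Cauchy-Riemann equation. -/
theorem CodazziField.exists_dbar_eq (hW : CodazziField Ω f W) (hf : SpacelikePatch Ω f) :
    ∃ d : Fin 4 → Plane → ℝ, (∀ i, ContinuousOn (d i) Ω) ∧ ∀ x ∈ Ω,
      pd 0 (fun y => fstCoeff f W 0 y + nullRe f y * fstCoeff f W 1 y) x +
        nullRe f x * pd 1 (fun y => fstCoeff f W 0 y + nullRe f y * fstCoeff f W 1 y) x -
        nullIm f x * pd 1 (fun y => -(nullIm f y * fstCoeff f W 1 y)) x =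
        d 0 x * fstCoeff f W 0 x + d 1 x * fstCoeff f W 1 x ∧
      pd 0 (fun y => -(nullIm f y * fstCoeff f W 1 y)) x +
        nullRe f x * pd 1 (fun y => -(nullIm f y * fstCoeff f W 1 y)) x +
        nullIm f x * pd 1 (fun y => fstCoeff f W 0 y + nullRe f y * fstCoeff f W 1 y) x =
        d 2 x * fstCoeff f W 0 x + d 3 x * fstCoeff f W 1 x := by
  have hΩ := hf.isOpen
  have cs := hf.contDiffOn_nullRe
  have ct := hf.contDiffOn_nullIm
  have cA := fun i j => contDiffOn_tanFst (hf.contDiffOn_pd 0) (hf.contDiffOn_pd 1)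
    (hf.contDiffOn_pd_pd i j) fun x hx => (hf.pos_det x hx).ne'
  have cB := fun i j => contDiffOn_tanSnd (hf.contDiffOn_pd 0) (hf.contDiffOn_pd 1)
    (hf.contDiffOn_pd_pd i j) fun x hx => (hf.pos_det x hx).ne'
  set s := nullRe f
  set t := nullIm f
  let A : Fin 2 → Fin 2 → Plane → ℝ := fun i j x => tanFst (pd 0 f x) (pd 1 f x) (pd i (pd j f) x)
  let B : Fin 2 → Fin 2 → Plane → ℝ := fun i j x => tanSnd (pd 0 f x) (pd 1 f x) (pd i (pd j f) x)
  have cA : ∀ i j, ContinuousOn (A i j) Ω := fun i j => (cA i j).continuousOn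
  have cB : ∀ i j, ContinuousOn (B i j) Ω := fun i j => (cB i j).continuousOn
  have cs0 := (contDiffOn_pd cs hΩ 0).continuousOn
  have cs1 := (contDiffOn_pd cs hΩ 1).continuousOn
  have ct0 := (contDiffOn_pd ct hΩ 0).continuousOn
  have ct1 := (contDiffOn_pd ct hΩ 1).continuousOn
  have cs' := cs.continuousOn
  have ct' := ct.continuousOn
  have a01 := cA 0 1
  have a11 := cA 1 1
  have a00 := cA 0 0
  have b01 := cB 0 1
  have b11 := cB 1 1
  have b00 := cB 0 0
  -- A symmetric traceless `B` exchanges the null directions: `B L̄ = w L` with `w = p + (s - it)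
  -- q`, whose real and imaginary parts are differentiated in the statement. The functions `A i j`,
  -- `B i j` are the tangential coefficients of `∂ᵢ∂ⱼf`, that is, the Christoffel symbols.
  refine ⟨![
    fun x => (-2 * B 0 1 x - 2 * s x * B 1 1 x) - 2 * pd 1 s x -
      s x * (-2 * A 0 1 x - 2 * s x * A 1 1 x),
    fun x => (B 0 0 x - (s x ^ 2 + t x ^ 2) * B 1 1 x) - (2 * s x * pd 1 s x + 2 * t x * pd 1 t x) -
      s x * (A 0 0 x - (s x ^ 2 + t x ^ 2) * A 1 1 x) +
      (pd 0 s x + s x * pd 1 s x + t x * pd 1 t x),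
    fun x => t x * (-2 * A 0 1 x - 2 * s x * A 1 1 x),
    fun x => t x * (A 0 0 x - (s x ^ 2 + t x ^ 2) * A 1 1 x) +
      (-pd 0 t x - s x * pd 1 t x + t x * pd 1 s x)], ?_, fun x hx => ?_⟩
  · intro i
    fin_cases i <;>
      simp only [Fin.zero_eta, Fin.mk_one, Fin.reduceFinMk, Matrix.cons_val] <;> fun_prop
  have D : ∀ {F : Plane → ℝ}, ContDiffOn ℝ ∞ F Ω → DifferentiableAt ℝ F x :=
    fun h => differentiableAt_of_contDiffOn h hΩ hx
  have ds := D cs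
  have dt := D ct
  have dp := fun i => D (contDiffOn_fstCoeff hf hW.smooth i)
  have df := fun i => differentiableAt_of_contDiffOn (hf.contDiffOn_pd i) hΩ hx
  set p := fstCoeff f W 0
  set q := fstCoeff f W 1
  have dp0 : DifferentiableAt ℝ p x := dp 0
  have dq0 : DifferentiableAt ℝ q x := dp 1
  have hD := (hf.pos_det x hx).ne'
  -- the integrability condition
  have e0 : pd 0 W =ᶠ[𝓝 x] fun y => p y • pd 0 f y +
      (2 * (s y * p y) + (s y * s y + t y * t y) * q y) • pd 1 f y := by
    filter_upwards [hΩ.mem_nhds hx] with y hy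
    rw [(hW.pd_eq hf hy).1]
    congr 2
    ring
  have e1 : pd 1 W =ᶠ[𝓝 x] fun y => q y • pd 0 f y - p y • pd 1 f y := by
    filter_upwards [hΩ.mem_nhds hx] with y hy
    rw [(hW.pd_eq hf hy).2, neg_smul, sub_eq_add_neg]
  have df0 := df 0
  have df1 := df 1
  have comm := pd_comm hW.smooth hΩ hx 1 0
  rw [pd_congr e0, pd_congr e1, pd_add (by fun_prop) (by fun_prop),
    pd_sub (by fun_prop) (by fun_prop), pd_smul dp0 df0, pd_smul (by fun_prop) df1,
    pd_smul dq0 df0, pd_smul dp0 df1, pd_add (by fun_prop) (by fun_prop),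
    pd_mul (by fun_prop) (by fun_prop), pd_mul (by fun_prop) (by fun_prop),
    pd_mul (by fun_prop) (by fun_prop), pd_add (by fun_prop) (by fun_prop),
    pd_mul (by fun_prop) (by fun_prop), pd_mul (by fun_prop) (by fun_prop), pd_const,
    pd_comm hf.smooth hΩ hx 1 0] at comm
  have V : (pd 1 p x - pd 0 q x) • pd 0 f x + (2 * (s x * pd 1 p x + pd 1 s x * p x) +
      ((s x * s x + t x * t x) * pd 1 q x + (2 * s x * pd 1 s x + 2 * t x * pd 1 t x) * q x) +
      pd 0 p x) • pd 1 f x = q x • pd 0 (pd 0 f) x + (-2 * p x) • pd 0 (pd 1 f) x +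
      (-(2 * (s x * p x) + (s x * s x + t x * t x) * q x)) • pd 1 (pd 1 f) x := by
    rw [← sub_eq_zero] at comm ⊢
    rw [← comm]
    module
  have VA := congrArg (tanFst (pd 0 f x) (pd 1 f x)) V
  have VB := congrArg (tanSnd (pd 0 f x) (pd 1 f x)) V
  rw [tanFst_comb hD, tanFst_add, tanFst_add, tanFst_smul, tanFst_smul, tanFst_smul] at VA
  rw [tanSnd_comb hD, tanSnd_add, tanSnd_add, tanSnd_smul, tanSnd_smul, tanSnd_smul] at VB
  change _ = q x * A 0 0 x + -2 * p x * A 0 1 x + _ * A 1 1 x at VA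
  change _ = q x * B 0 0 x + -2 * p x * B 0 1 x + _ * B 1 1 x at VB
  simp only [Matrix.cons_val]
  have E : ∀ i, pd i (fun y => p y + s y * q y) x = pd i p x + (s x * pd i q x + pd i s x * q x) :=
    fun i => by rw [pd_add (by fun_prop) (by fun_prop), pd_mul ds dq0]
  have E' : ∀ i, pd i (fun y => -(t y * q y)) x = -(t x * pd i q x + pd i t x * q x) :=
    fun i => by rw [pd_neg, pd_mul dt dq0]
  rw [E, E, E', E']
  -- The combinations `VB - s VA` and `t VA` of the two components of `∂₁∂₂W = ∂₂∂₁W` are the real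
  -- and imaginary parts of the equation for `L w`.
  constructor
  · linear_combination VB - s x * VA
  · linear_combination t x * VA

/-- The modulus of `w = p + (s - it) q` vanishes exactly when `dW` does. On a compact ball the terms
of order zero are bounded by a multiple of that modulus, so unique continuation applies. -/
theorem CodazziField.eq_zero_of_eq_zero (hW : CodazziField Ω f W) (hf : SpacelikePatch Ω f)
    {x₀ : Plane} {r R : ℝ} (hr : 0 < r) (hB : Metric.closedBall x₀ R ⊆ Ω)
    (h0 : ∀ x ∈ Metric.ball x₀ r, ∀ i, pd i W x = 0) :
    ∀ x ∈ Metric.ball x₀ R, ∀ i, pd i W x = 0 := by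
  obtain ⟨d, hd, hdx⟩ := hW.exists_dbar_eq hf
  have cs := hf.contDiffOn_nullRe
  have ct := hf.contDiffOn_nullIm
  have cp := contDiffOn_fstCoeff hf hW.smooth 0
  have cq := contDiffOn_fstCoeff hf hW.smooth 1
  have hpos : ∀ x ∈ Ω, 0 < nullIm f x := fun x hx => hf.nullIm_pos hx
  set s := nullRe f
  set t := nullIm f
  set p := fstCoeff f W 0
  set q := fstCoeff f W 1
  have hd0 := hd 0
  have hd1 := hd 1
  have hd2 := hd 2
  have hd3 := hd 3
  have cs' := cs.continuousOn
  have ct' := ct.continuousOn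
  -- These are the squared coefficients of the right-hand sides once `p` and `q` are expressed
  -- through the real part `p + sq` and the imaginary part `-tq`.
  have hcont : ContinuousOn (fun x => ((d 0 x) ^ 2 + ((s x * d 0 x - d 1 x) / t x) ^ 2) +
      ((d 2 x) ^ 2 + ((s x * d 2 x - d 3 x) / t x) ^ 2)) Ω := by
    have ht0 : ∀ x ∈ Ω, t x ≠ 0 := fun x hx => (hpos x hx).ne'
    fun_prop (disch := assumption)
  obtain ⟨M, hM⟩ := (isCompact_closedBall x₀ R).bddAbove_image (hcont.mono hB)
  have hdbar : ∀ x ∈ Metric.closedBall x₀ R,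
      dbarSq s t (fun y => p y + s y * q y) (fun y => -(t y * q y)) x ≤
      |M| * ((p x + s x * q x) ^ 2 + (-(t x * q x)) ^ 2) := by
    intro x hx
    have hxM := (hM (mem_image_of_mem _ hx)).trans (le_abs_self M)
    have htx := (hpos x (hB hx)).ne'
    obtain ⟨h1, h2⟩ := hdx x (hB hx)
    unfold dbarSq
    rw [h1, h2]
    refine le_trans ?_ (mul_le_mul_of_nonneg_right hxM (by positivity))
    have cauchy : ∀ u v a b : ℝ, (u * a + v * b) ^ 2 ≤ (u ^ 2 + v ^ 2) * (a ^ 2 + b ^ 2) :=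
      fun u v a b => by nlinarith [sq_nonneg (u * b - v * a)]
    have i1 := cauchy (d 0 x) ((s x * d 0 x - d 1 x) / t x) (p x + s x * q x) (-(t x * q x))
    have i2 := cauchy (d 2 x) ((s x * d 2 x - d 3 x) / t x) (p x + s x * q x) (-(t x * q x))
    have j1 : d 0 x * (p x + s x * q x) + (s x * d 0 x - d 1 x) / t x * -(t x * q x) =
      d 0 x * p x + d 1 x * q x := by field_simp; ring
    have j2 : d 2 x * (p x + s x * q x) + (s x * d 2 x - d 3 x) / t x * -(t x * q x) =
      d 2 x * p x + d 3 x * q x := by field_simp; ring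
    rw [j1] at i1
    rw [j2] at i2
    linarith
  have huc := unique_continuation hf.isOpen cs ct hpos (cp.add (cs.mul cq)) (ct.mul cq).neg hr
    (abs_nonneg M) hB hdbar fun x hx => by
      have hp : p x = 0 := by simp [p, fstCoeff, h0 x hx, tanFst, lor_zero_left]
      have hq : q x = 0 := by simp [q, fstCoeff, h0 x hx, tanFst, lor_zero_left]
      simp [hp, hq]
  intro x hx
  have hxΩ := hB (Metric.ball_subset_closedBall hx)
  obtain ⟨h1, h2⟩ := huc x hx
  have hq : q x = 0 := by
    have : t x * q x = 0 := by simpa using h2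
    exact (mul_eq_zero.1 this).resolve_left (hpos x hxΩ).ne'
  have hp : p x = 0 := by simpa [hq] using h1
  obtain ⟨e0, e1⟩ := hW.pd_eq hf hxΩ
  have e0' : pd 0 W x = 0 := by rw [e0]; change p x • _ + (_ * p x + _ * q x) • _ = _; simp [hp, hq]
  have e1' : pd 1 W x = 0 := by rw [e1]; change q x • _ + (-p x) • _ = _; simp [hp, hq]
  intro i
  fin_cases i <;> assumption

end Patch

/-! ### Parallel normal fields and the local umbilical field -/

section ParallelFields

/-- A parallel section of the normal bundle of the surface `f`. -/
structure ParallelField (Ω : Set Plane) (f ξ : Plane → L4) : Prop where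
  smooth : ContDiffOn ℝ ∞ ξ Ω
  normal : ∀ x ∈ Ω, IsNormal f x (ξ x)
  tangent : ∀ x ∈ Ω, ∀ i, IsTangent f x (pd i ξ x)

/-- A parametrised spacelike surface with parallel mean curvature vector `H`. -/
structure ParallelMeanCurvPatch (Ω : Set Plane) (f H : Plane → L4) : Prop where
  patch : SpacelikePatch Ω f
  parallel : ParallelField Ω f H
  trace : ∀ x ∈ Ω, ∀ n, IsNormal f x n →
    lor (pd 1 f x) (pd 1 f x) * lor (pd 0 (pd 0 f) x) n -
    2 * lor (pd 0 f x) (pd 1 f x) * lor (pd 0 (pd 1 f) x) n +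
    lor (pd 0 f x) (pd 0 f x) * lor (pd 1 (pd 1 f) x) n =
    2 * gramDet (pd 0 f x) (pd 1 f x) * lor (H x) n

variable {Ω U : Set Plane} {f H W V ξ η : Plane → L4} {x : Plane}

theorem isTangent_pd (f : Plane → L4) (x : Plane) (i : Fin 2) : IsTangent f x (pd i f x) := by
  intro n hn
  rw [lor_comm]
  fin_cases i
  · exact hn.1
  · exact hn.2

theorem eq_of_pd_eq_zero {E : Type*} [NormedAddCommGroup E] [NormedSpace ℝ E] {F : Plane → E}
    (hU : IsOpen U) (hc : IsPreconnected U) (hF : ContDiffOn ℝ ∞ F U)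
    (h : ∀ x ∈ U, ∀ i, pd i F x = 0) {x y : Plane} (hx : x ∈ U) (hy : y ∈ U) : F x = F y := by
  refine hU.is_const_of_fderiv_eq_zero (𝕜 := ℝ) hc (hF.differentiableOn (by simp))
    (fun z hz => ?_) hx hy
  ext v
  simp [fderiv_eq_pd, h z hz]

theorem ParallelField.mono (h : ParallelField Ω f ξ) (hU : U ⊆ Ω) : ParallelField U f ξ :=
  ⟨h.smooth.mono hU, fun x hx => h.normal x (hU hx), fun x hx => h.tangent x (hU hx)⟩

theorem ParallelMeanCurvPatch.mono (h : ParallelMeanCurvPatch Ω f H) (hUo : IsOpen U)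
    (hU : U ⊆ Ω) : ParallelMeanCurvPatch U f H :=
  ⟨h.patch.mono hUo hU, h.parallel.mono hU, fun x hx => h.trace x (hU hx)⟩

theorem ParallelField.comb (h : ParallelField Ω f ξ) (h' : ParallelField Ω f η) (hΩ : IsOpen Ω)
    (a b : ℝ) : ParallelField Ω f (fun x => a • ξ x + b • η x) where
  smooth := (h.smooth.const_smul a).add (h'.smooth.const_smul b)
  normal x hx := by
    have h1 := h.normal x hx
    have h2 := h'.normal x hx
    simp [IsNormal, lor_add_left, lor_smul_left, h1.1, h1.2, h2.1, h2.2]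
  tangent x hx i n hn := by
    have d1 := differentiableAt_of_contDiffOn h.smooth hΩ hx
    have d2 := differentiableAt_of_contDiffOn h'.smooth hΩ hx
    rw [pd_add (by fun_prop) (by fun_prop), pd_const_smul d1, pd_const_smul d2]
    simp [lor_add_left, lor_smul_left, h.tangent x hx i n hn, h'.tangent x hx i n hn]

theorem ParallelField.pd_lor_eq_zero (h : ParallelField Ω f ξ) (h' : ParallelField Ω f η)
    (hΩ : IsOpen Ω) (hx : x ∈ Ω) (i : Fin 2) : pd i (fun y => lor (ξ y) (η y)) x = 0 := by
  rw [pd_lor (differentiableAt_of_contDiffOn h.smooth hΩ hx)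
    (differentiableAt_of_contDiffOn h'.smooth hΩ hx), h.tangent x hx i _ (h'.normal x hx),
    lor_comm, h'.tangent x hx i _ (h.normal x hx), add_zero]

theorem ParallelField.lor_eq (h : ParallelField Ω f ξ) (h' : ParallelField Ω f η)
    (hΩ : IsOpen Ω) (hc : IsPreconnected Ω) {y : Plane} (hx : x ∈ Ω) (hy : y ∈ Ω) :
    lor (ξ x) (η x) = lor (ξ y) (η y) :=
  eq_of_pd_eq_zero hΩ hc (contDiffOn_lor h.smooth h'.smooth)
    (fun _ hz i => h.pd_lor_eq_zero h' hΩ hz i) hx hy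

/-- The Weingarten equation. -/
theorem lor_pd_of_normal (hf : SpacelikePatch Ω f) (hξ : ContDiffOn ℝ ∞ ξ Ω)
    (hn : ∀ x ∈ Ω, IsNormal f x (ξ x)) (hx : x ∈ Ω) (i j : Fin 2) :
    lor (pd i ξ x) (pd j f x) = -lor (pd i (pd j f) x) (ξ x) := by
  have h0 : ∀ y ∈ Ω, lor (ξ y) (pd j f y) = 0 := by
    intro y hy
    fin_cases j
    · exact (hn y hy).1
    · exact (hn y hy).2
  have := pd_eq_zero_of_eqOn hf.isOpen h0 hx i
  rw [pd_lor (differentiableAt_of_contDiffOn hξ hf.isOpen hx)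
    (differentiableAt_of_contDiffOn (hf.contDiffOn_pd j) hf.isOpen hx), lor_comm (ξ x)] at this
  linarith

/-- By Weingarten, `dξ = -df ∘ A_ξ`, and half the trace of `A_ξ` is `⟨H, ξ⟩ = m`, so adding `m f`
removes exactly the trace. Symmetry is that of the second derivatives of `f`. -/
theorem ParallelMeanCurvPatch.codazziField (h : ParallelMeanCurvPatch Ω f H)
    (hξ : ParallelField Ω f ξ) {m : ℝ} (hm : ∀ x ∈ Ω, lor (H x) (ξ x) = m) :
    CodazziField Ω f (fun x => ξ x + m • f x) := by
  have hΩ := h.patch.isOpen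
  have hpd : ∀ x ∈ Ω, ∀ i, pd i (fun x => ξ x + m • f x) x = pd i ξ x + m • pd i f x := by
    intro x hx i
    have d1 := differentiableAt_of_contDiffOn hξ.smooth hΩ hx
    have d2 := differentiableAt_of_contDiffOn h.patch.smooth hΩ hx
    rw [pd_add d1 (by fun_prop), pd_const_smul d2]
  have hw := fun x (hx : x ∈ Ω) i j => lor_pd_of_normal h.patch hξ.smooth hξ.normal hx i j
  refine ⟨hξ.smooth.add (h.patch.smooth.const_smul m), fun x hx i n hn => ?_, fun x hx => ?_,
    fun x hx => ?_⟩
  · rw [hpd x hx, lor_add_left, lor_smul_left, hξ.tangent x hx i n hn, isTangent_pd f x i n hn]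
    ring
  · rw [hpd x hx, hpd x hx, lor_add_left, lor_add_left, lor_smul_left, lor_smul_left, hw x hx,
      hw x hx, pd_comm h.patch.smooth hΩ hx 0 1, lor_comm (pd 0 f x)]
  · have ht := h.trace x hx _ (hξ.normal x hx)
    rw [hm x hx] at ht
    rw [hpd x hx, hpd x hx]
    simp only [lor_add_left, lor_smul_left, hw x hx]
    unfold gramDet at ht
    linear_combination -ht

/-- The Ricci equation: the normal bundle is flat. -/
theorem ParallelField.lor_pd_comm (hξ : ParallelField Ω f ξ) (hη : ParallelField Ω f η)
    (hΩ : IsOpen Ω) (hx : x ∈ Ω) :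
    lor (pd 0 ξ x) (pd 1 η x) = lor (pd 1 ξ x) (pd 0 η x) := by
  -- Obtained by differentiating `⟨∂ᵢξ, η⟩ = 0`. The first term is symmetric in `i` and `j`, hence
  -- so is the second.
  have key : ∀ i j, lor (pd j (pd i ξ) x) (η x) + lor (pd i ξ x) (pd j η x) = 0 := by
    intro i j
    rw [← pd_lor (differentiableAt_of_contDiffOn (contDiffOn_pd hξ.smooth hΩ i) hΩ hx)
      (differentiableAt_of_contDiffOn hη.smooth hΩ hx)]
    exact pd_eq_zero_of_eqOn hΩ (fun y hy => hξ.tangent y hy i _ (hη.normal y hy)) hx j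
  have h1 := key 0 1
  have h2 := key 1 0
  rw [pd_comm hξ.smooth hΩ hx 1 0] at h1
  linarith

/-- The Ricci equation says that the shape operators commute, and this is unaffected by adding
multiples of the identity. -/
theorem ParallelMeanCurvPatch.lor_pd_comm (h : ParallelMeanCurvPatch Ω f H)
    (hξ : ParallelField Ω f ξ) (hη : ParallelField Ω f η) {m k : ℝ}
    (hk : ∀ x ∈ Ω, lor (H x) (η x) = k) (hm : ∀ x ∈ Ω, lor (H x) (ξ x) = m) (hx : x ∈ Ω) :
    lor (pd 0 (fun x => ξ x + m • f x) x) (pd 1 (fun x => η x + k • f x) x) =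
      lor (pd 1 (fun x => ξ x + m • f x) x) (pd 0 (fun x => η x + k • f x) x) := by
  have hΩ := h.patch.isOpen
  have s1 := (h.codazziField hξ hm).symm x hx
  have s2 := (h.codazziField hη hk).symm x hx
  have d1 := differentiableAt_of_contDiffOn hξ.smooth hΩ hx
  have d2 := differentiableAt_of_contDiffOn h.patch.smooth hΩ hx
  have d3 := differentiableAt_of_contDiffOn hη.smooth hΩ hx
  have e1 : ∀ i, pd i (fun x => ξ x + m • f x) x = pd i ξ x + m • pd i f x := fun i => by
    rw [pd_add d1 (by fun_prop), pd_const_smul d2]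
  have e2 : ∀ i, pd i (fun x => η x + k • f x) x = pd i η x + k • pd i f x := fun i => by
    rw [pd_add d3 (by fun_prop), pd_const_smul d2]
  have hr := hξ.lor_pd_comm hη hΩ hx
  simp only [e1, e2, lor_add_left, lor_smul_left, lor_add_right, lor_smul_right,
    lor_comm (pd 0 f x) (pd 1 η x), lor_comm (pd 1 f x) (pd 0 η x),
    lor_comm (pd 1 f x) (pd 0 f x)] at s1 s2 ⊢
  linear_combination hr + k * s1 - m * s2

/-- The hypothesis says that the two endomorphisms commute. Their commutator is antisymmetric, so in
a plane it has one entry, here a positive multiple of the difference of the two products. -/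
theorem CodazziField.fstCoeff_mul (hW : CodazziField Ω f W) (hV : CodazziField Ω f V)
    (hf : SpacelikePatch Ω f) (hx : x ∈ Ω)
    (h : lor (pd 0 W x) (pd 1 V x) = lor (pd 1 W x) (pd 0 V x)) :
    fstCoeff f W 0 x * fstCoeff f V 1 x = fstCoeff f W 1 x * fstCoeff f V 0 x := by
  have e1 := hf.nullRe_mul hx
  have e2 := hf.nullSq_mul hx
  obtain ⟨w0, w1⟩ := hW.pd_eq hf hx
  obtain ⟨v0, v1⟩ := hV.pd_eq hf hx
  rw [w0, w1, v0, v1] at h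
  simp only [lor_add_left, lor_smul_left, lor_add_right, lor_smul_right,
    lor_comm (pd 1 f x) (pd 0 f x)] at h
  have hg := hf.pos_snd x hx
  have ht := hf.nullIm_pos hx
  have : (2 * nullIm f x ^ 2 * lor (pd 1 f x) (pd 1 f x)) *
      (fstCoeff f W 0 x * fstCoeff f V 1 x - fstCoeff f W 1 x * fstCoeff f V 0 x) = 0 := by
    linear_combination h - (2 * nullRe f x) *
      (fstCoeff f W 0 x * fstCoeff f V 1 x - fstCoeff f W 1 x * fstCoeff f V 0 x) * e1 +
      (fstCoeff f W 0 x * fstCoeff f V 1 x - fstCoeff f W 1 x * fstCoeff f V 0 x) * e2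
  have hne : 2 * nullIm f x ^ 2 * lor (pd 1 f x) (pd 1 f x) ≠ 0 := by positivity
  linarith [(mul_eq_zero.1 this).resolve_left hne]

/-- Two Codazzi fields with proportional differentials have proportional differentials with a
constant factor. -/
theorem CodazziField.exists_const (hW : CodazziField Ω f W) (hV : CodazziField Ω f V)
    (hf : SpacelikePatch Ω f) (hc : IsPreconnected Ω)
    (h : ∀ x ∈ Ω, lor (pd 0 W x) (pd 1 V x) = lor (pd 1 W x) (pd 0 V x))
    (hne : ∀ x ∈ Ω, 0 < fstCoeff f W 0 x ^ 2 + fstCoeff f W 1 x ^ 2) :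
    ∃ c : ℝ, ∀ x ∈ Ω, ∀ i, pd i V x = c • pd i W x := by
  have hΩ := hf.isOpen
  rcases Ω.eq_empty_or_nonempty with rfl | ⟨y, hy⟩
  · exact ⟨0, fun x hx => hx.elim⟩
  have cp := contDiffOn_fstCoeff hf hW.smooth 0
  have cq := contDiffOn_fstCoeff hf hW.smooth 1
  have cp' := contDiffOn_fstCoeff hf hV.smooth 0
  have cq' := contDiffOn_fstCoeff hf hV.smooth 1
  set p := fstCoeff f W 0
  set q := fstCoeff f W 1
  set p' := fstCoeff f V 0
  set q' := fstCoeff f V 1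
  -- The ratio of the two parallel vectors `(p', q')` and `(p, q)`, written as a projection so that
  -- it is smooth wherever `(p, q) ≠ 0`.
  let l : Plane → ℝ := fun x => (p x * p' x + q x * q' x) / (p x ^ 2 + q x ^ 2)
  have cl : ContDiffOn ℝ ∞ l Ω :=
    ((cp.mul cp').add (cq.mul cq')).div ((cp.pow 2).add (cq.pow 2)) fun x hx => (hne x hx).ne'
  have hl : ∀ x ∈ Ω, ∀ i, pd i V x = l x • pd i W x := by
    intro x hx
    have hpq : p x * q' x = q x * p' x := hW.fstCoeff_mul hV hf hx (h x hx)
    have hn := (hne x hx).ne'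
    have h1 : p' x = l x * p x := by simp only [l]; field_simp; linear_combination -q x * hpq
    have h2 : q' x = l x * q x := by simp only [l]; field_simp; linear_combination p x * hpq
    obtain ⟨w0, w1⟩ := hW.pd_eq hf hx
    obtain ⟨v0, v1⟩ := hV.pd_eq hf hx
    change pd 0 W x = p x • _ + (_ * p x + _ * q x) • _ at w0
    change pd 1 W x = q x • _ + (-p x) • _ at w1
    change pd 0 V x = p' x • _ + (_ * p' x + _ * q' x) • _ at v0
    change pd 1 V x = q' x • _ + (-p' x) • _ at v1
    rw [h1, h2] at v0 v1
    have a0 : pd 0 V x = l x • pd 0 W x := by rw [v0, w0]; module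
    have a1 : pd 1 V x = l x • pd 1 W x := by rw [v1, w1]; module
    intro i
    fin_cases i <;> assumption
  -- Equality of the mixed derivatives of `V` leaves `∂₁l ∂₂W = ∂₂l ∂₁W`. A nonzero symmetric
  -- traceless `B` is invertible, so `∂₁W` and `∂₂W` are independent and `dl = 0`.
  have hdl : ∀ x ∈ Ω, ∀ i, pd i l x = 0 := by
    intro x hx
    have dl := differentiableAt_of_contDiffOn cl hΩ hx
    have dW := fun i => differentiableAt_of_contDiffOn (contDiffOn_pd hW.smooth hΩ i) hΩ hx
    have e : ∀ i, pd i V =ᶠ[𝓝 x] fun y => l y • pd i W y := fun i => by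
      filter_upwards [hΩ.mem_nhds hx] with y hy using hl y hy i
    have comm := pd_comm hV.smooth hΩ hx 0 1
    rw [pd_congr (e 1), pd_congr (e 0), pd_smul dl (dW 1), pd_smul dl (dW 0),
      pd_comm hW.smooth hΩ hx 0 1, add_right_inj] at comm
    have hD := (hf.pos_det x hx).ne'
    have a := congrArg (tanFst (pd 0 f x) (pd 1 f x)) comm
    have b := congrArg (tanSnd (pd 0 f x) (pd 1 f x)) comm
    obtain ⟨w0, w1⟩ := hW.pd_eq hf hx
    change pd 0 W x = p x • _ + (_ * p x + _ * q x) • _ at w0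
    change pd 1 W x = q x • _ + (-p x) • _ at w1
    rw [w0, w1, tanFst_smul, tanFst_comb hD, tanFst_smul, tanFst_comb hD] at a
    rw [w0, w1, tanSnd_smul, tanSnd_comb hD, tanSnd_smul, tanSnd_comb hD] at b
    have ht := hf.nullIm_pos hx
    -- This quantity is `-det B`.
    have hφ : 0 < (p x + nullRe f x * q x) ^ 2 + (nullIm f x * q x) ^ 2 := by
      by_cases hq : q x = 0
      · have := hne x hx
        simp only [hq] at this ⊢
        linarith
      · positivity
    have h0 : pd 0 l x = 0 := by
      refine (mul_eq_zero.1 (?_ : ((p x + nullRe f x * q x) ^ 2 + (nullIm f x * q x) ^ 2) *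
        pd 0 l x = 0)).resolve_left hφ.ne'
      linear_combination (2 * nullRe f x * p x + (nullRe f x ^ 2 + nullIm f x ^ 2) * q x) * a -
        p x * b
    have h1 : pd 1 l x = 0 := by
      refine (mul_eq_zero.1 (?_ : ((p x + nullRe f x * q x) ^ 2 + (nullIm f x * q x) ^ 2) *
        pd 1 l x = 0)).resolve_left hφ.ne'
      linear_combination -p x * a - q x * b
    intro i
    fin_cases i <;> assumption
  refine ⟨l y, fun x hx i => ?_⟩
  rw [hl x hx, eq_of_pd_eq_zero hΩ hc cl hdl hx hy]

/-- Near a point at which `H` does not vanish, there is a parallel null normal field `ν` with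
`⟨H, ν⟩ = 1`. -/
theorem ParallelMeanCurvPatch.exists_null_field (h : ParallelMeanCurvPatch Ω f H) (hx : x ∈ Ω)
    (hH : H x ≠ 0) : ∃ U ⊆ Ω, IsOpen U ∧ x ∈ U ∧ ∃ ν, ParallelField U f ν ∧
      ∀ y ∈ U, lor (H y) (ν y) = 1 ∧ lor (ν y) (ν y) = 0 := by
  have hf := h.patch
  have hΩ := hf.isOpen
  obtain ⟨ε, hε, hne⟩ := exists_lor_nullNormal_ne_zero (hf.pos_fst x hx) (hf.pos_det x hx)
    (h.parallel.normal x hx).1 (h.parallel.normal x hx).2 hH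
  let l : Plane → L4 := fun y => nullNormal ε (pd 0 f y) (pd 1 f y)
  have hl : ContDiffOn ℝ ∞ l Ω := contDiffOn_nullNormal (hf.contDiffOn_pd 0) (hf.contDiffOn_pd 1)
    (fun y hy => (hf.pos_det y hy).ne') ε
  have hσ := contDiffOn_lor h.parallel.smooth hl
  have hUo : IsOpen (Ω ∩ (fun y => lor (H y) (l y)) ⁻¹' {0}ᶜ) :=
    hσ.continuousOn.isOpen_inter_preimage hΩ isOpen_compl_singleton
  set U := Ω ∩ (fun y => lor (H y) (l y)) ⁻¹' {0}ᶜ with hU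
  have hUΩ : U ⊆ Ω := inter_subset_left
  have hU0 : ∀ y ∈ U, lor (H y) (l y) ≠ 0 := fun y hy => hy.2
  let ν : Plane → L4 := fun y => (lor (H y) (l y))⁻¹ • l y
  have hν : ContDiffOn ℝ ∞ ν U := ((hσ.mono hUΩ).inv hU0).smul (hl.mono hUΩ)
  have hνn : ∀ y ∈ U, IsNormal f y (ν y) := fun y hy => by
    have hD := hf.pos_det y (hUΩ hy)
    simp only [ν, l, IsNormal, lor_smul_left, lor_nullNormal_fst hD, lor_nullNormal_snd hD]
    simp
  have hHν : ∀ y ∈ U, lor (H y) (ν y) = 1 := fun y hy => by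
    simp only [ν, lor_smul_right]
    exact inv_mul_cancel₀ (hU0 y hy)
  have hνν : ∀ y ∈ U, lor (ν y) (ν y) = 0 := fun y hy => by
    simp only [ν, l, lor_smul_right, lor_smul_left,
      lor_nullNormal_self (hf.pos_det y (hUΩ hy)) hε]
    simp
  refine ⟨U, hUΩ, hUo, ⟨hx, hne⟩, ν, ⟨hν, hνn, fun y hy i n hn => ?_⟩,
    fun y hy => ⟨hHν y hy, hνν y hy⟩⟩
  have dν := differentiableAt_of_contDiffOn hν hUo hy
  have dH := differentiableAt_of_contDiffOn h.parallel.smooth hΩ (hUΩ hy)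
  have h1 := pd_eq_zero_of_eqOn hUo hHν hy i
  rw [pd_lor dH dν, h.parallel.tangent y (hUΩ hy) i _ (hνn y hy), zero_add] at h1
  have h2 := pd_eq_zero_of_eqOn hUo hνν hy i
  rw [pd_lor dν dν, lor_comm (ν y)] at h2
  have hN := h.parallel.normal y (hUΩ hy)
  -- `H` and `ν` span the normal plane, and both products with `∂ᵢν` vanish because `⟨H, ν⟩` and
  -- `⟨ν, ν⟩` are constant and `H` is parallel. So `ν` is parallel without solving any equation.
  have hz : ∀ a b : ℝ, lor (pd i ν y) (a • H y + b • ν y) = 0 := fun a b => by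
    rw [lor_add_right, lor_smul_right, lor_smul_right, lor_comm _ (H y), h1,
      (by linarith : lor (pd i ν y) (ν y) = 0)]
    ring
  rw [eq_comb_of_normal (hf.pos_det y (hUΩ hy)).ne' hN.1 hN.2 (hνn y hy).1 (hνn y hy).2
    (hHν y hy) (hνν y hy) hn.1 hn.2]
  exact hz _ _

/-- If `A - mf` is normal to the surface, then `m = ⟨H, A - mf⟩`. -/
theorem ParallelMeanCurvPatch.lor_meanCurv_eq (h : ParallelMeanCurvPatch Ω f H) {A : L4} {m : ℝ}
    (hn : ∀ x ∈ Ω, IsNormal f x (A - m • f x)) (hx : x ∈ Ω) : lor (H x) (A - m • f x) = m := by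
  have hf := h.patch
  have hs : ContDiffOn ℝ ∞ (fun x => A - m • f x) Ω :=
    contDiffOn_const.sub (hf.smooth.const_smul m)
  -- The differential of `A - m f` is `-m df`, so its shape operator is `m` times the identity, with
  -- half trace `m`.
  have hw := fun i j => lor_pd_of_normal hf hs hn hx i j
  have df := differentiableAt_of_contDiffOn hf.smooth hf.isOpen hx
  have e : ∀ i, pd i (fun x => A - m • f x) x = -(m • pd i f x) := fun i => by
    rw [pd_sub (by fun_prop) (by fun_prop), pd_const_smul df, pd_const, zero_sub]
  simp only [e, lor_neg_left, lor_smul_left, neg_inj] at hw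
  have ht := h.trace x hx _ (hn x hx)
  rw [← hw, ← hw, ← hw] at ht
  have hD := (hf.pos_det x hx).ne'
  have : gramDet (pd 0 f x) (pd 1 f x) * (lor (H x) (A - m • f x) - m) = 0 := by
    unfold gramDet at ht ⊢
    linear_combination -(1 / 2) * ht
  linarith [(mul_eq_zero.1 this).resolve_left hD]

theorem parallelField_sub_smul (hf : SpacelikePatch Ω f) {A : L4} {m : ℝ}
    (hn : ∀ x ∈ Ω, IsNormal f x (A - m • f x)) : ParallelField Ω f (fun x => A - m • f x) := by
  refine ⟨contDiffOn_const.sub (hf.smooth.const_smul m), hn, fun x hx i n hN => ?_⟩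
  have df := differentiableAt_of_contDiffOn hf.smooth hf.isOpen hx
  rw [pd_sub (by fun_prop) (by fun_prop), pd_const_smul df, pd_const, zero_sub, lor_neg_left,
    lor_smul_left, isTangent_pd f x i n hN]
  simp

/-- If the Codazzi field of `ξ` is constant near `y`, unique continuation makes it constant on a
ball of radius `2R` about `y`, which contains the ball of radius `R` about `x₀`. The factor 4 leaves
room for the closed ball about `y`, since `2R + R < 4R`. -/
theorem ParallelMeanCurvPatch.eq_sub_smul {x₀ y : Plane} {R r : ℝ}
    (h : ParallelMeanCurvPatch (Metric.ball x₀ (4 * R)) f H) (hR : 0 < R)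
    (hξ : ParallelField (Metric.ball x₀ (4 * R)) f ξ) {m : ℝ}
    (hm : ∀ x ∈ Metric.ball x₀ (4 * R), lor (H x) (ξ x) = m) (hy : y ∈ Metric.ball x₀ R)
    (hr : 0 < r) (h0 : ∀ x ∈ Metric.ball y r, ∀ i, pd i (fun x => ξ x + m • f x) x = 0) :
    ∀ x ∈ Metric.ball x₀ R, ξ x = (ξ y + m • f y) - m • f x := by
  have hy' := Metric.mem_ball.1 hy
  have hB : Metric.closedBall y (2 * R) ⊆ Metric.ball x₀ (4 * R) := fun z hz => by
    rw [Metric.mem_closedBall] at hz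
    rw [Metric.mem_ball]
    linarith [dist_triangle z y x₀]
  have hB' : Metric.ball x₀ R ⊆ Metric.ball y (2 * R) := fun z hz => by
    rw [Metric.mem_ball] at hz ⊢
    linarith [dist_triangle z x₀ y, dist_comm y x₀]
  have hW := h.codazziField hξ hm
  have hz := hW.eq_zero_of_eq_zero h.patch hr hB h0
  intro x hx
  have hsub : Metric.ball x₀ R ⊆ Metric.ball x₀ (4 * R) := Metric.ball_subset_ball (by linarith)
  have := eq_of_pd_eq_zero Metric.isOpen_ball (convex_ball x₀ R).isPreconnected
    (hW.smooth.mono hsub) (fun z hz' => hz z (hB' hz')) hx hy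
  rw [← this]
  simp

/-- Locally, a surface with parallel nonvanishing mean curvature vector has an umbilical parallel
normal field `A - mf`, and such fields have the unique continuation property. -/
theorem ParallelMeanCurvPatch.exists_umbilical (h : ParallelMeanCurvPatch Ω f H) {x₀ : Plane}
    (hx₀ : x₀ ∈ Ω) (hH : H x₀ ≠ 0) : ∃ R > 0, Metric.ball x₀ R ⊆ Ω ∧
      (∃ (A : L4) (m : ℝ), (A ≠ 0 ∨ m ≠ 0) ∧ ∀ x ∈ Metric.ball x₀ R, IsNormal f x (A - m • f x)) ∧
      ∀ (A : L4) (m : ℝ) (V : Set Plane), IsOpen V → V.Nonempty → V ⊆ Metric.ball x₀ R →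
        (∀ x ∈ V, IsNormal f x (A - m • f x)) →
        ∀ x ∈ Metric.ball x₀ R, IsNormal f x (A - m • f x) := by
  obtain ⟨U, hUΩ, hUo, hxU, ν, hν, hνU⟩ := h.exists_null_field hx₀ hH
  obtain ⟨R', hR', hRU⟩ := Metric.isOpen_iff.1 hUo x₀ hxU
  obtain ⟨R, rfl⟩ : ∃ R, R' = 4 * R := ⟨R' / 4, by ring⟩
  have hR : 0 < R := by linarith
  have hsub : Metric.ball x₀ R ⊆ Metric.ball x₀ (4 * R) := Metric.ball_subset_ball (by linarith)
  replace h := h.mono Metric.isOpen_ball (hRU.trans hUΩ)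
  replace hν := hν.mono hRU
  have hHν : ∀ y ∈ Metric.ball x₀ (4 * R), lor (H y) (ν y) = 1 := fun y hy => (hνU y (hRU hy)).1
  have hνν : ∀ y ∈ Metric.ball x₀ (4 * R), lor (ν y) (ν y) = 0 := fun y hy => (hνU y (hRU hy)).2
  have hconn : ∀ (y : Plane) (r : ℝ), IsPreconnected (Metric.ball y r) := fun y r =>
    (convex_ball y r).isPreconnected
  have hx4 : x₀ ∈ Metric.ball x₀ (4 * R) := Metric.mem_ball_self (by linarith)
  obtain ⟨c, hc⟩ : ∃ c, ∀ y ∈ Metric.ball x₀ (4 * R), lor (H y) (H y) = c :=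
    ⟨lor (H x₀) (H x₀), fun y hy =>
      h.parallel.lor_eq h.parallel Metric.isOpen_ball (hconn _ _) hy hx4⟩
  refine ⟨R, hR, hsub.trans (hRU.trans hUΩ), ?_, fun A m V hV hVne hVB hVn x hx => ?_⟩
  · have hW := h.codazziField h.parallel hc
    have hW' := h.codazziField hν hHν
    have hx0 : x₀ ∈ Metric.ball x₀ R := Metric.mem_ball_self hR
    -- Either `H` itself is umbilical on the small ball, or its traceless shape operator is nonzero
    -- at some `y` and can serve as a denominator near `y`.
    by_cases hz : ∀ x ∈ Metric.ball x₀ R, ∀ i, pd i (fun x => H x + c • f x) x = 0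
    · have := h.eq_sub_smul hR h.parallel hc hx0 hR hz
      refine ⟨H x₀ + c • f x₀, c, ?_, fun x hx => ?_⟩
      · by_contra! hcon
        rw [hcon.2] at hcon
        exact hH (by simpa using hcon.1)
      · rw [← this x hx]
        exact h.parallel.normal x (hsub hx)
    · push Not at hz
      obtain ⟨y, hy, hyi⟩ := hz
      have cp := contDiffOn_fstCoeff h.patch hW.smooth 0
      have cq := contDiffOn_fstCoeff h.patch hW.smooth 1
      have hy4 := hsub hy
      have hpos : 0 < fstCoeff f (fun x => H x + c • f x) 0 y ^ 2 +
          fstCoeff f (fun x => H x + c • f x) 1 y ^ 2 := by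
        refine lt_of_le_of_ne (by positivity) fun hcon => ?_
        have p0 : fstCoeff f (fun x => H x + c • f x) 0 y = 0 := by
          nlinarith [sq_nonneg (fstCoeff f (fun x => H x + c • f x) 0 y),
            sq_nonneg (fstCoeff f (fun x => H x + c • f x) 1 y)]
        have p1 : fstCoeff f (fun x => H x + c • f x) 1 y = 0 := by
          nlinarith [sq_nonneg (fstCoeff f (fun x => H x + c • f x) 0 y),
            sq_nonneg (fstCoeff f (fun x => H x + c • f x) 1 y)]
        obtain ⟨e0, e1⟩ := hW.pd_eq h.patch hy4
        rw [p0, p1] at e0 e1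
        obtain ⟨i, hi⟩ := hyi
        refine hi ?_
        fin_cases i
        · simpa using e0
        · simpa using e1
      have hOo := ((cp.pow 2).add (cq.pow 2)).continuousOn.isOpen_inter_preimage
        Metric.isOpen_ball isOpen_Ioi (s := Metric.ball x₀ (4 * R)) (t := Ioi 0)
      obtain ⟨r, hr, hrO⟩ := Metric.isOpen_iff.1 hOo y ⟨hy4, hpos⟩
      have hrB : Metric.ball y r ⊆ Metric.ball x₀ (4 * R) := hrO.trans inter_subset_left
      obtain ⟨l, hl⟩ := (hW.mono hrB).exists_const (hW'.mono hrB)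
        (h.patch.mono Metric.isOpen_ball hrB) (hconn y r)
        (fun x hx => h.lor_pd_comm h.parallel hν hHν hc (hrB hx)) fun x hx => (hrO hx).2
      -- Near `y` the traceless parts satisfy `dW_ν = l dW_H`, so the field `ν - l H` is umbilical
      -- there.
      have hη := hν.comb h.parallel Metric.isOpen_ball 1 (-l)
      have hHη : ∀ x ∈ Metric.ball x₀ (4 * R), lor (H x) ((1 : ℝ) • ν x + (-l) • H x) = 1 - l * c :=
        fun x hx => by
          rw [lor_add_right, lor_smul_right, lor_smul_right, hHν x hx, hc x hx]; ring
      have hzero : ∀ x ∈ Metric.ball y r, ∀ i,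
          pd i (fun x => ((1 : ℝ) • ν x + (-l) • H x) + (1 - l * c) • f x) x = 0 := by
        intro x hx i
        have d1 := differentiableAt_of_contDiffOn hW.smooth Metric.isOpen_ball (hrB hx)
        have d2 := differentiableAt_of_contDiffOn hW'.smooth Metric.isOpen_ball (hrB hx)
        have e : (fun x => ((1 : ℝ) • ν x + (-l) • H x) + (1 - l * c) • f x) =
            fun x => (ν x + (1 : ℝ) • f x) - l • (H x + c • f x) := by
          ext1 x
          module
        have d3 : DifferentiableAt ℝ (fun x => l • (H x + c • f x)) x := d1.const_smul l
        rw [e, pd_sub d2 d3, pd_const_smul d1, hl x hx, sub_self]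
      have hA := h.eq_sub_smul hR hη hHη hy hr hzero
      refine ⟨_, _, ?_, fun x hx => by rw [← hA x hx]; exact hη.normal x (hsub hx)⟩
      -- If `A` and `m` both vanished, then `ν - l H = 0` at `y`. Pairing with the null vector `ν`
      -- gives `l = 0`, whereas then `m = 1 - l c = 1`.
      by_contra! hcon
      have hy0 := hA y hy
      rw [hcon.1, hcon.2, zero_smul, sub_zero] at hy0
      have h1 := congrArg (lor (ν y)) hy0
      rw [lor_add_right, lor_smul_right, lor_smul_right, hνν y hy4, lor_comm, hHν y hy4,
        lor_zero_right] at h1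
      have h2 := hcon.2
      rw [(by linarith : l = 0)] at h2
      norm_num at h2
  · obtain ⟨y, hy⟩ := hVne
    obtain ⟨r, hr, hrV⟩ := Metric.isOpen_iff.1 hV y hy
    have hrB : Metric.ball y r ⊆ Metric.ball x₀ (4 * R) := (hrV.trans hVB).trans hsub
    have hyr : y ∈ Metric.ball y r := Metric.mem_ball_self hr
    have hb := h.mono Metric.isOpen_ball hrB
    have hn : ∀ x ∈ Metric.ball y r, IsNormal f x (A - m • f x) := fun x hx => hVn x (hrV hx)
    have hη := parallelField_sub_smul hb.patch hn
    -- On the small ball `A - m f` is parallel, so its coefficients in the parallel frame `H`, `ν`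
    -- are constants. The same combination of the frame extends it to the large ball, where unique
    -- continuation applies.
    set a := lor (A - m • f y) (ν y) with ha
    have hην : ∀ x ∈ Metric.ball y r, lor (A - m • f x) (ν x) = a := fun x hx =>
      hη.lor_eq (hν.mono hrB) Metric.isOpen_ball (hconn y r) hx hyr
    have hηH : ∀ x ∈ Metric.ball y r, lor (A - m • f x) (H x) = m := fun x hx => by
      rw [lor_comm]
      exact hb.lor_meanCurv_eq hn hx
    have hξ := h.parallel.comb hν Metric.isOpen_ball a (m - c * a)
    have heq : ∀ x ∈ Metric.ball y r, a • H x + (m - c * a) • ν x = A - m • f x := by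
      intro x hx
      have hN := h.parallel.normal x (hrB hx)
      have hN' := hν.normal x (hrB hx)
      have := eq_comb_of_normal (h.patch.pos_det x (hrB hx)).ne' hN.1 hN.2 hN'.1 hN'.2
        (hHν x (hrB hx)) (hνν x (hrB hx)) (hn x hx).1 (hn x hx).2
      rw [hην x hx, hηH x hx, hc x (hrB hx)] at this
      exact this.symm
    have hHξ : ∀ x ∈ Metric.ball x₀ (4 * R), lor (H x) (a • H x + (m - c * a) • ν x) = m :=
      fun x hx => by
        rw [lor_add_right, lor_smul_right, lor_smul_right, hc x hx, hHν x hx]; ring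
    have hA := h.eq_sub_smul hR hξ hHξ (hVB hy) hr fun x hx i =>
      pd_eq_zero_of_eqOn (c := A) Metric.isOpen_ball
        (fun z hz => by rw [heq z hz, sub_add_cancel]) hx i
    have hAy : a • H y + (m - c * a) • ν y + m • f y = A := by rw [heq y hyr, sub_add_cancel]
    have := hA x hx
    rw [hAy] at this
    rw [← this]
    exact hξ.normal x (hsub hx)

end ParallelFields

/-! ### Zeros of parallel normal fields -/

section Vanishing

variable {Ω : Set Plane} {f ξ : Plane → L4}

theorem abs_lor_le (x y : L4) : |lor x y| ≤ 4 * (‖x‖ * ‖y‖) := by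
  have h : ∀ i, |x i * y i| ≤ ‖x‖ * ‖y‖ := fun i => by
    rw [abs_mul]
    exact mul_le_mul (norm_le_pi_norm x i) (norm_le_pi_norm y i) (abs_nonneg _) (norm_nonneg _)
  have h0 := abs_le.1 (h 0)
  have h1 := abs_le.1 (h 1)
  have h2 := abs_le.1 (h 2)
  have h3 := abs_le.1 (h 3)
  unfold lor
  rw [abs_le]
  constructor <;> linarith

/-- A parallel normal field which vanishes at a point vanishes near it. -/
theorem ParallelField.eventually_eq_zero (hξ : ParallelField Ω f ξ) (hf : SpacelikePatch Ω f)
    {x₀ : Plane} (hx₀ : x₀ ∈ Ω) (h0 : ξ x₀ = 0) : ∀ᶠ x in 𝓝 x₀, ξ x = 0 := by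
  have hΩ := hf.isOpen
  -- The derivative of a parallel field is tangent, and by Weingarten its tangential coefficients
  -- are linear in `ξ`; `κ` bounds them.
  let κ : Fin 2 → Plane → ℝ := fun i x =>
    (4 * ‖pd i (pd 0 f) x‖ * |lor (pd 1 f x) (pd 1 f x)| +
      4 * ‖pd i (pd 1 f) x‖ * |lor (pd 0 f x) (pd 1 f x)|) / gramDet (pd 0 f x) (pd 1 f x) *
      ‖pd 0 f x‖ +
    (4 * ‖pd i (pd 1 f) x‖ * |lor (pd 0 f x) (pd 0 f x)| +
      4 * ‖pd i (pd 0 f) x‖ * |lor (pd 0 f x) (pd 1 f x)|) / gramDet (pd 0 f x) (pd 1 f x) *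
      ‖pd 1 f x‖
  have hκ : ∀ i, ∀ x ∈ Ω, ‖pd i ξ x‖ ≤ κ i x * ‖ξ x‖ := by
    intro i x hx
    have hD := hf.pos_det x hx
    have e := eq_tan_of_orthogonal hD.ne' fun n ha hb => hξ.tangent x hx i n ⟨ha, hb⟩
    have w := fun j => lor_pd_of_normal hf hξ.smooth hξ.normal hx i j
    have bd : ∀ u v a b : ℝ, ∀ X Y : L4, u = -lor X (ξ x) → v = -lor Y (ξ x) →
        |(u * a - v * b) / gramDet (pd 0 f x) (pd 1 f x)| ≤
        (4 * ‖X‖ * |a| + 4 * ‖Y‖ * |b|) / gramDet (pd 0 f x) (pd 1 f x) * ‖ξ x‖ := by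
      intro u v a b X Y hu hv
      rw [abs_div, abs_of_pos hD, div_mul_eq_mul_div]
      refine div_le_div_of_nonneg_right ?_ hD.le
      have h1 : |u| ≤ 4 * (‖X‖ * ‖ξ x‖) := by rw [hu, abs_neg]; exact abs_lor_le _ _
      have h2 : |v| ≤ 4 * (‖Y‖ * ‖ξ x‖) := by rw [hv, abs_neg]; exact abs_lor_le _ _
      calc |u * a - v * b| ≤ |u * a| + |v * b| := abs_sub _ _
        _ = |u| * |a| + |v| * |b| := by rw [abs_mul, abs_mul]
        _ ≤ 4 * (‖X‖ * ‖ξ x‖) * |a| + 4 * (‖Y‖ * ‖ξ x‖) * |b| := by gcongr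
        _ = _ := by ring
    have b1 := bd _ _ (lor (pd 1 f x) (pd 1 f x)) (lor (pd 0 f x) (pd 1 f x)) _ _ (w 0) (w 1)
    have b2 := bd _ _ (lor (pd 0 f x) (pd 0 f x)) (lor (pd 0 f x) (pd 1 f x)) _ _ (w 1) (w 0)
    conv_lhs => rw [e]
    refine (norm_add_le _ _).trans ?_
    rw [norm_smul, norm_smul, Real.norm_eq_abs, Real.norm_eq_abs]
    have c1 := mul_le_mul_of_nonneg_right b1 (norm_nonneg (pd 0 f x))
    have c2 := mul_le_mul_of_nonneg_right b2 (norm_nonneg (pd 1 f x))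
    refine (add_le_add c1 c2).trans (le_of_eq ?_)
    simp only [κ]
    ring
  have hκc : ∀ i, ContinuousOn (κ i) Ω := by
    intro i
    have c0 := (hf.contDiffOn_pd_pd i 0).continuousOn
    have c1 := (hf.contDiffOn_pd_pd i 1).continuousOn
    have d0 := (hf.contDiffOn_pd 0).continuousOn
    have d1 := (hf.contDiffOn_pd 1).continuousOn
    have g00 := (contDiffOn_lor (hf.contDiffOn_pd 0) (hf.contDiffOn_pd 0)).continuousOn
    have g01 := (contDiffOn_lor (hf.contDiffOn_pd 0) (hf.contDiffOn_pd 1)).continuousOn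
    have g11 := (contDiffOn_lor (hf.contDiffOn_pd 1) (hf.contDiffOn_pd 1)).continuousOn
    have g := (contDiffOn_gramDet (hf.contDiffOn_pd 0) (hf.contDiffOn_pd 1)).continuousOn
    have gne : ∀ x ∈ Ω, gramDet (pd 0 f x) (pd 1 f x) ≠ 0 := fun x hx => (hf.pos_det x hx).ne'
    fun_prop (disch := assumption)
  obtain ⟨R, hR, hB⟩ := Metric.nhds_basis_closedBall.mem_iff.1 (hΩ.mem_nhds hx₀)
  obtain ⟨M, hM⟩ := (isCompact_closedBall x₀ R).bddAbove_image
    (((hκc 0).add (hκc 1)).mono hB)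
  have hκ0 : ∀ i, ∀ x ∈ Ω, 0 ≤ κ i x := fun i x hx => by
    have := hf.pos_det x hx
    simp only [κ]; positivity
  have hκM : ∀ i, ∀ x ∈ Metric.closedBall x₀ R, κ i x ≤ M := fun i x hx => by
    have h1 : κ 0 x + κ 1 x ≤ M := hM (mem_image_of_mem _ hx)
    have h2 := hκ0 0 x (hB hx)
    have h3 := hκ0 1 x (hB hx)
    fin_cases i
    · change κ 0 x ≤ M; linarith
    · change κ 1 x ≤ M; linarith
  filter_upwards [Metric.closedBall_mem_nhds x₀ hR] with x hx
  have hseg : ∀ τ ∈ Icc (0 : ℝ) 1, x₀ + τ • (x - x₀) ∈ Metric.closedBall x₀ R := by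
    intro τ hτ
    rw [mem_closedBall_iff_norm] at hx ⊢
    rw [add_sub_cancel_left, norm_smul, Real.norm_of_nonneg hτ.1]
    exact (mul_le_of_le_one_left (norm_nonneg _) hτ.2).trans hx
  have hd : ∀ τ ∈ Icc (0 : ℝ) 1, HasDerivAt (fun τ : ℝ => ξ (x₀ + τ • (x - x₀)))
      (fderiv ℝ ξ (x₀ + τ • (x - x₀)) (x - x₀)) τ := by
    intro τ hτ
    have h1 : HasDerivAt (fun τ : ℝ => x₀ + τ • (x - x₀)) (x - x₀) τ := by
      simpa using ((hasDerivAt_id τ).smul_const (x - x₀)).const_add x₀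
    exact (differentiableAt_of_contDiffOn hξ.smooth hΩ (hB (hseg τ hτ))).hasFDerivAt.comp_hasDerivAt
      τ h1
  -- Grönwall's inequality along the segment from `x₀` to `x`.
  have := eq_zero_of_abs_deriv_le_mul_abs_self_of_eq_zero_right
    (K := (‖(x - x₀) 0‖ + ‖(x - x₀) 1‖) * M)
    (fun τ hτ => (hd τ hτ).continuousAt.continuousWithinAt)
    (fun τ hτ => (hd τ (Ico_subset_Icc_self hτ)).hasDerivWithinAt) (by simpa using h0)
    (fun τ hτ => ?_) 1 (by simp)
  · simpa using this
  · have hτ' := hseg τ (Ico_subset_Icc_self hτ)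
    set z := x₀ + τ • (x - x₀)
    have k0 := (hκ 0 z (hB hτ')).trans
      (mul_le_mul_of_nonneg_right (hκM 0 z hτ') (norm_nonneg (ξ z)))
    have k1 := (hκ 1 z (hB hτ')).trans
      (mul_le_mul_of_nonneg_right (hκM 1 z hτ') (norm_nonneg (ξ z)))
    rw [fderiv_eq_pd]
    refine (norm_add_le _ _).trans ?_
    rw [norm_smul, norm_smul]
    have l0 := mul_le_mul_of_nonneg_left k0 (norm_nonneg ((x - x₀) 0))
    have l1 := mul_le_mul_of_nonneg_left k1 (norm_nonneg ((x - x₀) 1))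
    calc _ ≤ _ := add_le_add l0 l1
      _ = _ := by ring

end Vanishing

/-! ### Formulas for the mean curvature vector -/

section MeanCurvature

/-- The mean curvature vector of a parametrised surface. -/
noncomputable def patchMeanCurv (f : Plane → L4) (x : Plane) : L4 :=
  (2 * gramDet (pd 0 f x) (pd 1 f x))⁻¹ • perp (pd 0 f x) (pd 1 f x)
    (lor (pd 1 f x) (pd 1 f x) • pd 0 (pd 0 f) x -
      (2 * lor (pd 0 f x) (pd 1 f x)) • pd 0 (pd 1 f) x +
      lor (pd 0 f x) (pd 0 f x) • pd 1 (pd 1 f) x)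

theorem lor_perp_of_orthogonal {a b n : L4} (ha : lor n a = 0) (hb : lor n b = 0) (w : L4) :
    lor (perp a b w) n = lor w n := by
  simp [perp, lor_sub_left, lor_add_left, lor_smul_left, lor_comm a n, lor_comm b n, ha, hb]

variable {Ω : Set Plane} {f : Plane → L4} {x : Plane}

theorem SpacelikePatch.contDiffOn_patchMeanCurv (hf : SpacelikePatch Ω f) :
    ContDiffOn ℝ ∞ (patchMeanCurv f) Ω := by
  have h0 := hf.contDiffOn_pd 0
  have h1 := hf.contDiffOn_pd 1
  have hD : ∀ x ∈ Ω, gramDet (pd 0 f x) (pd 1 f x) ≠ 0 := fun x hx => (hf.pos_det x hx).ne'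
  refine ContDiffOn.smul ((contDiffOn_const.mul (contDiffOn_gramDet h0 h1)).inv
    fun x hx => mul_ne_zero two_ne_zero (hD x hx)) (contDiffOn_perp h0 h1 ?_ hD)
  exact (((contDiffOn_lor h1 h1).smul (hf.contDiffOn_pd_pd 0 0)).sub
    ((contDiffOn_const.mul (contDiffOn_lor h0 h1)).smul (hf.contDiffOn_pd_pd 0 1))).add
    ((contDiffOn_lor h0 h0).smul (hf.contDiffOn_pd_pd 1 1))

theorem SpacelikePatch.isNormal_patchMeanCurv (hf : SpacelikePatch Ω f) (hx : x ∈ Ω) :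
    IsNormal f x (patchMeanCurv f x) := by
  have hD := (hf.pos_det x hx).ne'
  simp [IsNormal, patchMeanCurv, lor_smul_left, lor_perp_fst hD, lor_perp_snd hD]

theorem SpacelikePatch.trace_patchMeanCurv (hf : SpacelikePatch Ω f) (hx : x ∈ Ω) {n : L4}
    (hn : IsNormal f x n) :
    lor (pd 1 f x) (pd 1 f x) * lor (pd 0 (pd 0 f) x) n -
    2 * lor (pd 0 f x) (pd 1 f x) * lor (pd 0 (pd 1 f) x) n +
    lor (pd 0 f x) (pd 0 f x) * lor (pd 1 (pd 1 f) x) n =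
    2 * gramDet (pd 0 f x) (pd 1 f x) * lor (patchMeanCurv f x) n := by
  have hD := (hf.pos_det x hx).ne'
  rw [patchMeanCurv, lor_smul_left, lor_perp_of_orthogonal hn.1 hn.2]
  simp only [lor_add_left, lor_sub_left, lor_smul_left]
  field_simp

variable {S : Type*} [TopologicalSpace S] [ChartedSpace Plane S]

theorem gram_inv (ψ : S → L4) (y : S) : (gram ψ y)⁻¹ =
    (gramDet (diff ψ y (coordVec 0)) (diff ψ y (coordVec 1)))⁻¹ •
      !![lor (diff ψ y (coordVec 1)) (diff ψ y (coordVec 1)),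
        -lor (diff ψ y (coordVec 0)) (diff ψ y (coordVec 1));
        -lor (diff ψ y (coordVec 0)) (diff ψ y (coordVec 1)),
        lor (diff ψ y (coordVec 0)) (diff ψ y (coordVec 0))] := by
  rw [Matrix.inv_def, Matrix.det_fin_two, Matrix.adjugate_fin_two, Ring.inverse_eq_inv']
  simp only [gram, Matrix.of_apply, gramDet, lor_comm (diff ψ y (coordVec 1)) (diff ψ y (coordVec 0)),
    sq]

theorem normalPart_eq_perp (ψ : S → L4) (y : S) (w : L4) :
    normalPart ψ y w = perp (diff ψ y (coordVec 0)) (diff ψ y (coordVec 1)) w := by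
  simp only [normalPart, gram_inv, perp, tanFst, tanSnd, Fin.sum_univ_two, Matrix.smul_apply,
    Matrix.of_apply, Matrix.cons_val', Matrix.cons_val_zero, Matrix.cons_val_one, smul_eq_mul,
    Matrix.cons_val_fin_one]
  rw [← add_smul, ← add_smul]
  congr 3 <;> ring

theorem lor_meanCurv_fst {ψ : S → L4} {y : S}
    (h : gramDet (diff ψ y (coordVec 0)) (diff ψ y (coordVec 1)) ≠ 0) :
    lor (meanCurv ψ y) (diff ψ y (coordVec 0)) = 0 := by
  simp [meanCurv, secondForm, normalPart_eq_perp, lor_smul_left, lor_add_left, lor_perp_fst h]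

theorem lor_meanCurv_snd {ψ : S → L4} {y : S}
    (h : gramDet (diff ψ y (coordVec 0)) (diff ψ y (coordVec 1)) ≠ 0) :
    lor (meanCurv ψ y) (diff ψ y (coordVec 1)) = 0 := by
  simp [meanCurv, secondForm, normalPart_eq_perp, lor_smul_left, lor_add_left, lor_perp_snd h]

theorem lor_meanCurv_of_normal {ψ : S → L4} {y : S}
    (h : gramDet (diff ψ y (coordVec 0)) (diff ψ y (coordVec 1)) ≠ 0) {n : L4}
    (h0 : lor n (diff ψ y (coordVec 0)) = 0) (h1 : lor n (diff ψ y (coordVec 1)) = 0) :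
    2 * gramDet (diff ψ y (coordVec 0)) (diff ψ y (coordVec 1)) * lor (meanCurv ψ y) n =
      lor (diff ψ y (coordVec 1)) (diff ψ y (coordVec 1)) *
        lor (hessian ψ y (coordVec 0) (coordVec 0)) n -
      lor (diff ψ y (coordVec 0)) (diff ψ y (coordVec 1)) *
        (lor (hessian ψ y (coordVec 0) (coordVec 1)) n +
          lor (hessian ψ y (coordVec 1) (coordVec 0)) n) +
      lor (diff ψ y (coordVec 0)) (diff ψ y (coordVec 0)) *
        lor (hessian ψ y (coordVec 1) (coordVec 1)) n := by
  simp only [meanCurv, secondForm, normalPart_eq_perp, gram_inv, Fin.sum_univ_two,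
    Matrix.smul_apply, Matrix.of_apply, Matrix.cons_val', Matrix.cons_val_zero,
    Matrix.cons_val_one, smul_eq_mul, Matrix.cons_val_fin_one, lor_smul_left, lor_add_left,
    lor_perp_of_orthogonal h0 h1]
  field_simp
  ring

end MeanCurvature

/-! ### Independence of the chart -/

section Charts

variable {S : Type*} [TopologicalSpace S] [ChartedSpace Plane S]

theorem diff_comb (ψ : S → L4) (y : S) (s t : ℝ) (v w : Plane) :
    diff ψ y (s • v + t • w) = s • diff ψ y v + t • diff ψ y w := by
  let l : Plane →L[ℝ] L4 := mfderiv (𝓡 2) 𝓘(ℝ, L4) ψ y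
  change l (s • v + t • w) = s • l v + t • l w
  rw [map_add, map_smul, map_smul]

/-- The coordinate change from the preferred chart at `y` to the preferred chart at `p`. -/
noncomputable def chartChange (p y : S) : Plane → Plane :=
  chartAt Plane p ∘ (chartAt Plane y).symm

theorem mem_chartChange_source {p y : S} (hy : y ∈ (chartAt Plane p).source) :
    chartAt Plane y y ∈ ((chartAt Plane y).symm.trans (chartAt Plane p)).source := by
  simp [hy]

theorem chartChange_apply (p y : S) : chartChange p y (chartAt Plane y y) = chartAt Plane p y := by
  simp [chartChange]

theorem gramDet_pos {a b : L4}
    (h : ∀ s t : ℝ, (s ≠ 0 ∨ t ≠ 0) → 0 < lor (s • a + t • b) (s • a + t • b)) :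
    0 < lor a a ∧ 0 < lor b b ∧ 0 < gramDet a b := by
  have h1 := h 1 0 (by simp)
  have h2 := h 0 1 (by simp)
  simp only [one_smul, zero_smul, add_zero, zero_add] at h1 h2
  -- This combination is orthogonal to `b`, and its square is `lor b b` times the Gram determinant.
  have h3 := h (lor b b) (-lor a b) (Or.inl h2.ne')
  refine ⟨h1, h2, ?_⟩
  simp only [lor_add_left, lor_add_right, lor_smul_left, lor_smul_right, lor_comm b a] at h3
  refine pos_of_mul_pos_right (a := lor b b) ?_ h2.le
  unfold gramDet
  linarith

theorem coordVec_comb_ne_zero {s t : ℝ} (h : s ≠ 0 ∨ t ≠ 0) :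
    s • coordVec 0 + t • coordVec 1 ≠ 0 := by
  intro h0
  have e0 := congrArg (fun v : Plane => v 0) h0
  have e1 := congrArg (fun v : Plane => v 1) h0
  simp [coordVec] at e0 e1
  tauto

theorem IsSpacelike.gramDet_diff_pos {ψ : S → L4} (hψ : IsSpacelike ψ) (y : S) :
    0 < gramDet (diff ψ y (coordVec 0)) (diff ψ y (coordVec 1)) := by
  refine (gramDet_pos fun s t hst => ?_).2.2
  have := hψ.pos y _ (coordVec_comb_ne_zero hst)
  rwa [diff_comb] at this

variable [IsManifold (𝓡 2) ∞ S]

theorem contDiffOn_comp_chart_symm {ψ : S → L4} (hψ : ContMDiff (𝓡 2) 𝓘(ℝ, L4) ∞ ψ) (p : S) :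
    ContDiffOn ℝ ∞ (ψ ∘ (chartAt Plane p).symm) (chartAt Plane p).target :=
  contMDiffOn_iff_contDiffOn.1 (hψ.comp_contMDiffOn (contMDiffOn_chart_symm (I := 𝓡 2)))

theorem contDiffOn_chartChange (p y : S) : ContDiffOn ℝ ∞ (chartChange p y)
    ((chartAt Plane y).symm.trans (chartAt Plane p)).source := by
  refine contMDiffOn_iff_contDiffOn.1 ((contMDiffOn_chart (I := 𝓡 2) (x := p)).comp
    ((contMDiffOn_chart_symm (I := 𝓡 2) (x := y)).mono ?_) ?_)
  · intro z hz
    simpa using hz.1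
  · intro z hz
    simpa using hz.2

/-- The differential of the coordinate change at `y`. -/
noncomputable def chartChangeDeriv (p y : S) : Plane →L[ℝ] Plane :=
  fderiv ℝ (chartChange p y) (chartAt Plane y y)

/-- The derivative of the inverse coordinate change is a right inverse. Surjectivity transfers
statements about all tangent vectors from the preferred chart at `y` to the chart at `p`. -/
theorem chartChangeDeriv_surjective {p y : S} (hy : y ∈ (chartAt Plane p).source) :
    Function.Surjective (chartChangeDeriv p y) := by
  have ho := ((chartAt Plane y).symm.trans (chartAt Plane p)).open_source
  have ho' := ((chartAt Plane p).symm.trans (chartAt Plane y)).open_source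
  have hm' : chartAt Plane p y ∈ ((chartAt Plane p).symm.trans (chartAt Plane y)).source := by
    simp [hy]
  have e : chartChange y p (chartAt Plane p y) = chartAt Plane y y := by simp [chartChange, hy]
  have d1 := differentiableAt_of_contDiffOn (contDiffOn_chartChange p y) ho
    (mem_chartChange_source hy)
  have d2 := differentiableAt_of_contDiffOn (contDiffOn_chartChange y p) ho' hm'
  rw [← e] at d1
  have hid : chartChange p y ∘ chartChange y p =ᶠ[𝓝 (chartAt Plane p y)] id := by
    filter_upwards [ho'.mem_nhds hm'] with z hz
    have h1 : z ∈ (chartAt Plane p).target := by simpa using hz.1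
    have h2 : (chartAt Plane p).symm z ∈ (chartAt Plane y).source := by simpa using hz.2
    simp [chartChange, h1, h2]
  have hc := hid.fderiv_eq (𝕜 := ℝ)
  rw [fderiv_comp _ d1 d2, fderiv_id, e] at hc
  intro v
  exact ⟨fderiv ℝ (chartChange y p) (chartAt Plane p y) v, DFunLike.congr_fun hc v⟩

/-- The differential at `y` of a map which is smooth in the preferred chart at `p`. -/
theorem diff_eq {ξ : S → L4} {p y : S} (hy : y ∈ (chartAt Plane p).source) {g : Plane → L4}
    (hg : DifferentiableAt ℝ g (chartAt Plane p y))
    (hξ : ∀ z ∈ (chartAt Plane p).source, ξ z = g (chartAt Plane p z)) (v : Plane) :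
    diff ξ y v = fderiv ℝ g (chartAt Plane p y) (chartChangeDeriv p y v) := by
  have heq : ξ =ᶠ[𝓝 y] g ∘ chartAt Plane p := by
    filter_upwards [(chartAt Plane p).open_source.mem_nhds hy] with z hz using hξ z hz
  have hφ : MDifferentiableAt (𝓡 2) 𝓘(ℝ, Plane) (chartAt Plane p) y :=
    mdifferentiableAt_atlas (chart_mem_atlas Plane p) hy
  have hmd : MDifferentiableAt (𝓡 2) 𝓘(ℝ, L4) ξ y :=
    (hg.mdifferentiableAt.comp y hφ).congr_of_eventuallyEq heq
  have h1 : diff ξ y v = fderiv ℝ (ξ ∘ (chartAt Plane y).symm) (chartAt Plane y y) v := by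
    rw [diff, hmd.mfderiv]
    simp [writtenInExtChartAt, extChartAt, fderivWithin_univ]
    rfl
  have ho := ((chartAt Plane y).symm.trans (chartAt Plane p)).open_source
  have h2 : ξ ∘ (chartAt Plane y).symm =ᶠ[𝓝 (chartAt Plane y y)] g ∘ chartChange p y := by
    filter_upwards [ho.mem_nhds (mem_chartChange_source hy)] with z hz
    have : (chartAt Plane y).symm z ∈ (chartAt Plane p).source := by simpa using hz.2
    simp [chartChange, hξ _ this]
  have d1 := differentiableAt_of_contDiffOn (contDiffOn_chartChange p y) ho
    (mem_chartChange_source hy)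
  rw [← chartChange_apply p y] at hg
  rw [h1, h2.fderiv_eq, fderiv_comp _ hg d1, chartChange_apply]
  rfl

variable {ψ : S → L4}

theorem IsSpacelike.diff_eq (hψ : IsSpacelike ψ) {p y : S} (hy : y ∈ (chartAt Plane p).source)
    (v : Plane) : diff ψ y v =
      fderiv ℝ (ψ ∘ (chartAt Plane p).symm) (chartAt Plane p y) (chartChangeDeriv p y v) :=
  Minkowski.diff_eq hy (differentiableAt_of_contDiffOn (contDiffOn_comp_chart_symm hψ.smooth p)
    (chartAt Plane p).open_target ((chartAt Plane p).map_source hy))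
    (fun z hz => by simp [hz]) v

theorem IsSpacelike.spacelikePatch (hψ : IsSpacelike ψ) (p : S) :
    SpacelikePatch (chartAt Plane p).target (ψ ∘ (chartAt Plane p).symm) := by
  have key : ∀ x ∈ (chartAt Plane p).target, 0 < lor (pd 0 (ψ ∘ (chartAt Plane p).symm) x)
      (pd 0 (ψ ∘ (chartAt Plane p).symm) x) ∧ 0 < lor (pd 1 (ψ ∘ (chartAt Plane p).symm) x)
      (pd 1 (ψ ∘ (chartAt Plane p).symm) x) ∧ 0 < gramDet (pd 0 (ψ ∘ (chartAt Plane p).symm) x)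
      (pd 1 (ψ ∘ (chartAt Plane p).symm) x) := by
    intro x hx
    refine gramDet_pos fun s t hst => ?_
    have hy := (chartAt Plane p).map_target hx
    obtain ⟨v, hv⟩ := chartChangeDeriv_surjective hy (s • coordVec 0 + t • coordVec 1)
    have hv0 : v ≠ 0 := by
      rintro rfl
      exact coordVec_comb_ne_zero hst (by rw [← hv, map_zero])
    have := hψ.pos ((chartAt Plane p).symm x) v hv0
    rw [hψ.diff_eq hy, hv, (chartAt Plane p).right_inv hx, map_add, map_smul, map_smul] at this
    exact this
  exact ⟨(chartAt Plane p).open_target, contDiffOn_comp_chart_symm hψ.smooth p,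
    fun x hx => (key x hx).1, fun x hx => (key x hx).2.1, fun x hx => (key x hx).2.2⟩

/-- `n` is orthogonal to the surface `ψ` at `y`. -/
def IsNormalAt (ψ : S → L4) (y : S) (n : L4) : Prop := ∀ v, lor n (diff ψ y v) = 0

theorem isNormal_iff {f : Plane → L4} {x : Plane} {n : L4} :
    IsNormal f x n ↔ ∀ v, lor n (fderiv ℝ f x v) = 0 := by
  refine ⟨fun h v => ?_, fun h => ⟨h _, h _⟩⟩
  rw [fderiv_eq_pd, lor_add_right, lor_smul_right, lor_smul_right, h.1, h.2]
  ring

theorem IsSpacelike.isNormalAt_iff (hψ : IsSpacelike ψ) {p y : S}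
    (hy : y ∈ (chartAt Plane p).source) {n : L4} :
    IsNormalAt ψ y n ↔ IsNormal (ψ ∘ (chartAt Plane p).symm) (chartAt Plane p y) n := by
  rw [isNormal_iff]
  refine ⟨fun h v => ?_, fun h v => ?_⟩
  · obtain ⟨w, rfl⟩ := chartChangeDeriv_surjective hy v
    rw [← hψ.diff_eq hy]
    exact h w
  · rw [hψ.diff_eq hy]
    exact h _

/-- The second derivative in the preferred chart at `y`, computed in the preferred chart at `p`. -/
theorem IsSpacelike.lor_hessian (hψ : IsSpacelike ψ) {p y : S}
    (hy : y ∈ (chartAt Plane p).source) {n : L4} (hn : IsNormalAt ψ y n) (v w : Plane) :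
    lor (hessian ψ y v w) n =
      lor (fderiv ℝ (fderiv ℝ (ψ ∘ (chartAt Plane p).symm)) (chartAt Plane p y)
        (chartChangeDeriv p y v) (chartChangeDeriv p y w)) n := by
  have ho := ((chartAt Plane y).symm.trans (chartAt Plane p)).open_source
  have hm := mem_chartChange_source hy
  have hT := contDiffOn_chartChange p y
  have hf := contDiffOn_comp_chart_symm hψ.smooth p
  have hto := (chartAt Plane p).open_target
  have hmaps : ∀ z ∈ ((chartAt Plane y).symm.trans (chartAt Plane p)).source,
      chartChange p y z ∈ (chartAt Plane p).target := fun z hz =>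
    (chartAt Plane p).map_source (by simpa using hz.2)
  set f := ψ ∘ (chartAt Plane p).symm with hfd
  have e1 : ∀ z ∈ ((chartAt Plane y).symm.trans (chartAt Plane p)).source,
      (ψ ∘ (chartAt Plane y).symm) z = (f ∘ chartChange p y) z := by
    intro z hz
    have : (chartAt Plane y).symm z ∈ (chartAt Plane p).source := by simpa using hz.2
    simp [hfd, chartChange, this]
  have e2 : fderiv ℝ (ψ ∘ (chartAt Plane y).symm) =ᶠ[𝓝 (chartAt Plane y y)]
      fun z => (fderiv ℝ f (chartChange p y z)).comp (fderiv ℝ (chartChange p y) z) := by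
    filter_upwards [ho.mem_nhds hm] with z hz
    have : ψ ∘ (chartAt Plane y).symm =ᶠ[𝓝 z] f ∘ chartChange p y := by
      filter_upwards [ho.mem_nhds hz] with z' hz' using e1 z' hz'
    rw [this.fderiv_eq, fderiv_comp _ (differentiableAt_of_contDiffOn hf hto (hmaps z hz))
      (differentiableAt_of_contDiffOn hT ho hz)]
  have hdf : DifferentiableAt ℝ (fderiv ℝ f) (chartChange p y (chartAt Plane y y)) :=
    differentiableAt_of_contDiffOn (hf.fderiv_of_isOpen hto (by simp)) hto (hmaps _ hm)
  have hdT : DifferentiableAt ℝ (fderiv ℝ (chartChange p y)) (chartAt Plane y y) :=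
    differentiableAt_of_contDiffOn (hT.fderiv_of_isOpen ho (by simp)) ho hm
  -- The second derivative of `f ∘ T` is `f''(T'v, T'w) + f'(T''(v, w))`; the last term is tangent
  -- to the surface and disappears against a normal vector.
  have hd := (hdf.hasFDerivAt.comp _
    (differentiableAt_of_contDiffOn hT ho hm).hasFDerivAt).clm_comp hdT.hasFDerivAt
  have e3 := e2.fderiv_eq (𝕜 := ℝ)
  have e4 : fderiv ℝ (fun z => (fderiv ℝ f (chartChange p y z)).comp
    (fderiv ℝ (chartChange p y) z)) (chartAt Plane y y) = _ := hd.fderiv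
  rw [hessian, e3, e4]
  have hN := isNormal_iff.1 ((hψ.isNormalAt_iff hy).1 hn)
  simp only [add_apply, ContinuousLinearMap.comp_apply,
    ContinuousLinearMap.compL_apply, ContinuousLinearMap.flip_apply, Function.comp_apply,
    lor_add_left, chartChange_apply]
  rw [lor_comm (fderiv ℝ f _ _), hN, zero_add]
  rfl

theorem fderiv_fderiv_eq {f : Plane → L4} {Ω : Set Plane} (hf : ContDiffOn ℝ ∞ f Ω)
    (hΩ : IsOpen Ω) {x : Plane} (hx : x ∈ Ω) (v w : Plane) :
    fderiv ℝ (fderiv ℝ f) x v w = (v 0 * w 0) • pd 0 (pd 0 f) x +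
      (v 0 * w 1 + v 1 * w 0) • pd 0 (pd 1 f) x + (v 1 * w 1) • pd 1 (pd 1 f) x := by
  have hd : DifferentiableAt ℝ (fderiv ℝ f) x :=
    differentiableAt_of_contDiffOn (hf.fderiv_of_isOpen hΩ (by simp)) hΩ hx
  have key : ∀ i j, fderiv ℝ (fderiv ℝ f) x (coordVec i) (coordVec j) = pd i (pd j f) x := by
    intro i j
    unfold pd
    rw [fderiv_clm_apply hd (by fun_prop)]
    simp
  have hv : ∀ v : Plane, v = v 0 • coordVec 0 + v 1 • coordVec 1 := fun v => by
    ext i; fin_cases i <;> simp [coordVec]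
  conv_lhs => rw [hv v, hv w]
  simp only [map_add, map_smul, add_apply, smul_apply, key]
  rw [pd_comm hf hΩ hx 1 0]
  module

/-- The mean curvature vector is defined pointwise in a chart that varies with the point; to
differentiate it, one fixed chart is needed. Both sides are normal and have the same product with
every normal vector, since the trace of a bilinear form does not depend on the basis. -/
theorem IsSpacelike.meanCurv_eq (hψ : IsSpacelike ψ) {p y : S}
    (hy : y ∈ (chartAt Plane p).source) :
    meanCurv ψ y = patchMeanCurv (ψ ∘ (chartAt Plane p).symm) (chartAt Plane p y) := by
  have hf := hψ.spacelikePatch p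
  have hx := (chartAt Plane p).map_source hy
  have hD := hψ.gramDet_diff_pos y
  have hess := fun n (hn : IsNormalAt ψ y n) v w => hψ.lor_hessian hy hn v w
  have hdiff := hψ.diff_eq hy
  have hiff := fun n => hψ.isNormalAt_iff (n := n) hy
  have hDf := hf.pos_det _ hx
  have hN := hf.isNormal_patchMeanCurv hx
  have htr := fun n => hf.trace_patchMeanCurv (n := n) hx
  have hff := fun v w => fderiv_fderiv_eq hf.smooth hf.isOpen hx v w
  set f := ψ ∘ (chartAt Plane p).symm
  set x := chartAt Plane p y
  set M := chartChangeDeriv p y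
  have hm : IsNormalAt ψ y (meanCurv ψ y) := by
    intro v
    have hv : v = v 0 • coordVec 0 + v 1 • coordVec 1 := by
      ext i; fin_cases i <;> simp [coordVec]
    have : diff ψ y v = v 0 • diff ψ y (coordVec 0) + v 1 • diff ψ y (coordVec 1) := by
      conv_lhs => rw [hv]
      rw [diff_comb]
    rw [this, lor_add_right, lor_smul_right, lor_smul_right, lor_meanCurv_fst hD.ne',
      lor_meanCurv_snd hD.ne']
    ring
  have hm' := (hiff _).1 hm
  rw [← sub_eq_zero]
  refine eq_zero_of_orthogonal hDf.ne' (by rw [lor_sub_left, hm'.1, hN.1, sub_zero])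
    (by rw [lor_sub_left, hm'.2, hN.2, sub_zero]) fun n ha hb => ?_
  have hn := (hiff n).2 ⟨ha, hb⟩
  have h1 := lor_meanCurv_of_normal hD.ne' (hn _) (hn _)
  have h2 := htr n ⟨ha, hb⟩
  have a0 := hdiff (coordVec 0)
  have a1 := hdiff (coordVec 1)
  rw [fderiv_eq_pd] at a0 a1
  rw [hess n hn, hess n hn, hess n hn, hess n hn, hff, hff, hff, hff] at h1
  rw [a0, a1] at h1 hD
  set m00 := M (coordVec 0) 0
  set m01 := M (coordVec 0) 1
  set m10 := M (coordVec 1) 0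
  set m11 := M (coordVec 1) 1
  -- The Gram determinant scales by the squared Jacobian, and so does the numerator of the trace.
  have hdet : gramDet (m00 • pd 0 f x + m01 • pd 1 f x) (m10 • pd 0 f x + m11 • pd 1 f x) =
      (m00 * m11 - m01 * m10) ^ 2 * gramDet (pd 0 f x) (pd 1 f x) := by
    simp only [gramDet, lor_add_left, lor_add_right, lor_smul_left, lor_smul_right,
      lor_comm (pd 1 f x) (pd 0 f x)]
    ring
  rw [hdet] at h1 hD
  simp only [lor_add_left, lor_add_right, lor_smul_left, lor_smul_right,
      lor_comm (pd 1 f x) (pd 0 f x)] at h1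
  rw [lor_sub_left]
  refine (mul_eq_zero.1 (?_ : ((m00 * m11 - m01 * m10) ^ 2 * gramDet (pd 0 f x) (pd 1 f x)) *
    (lor (meanCurv ψ y) n - lor (patchMeanCurv f x) n) = 0)).resolve_left hD.ne'
  linear_combination (1 / 2) * h1 + (1 / 2) * (m00 * m11 - m01 * m10) ^ 2 * h2

theorem IsSpacelike.parallelMeanCurvPatch (hψ : IsSpacelike ψ) (hpar : HasParallelMeanCurv ψ)
    (p : S) : ParallelMeanCurvPatch (chartAt Plane p).target (ψ ∘ (chartAt Plane p).symm)
      (patchMeanCurv (ψ ∘ (chartAt Plane p).symm)) := by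
  have hf := hψ.spacelikePatch p
  refine ⟨hf, ⟨hf.contDiffOn_patchMeanCurv, fun x hx => hf.isNormal_patchMeanCurv hx,
    fun x hx i n hn => ?_⟩, fun x hx n hn => hf.trace_patchMeanCurv hx hn⟩
  have hy := (chartAt Plane p).map_target hx
  obtain ⟨v, hv⟩ := chartChangeDeriv_surjective hy (coordVec i)
  have hr := (chartAt Plane p).right_inv hx
  have hd := differentiableAt_of_contDiffOn hf.contDiffOn_patchMeanCurv hf.isOpen hx
  have h1 := hpar ((chartAt Plane p).symm x) v
  rw [← hr] at hd
  rw [normalConn, normalPart_eq_perp, Minkowski.diff_eq hy hd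
    (fun z hz => hψ.meanCurv_eq hz), hv, hr] at h1
  have hn' : IsNormalAt ψ ((chartAt Plane p).symm x) n := by
    rw [hψ.isNormalAt_iff hy, hr]
    exact hn
  change lor (fderiv ℝ _ x (coordVec i)) n = 0
  rw [← lor_perp_of_orthogonal (hn' (coordVec 0)) (hn' (coordVec 1)), h1, lor_zero_left]

end Charts

/-! ### From local to global -/

section Global

variable {S : Type*} [TopologicalSpace S] [ChartedSpace Plane S]

theorem eventually_eq_of_pd_eq_zero {E : Type*} [NormedAddCommGroup E] [NormedSpace ℝ E]
    {F : S → E} {p : S} {G : Plane → E} (hG : ContDiffOn ℝ ∞ G (chartAt Plane p).target)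
    (h : ∀ x ∈ (chartAt Plane p).target, ∀ i, pd i G x = 0)
    (hFG : ∀ y ∈ (chartAt Plane p).source, F y = G (chartAt Plane p y)) :
    ∀ᶠ y in 𝓝 p, F y = F p := by
  obtain ⟨r, hr, hB⟩ := Metric.isOpen_iff.1 (chartAt Plane p).open_target _
    (mem_chart_target Plane p)
  filter_upwards [(chartAt Plane p).open_source.mem_nhds (mem_chart_source Plane p),
    (chartAt Plane p).continuousAt (mem_chart_source Plane p) (Metric.ball_mem_nhds _ hr)]
    with y hy hyr
  rw [hFG y hy, hFG p (mem_chart_source Plane p)]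
  exact eq_of_pd_eq_zero Metric.isOpen_ball (convex_ball _ r).isPreconnected (hG.mono hB)
    (fun z hz => h z (hB hz)) hyr (Metric.mem_ball_self hr)

variable [IsManifold (𝓡 2) ∞ S] {ψ : S → L4}

/-- The vanishing of the parallel field `H` is both an open and a closed condition, so on a
connected surface `H` vanishes everywhere or nowhere. -/
theorem IsSpacelike.meanCurv_ne_zero [PreconnectedSpace S] (hψ : IsSpacelike ψ)
    (hpar : HasParallelMeanCurv ψ) (hmax : ¬ IsMaximal ψ) (y : S) : meanCurv ψ y ≠ 0 := by
  have hloc : IsLocallyConstant (fun y => meanCurv ψ y = 0) := by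
    rw [IsLocallyConstant.iff_eventually_eq]
    intro p
    have hp := mem_chart_source Plane p
    have hP := hψ.parallelMeanCurvPatch hpar p
    have hsrc := (chartAt Plane p).open_source.mem_nhds hp
    have hcont := (chartAt Plane p).continuousAt hp
    by_cases h0 : meanCurv ψ p = 0
    · rw [hψ.meanCurv_eq hp] at h0
      filter_upwards [hsrc, hcont.eventually
        (hP.parallel.eventually_eq_zero hP.patch (mem_chart_target Plane p) h0)] with y hy hy0
      rw [hψ.meanCurv_eq hy, hψ.meanCurv_eq hp, hy0, h0]
    · rw [hψ.meanCurv_eq hp] at h0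
      have hc := hP.parallel.smooth.continuousOn.continuousAt
        ((chartAt Plane p).open_target.mem_nhds (mem_chart_target Plane p))
      filter_upwards [hsrc, hcont.eventually (hc.eventually_ne h0)] with y hy hy0
      rw [hψ.meanCurv_eq hy, hψ.meanCurv_eq hp]
      simp [hy0, h0]
  intro h0
  refine hmax fun z => ?_
  have := hloc.apply_eq_of_preconnectedSpace y z
  exact this.mp h0

/-- A surface with parallel mean curvature vector which is not maximal has a global umbilical
parallel normal field `A - mψ`. -/
theorem IsSpacelike.exists_umbilical [ConnectedSpace S] (hψ : IsSpacelike ψ)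
    (hpar : HasParallelMeanCurv ψ) (hmax : ¬ IsMaximal ψ) :
    ∃ (A : L4) (m : ℝ), (A ≠ 0 ∨ m ≠ 0) ∧ ∀ y, IsNormalAt ψ y (A - m • ψ y) := by
  -- The germs of umbilical fields at `y`. On the neighbourhoods of `hlocal`, a pair valid near one
  -- point is valid throughout, so this set is locally constant and hence constant.
  let E : S → Set (L4 × ℝ) := fun y => {a | ∀ᶠ z in 𝓝 y, IsNormalAt ψ z (a.1 - a.2 • ψ z)}
  have hlocal : ∀ p : S, ∃ O : Set S, IsOpen O ∧ p ∈ O ∧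
      (∃ (A : L4) (m : ℝ), (A ≠ 0 ∨ m ≠ 0) ∧ ∀ y ∈ O, IsNormalAt ψ y (A - m • ψ y)) ∧
      ∀ (A : L4) (m : ℝ) (V : Set S), IsOpen V → V.Nonempty → V ⊆ O →
        (∀ y ∈ V, IsNormalAt ψ y (A - m • ψ y)) → ∀ y ∈ O, IsNormalAt ψ y (A - m • ψ y) := by
    intro p
    have hp := mem_chart_source Plane p
    have hH := hψ.meanCurv_ne_zero hpar hmax p
    rw [hψ.meanCurv_eq hp] at hH
    obtain ⟨R, hR, hB, ⟨A, m, hAm, hA⟩, huc⟩ :=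
      (hψ.parallelMeanCurvPatch hpar p).exists_umbilical (mem_chart_target Plane p) hH
    have hψf : ∀ y ∈ (chartAt Plane p).source,
        (ψ ∘ (chartAt Plane p).symm) (chartAt Plane p y) = ψ y := fun y hy => by simp [hy]
    refine ⟨(chartAt Plane p).source ∩ chartAt Plane p ⁻¹' Metric.ball (chartAt Plane p p) R,
      (chartAt Plane p).isOpen_inter_preimage Metric.isOpen_ball, ⟨hp, Metric.mem_ball_self hR⟩,
      ⟨A, m, hAm, fun y hy => ?_⟩, fun A m V hV hVne hVO hVn y hy => ?_⟩
    · have := hA _ hy.2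
      rwa [hψf y hy.1, ← hψ.isNormalAt_iff hy.1] at this
    · have := huc A m (chartAt Plane p '' V)
        ((chartAt Plane p).isOpen_image_of_subset_source hV (hVO.trans inter_subset_left))
        (hVne.image _) (by rintro _ ⟨z, hz, rfl⟩; exact (hVO hz).2)
        (by
          rintro _ ⟨z, hz, rfl⟩
          rw [hψf z (hVO hz).1, ← hψ.isNormalAt_iff (hVO hz).1]
          exact hVn z hz) _ hy.2
      rwa [hψf y hy.1, ← hψ.isNormalAt_iff hy.1] at this
  have hE : IsLocallyConstant E := by
    rw [IsLocallyConstant.iff_eventually_eq]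
    intro p
    obtain ⟨O, hO, hpO, -, huc⟩ := hlocal p
    have key : ∀ y ∈ O, ∀ a, a ∈ E y ↔ ∀ z ∈ O, IsNormalAt ψ z (a.1 - a.2 • ψ z) := by
      intro y hy a
      refine ⟨fun ha => ?_, fun ha => ?_⟩
      · obtain ⟨V, hVs, hV, hyV⟩ := eventually_nhds_iff.1 ha
        exact huc a.1 a.2 (V ∩ O) (IsOpen.inter hV hO) ⟨y, hyV, hy⟩ inter_subset_right
          fun z hz => hVs z hz.1
      · filter_upwards [hO.mem_nhds hy] with z hz using ha z hz
    filter_upwards [hO.mem_nhds hpO] with y hy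
    ext a
    rw [key y hy, key p hpO]
  obtain ⟨p⟩ := (inferInstance : Nonempty S)
  obtain ⟨O, hO, hpO, ⟨A, m, hAm, hA⟩, -⟩ := hlocal p
  have hp : (A, m) ∈ E p := by filter_upwards [hO.mem_nhds hpO] with z hz using hA z hz
  refine ⟨A, m, hAm, fun y => ?_⟩
  rw [hE.apply_eq_of_preconnectedSpace p y] at hp
  have hp' : ∀ᶠ z in 𝓝 y, IsNormalAt ψ z (A - m • ψ z) := hp
  exact hp'.self_of_nhds

/-- In an orthogonal frame `η, ν` of the normal plane with `ν` a unit vector, `|⟨H, ν⟩|` is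
determined by `⟨H, H⟩`, `⟨H, η⟩` and `⟨η, η⟩`. -/
theorem abs_lor_eq_sqrt {a b η ν H : L4} (h : gramDet a b ≠ 0) (hη : η ≠ 0)
    (ηa : lor η a = 0) (ηb : lor η b = 0) (νa : lor ν a = 0) (νb : lor ν b = 0)
    (Ha : lor H a = 0) (Hb : lor H b = 0) (hην : lor η ν = 0) (hν : |lor ν ν| = 1) :
    |lor H ν| = √|lor H H - lor H η ^ 2 / lor η η| := by
  have hνν : lor ν ν ≠ 0 := by
    intro h0
    rw [h0] at hν
    norm_num at hν
  -- A null `η` orthogonal to the non-null `ν` would be orthogonal to the whole normal plane, hence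
  -- zero.
  have hηη : lor η η ≠ 0 := by
    intro h0
    refine hη (eq_zero_of_orthogonal_frame h ηa ηb νa νb (fun x y hxy => ?_) ηa ηb h0 hην)
    have e := congrArg (fun z => lor z ν) hxy
    simp only [lor_add_left, lor_smul_left, lor_zero_left, hην, mul_zero, zero_add] at e
    have hy := (mul_eq_zero.1 e).resolve_right hνν
    rw [hy, zero_smul, add_zero] at hxy
    exact ⟨(smul_eq_zero.1 hxy).resolve_right hη, hy⟩
  -- Orthogonal expansion of `H`; pairing it with `H` yields `⟨H, ν⟩²/⟨ν, ν⟩` from the remaining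
  -- products.
  have hH : H - ((lor H η / lor η η) • η + (lor H ν / lor ν ν) • ν) = 0 := by
    refine eq_zero_of_orthogonal_frame h ηa ηb νa νb
      (indep_of_gramDet_ne_zero (by simp [gramDet, hην, hηη, hνν])) ?_ ?_ ?_ ?_ <;>
    simp only [lor_sub_left, lor_add_left, lor_smul_left, ηa, ηb, νa, νb, Ha, Hb, hην,
      lor_comm ν η] <;> field_simp <;> ring
  have e := congrArg (fun z => lor z H) hH
  simp only [lor_sub_left, lor_add_left, lor_smul_left, lor_zero_left, lor_comm η H,
    lor_comm ν H] at e
  have e2 : lor H H - lor H η ^ 2 / lor η η = lor H ν ^ 2 / lor ν ν := by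
    linear_combination e
  rw [e2, abs_div, hν, div_one, abs_sq, Real.sqrt_sq_eq_abs]

/-- If `A - mψ` is normal to the surface, then the squares of `A - mψ` and of the mean curvature
vector are constant, and so is their product, which is `m`. -/
theorem IsSpacelike.exists_lor_eq [ConnectedSpace S] (hψ : IsSpacelike ψ)
    (hpar : HasParallelMeanCurv ψ) {A : L4} {m : ℝ} (hA : ∀ y, IsNormalAt ψ y (A - m • ψ y)) :
    ∃ c e : ℝ, ∀ y, lor (meanCurv ψ y) (meanCurv ψ y) = c ∧
      lor (A - m • ψ y) (A - m • ψ y) = e ∧ lor (meanCurv ψ y) (A - m • ψ y) = m := by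
  have hψf : ∀ p, ∀ y ∈ (chartAt Plane p).source,
      (ψ ∘ (chartAt Plane p).symm) (chartAt Plane p y) = ψ y := fun p y hy => by simp [hy]
  have hn : ∀ p, ∀ x ∈ (chartAt Plane p).target, IsNormal (ψ ∘ (chartAt Plane p).symm) x
      (A - m • (ψ ∘ (chartAt Plane p).symm) x) := by
    intro p x hx
    have h1 := (hψ.isNormalAt_iff ((chartAt Plane p).map_target hx)).1
      (hA ((chartAt Plane p).symm x))
    rwa [(chartAt Plane p).right_inv hx] at h1
  have hc : IsLocallyConstant fun y => lor (meanCurv ψ y) (meanCurv ψ y) := by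
    rw [IsLocallyConstant.iff_eventually_eq]
    intro p
    have hP := hψ.parallelMeanCurvPatch hpar p
    exact eventually_eq_of_pd_eq_zero (contDiffOn_lor hP.parallel.smooth hP.parallel.smooth)
      (fun x hx i => hP.parallel.pd_lor_eq_zero hP.parallel hP.patch.isOpen hx i)
      fun y hy => by rw [hψ.meanCurv_eq hy]
  have he : IsLocallyConstant fun y => lor (A - m • ψ y) (A - m • ψ y) := by
    rw [IsLocallyConstant.iff_eventually_eq]
    intro p
    have hf := hψ.spacelikePatch p
    have hη := parallelField_sub_smul hf (hn p)
    exact eventually_eq_of_pd_eq_zero (contDiffOn_lor hη.smooth hη.smooth)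
      (fun x hx i => hη.pd_lor_eq_zero hη hf.isOpen hx i)
      fun y hy => by rw [hψf p y hy]
  obtain ⟨p⟩ := (inferInstance : Nonempty S)
  refine ⟨_, _, fun y => ⟨hc.apply_eq_of_preconnectedSpace y p,
    he.apply_eq_of_preconnectedSpace y p, ?_⟩⟩
  have hy := mem_chart_source Plane y
  have := (hψ.parallelMeanCurvPatch hpar y).lor_meanCurv_eq (hn y) (mem_chart_target Plane y)
  rwa [hψf y y hy, ← hψ.meanCurv_eq hy] at this

theorem IsSpacelike.isNormalAt_meanCurv (hψ : IsSpacelike ψ) (y : S) :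
    IsNormalAt ψ y (meanCurv ψ y) := by
  have hy := mem_chart_source Plane y
  rw [hψ.isNormalAt_iff hy, hψ.meanCurv_eq hy]
  exact (hψ.spacelikePatch y).isNormal_patchMeanCurv (mem_chart_target Plane y)

/-- A surface in a hypersurface whose normal along the surface is proportional to `A - mψ` has
constant mean curvature in it. -/
theorem IsSpacelike.hasConstantMeanCurvIn [ConnectedSpace S] (hψ : IsSpacelike ψ)
    (hpar : HasParallelMeanCurv ψ) {A : L4} {m : ℝ} (hA : ∀ y, IsNormalAt ψ y (A - m • ψ y))
    (hne : ∀ y, A - m • ψ y ≠ 0) {Q : Hyperquadric}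
    (hQ : ∀ y v, Q.deriv (ψ y) v = 0 → lor (A - m • ψ y) v = 0) : HasConstantMeanCurvIn ψ Q := by
  obtain ⟨c, e, hce⟩ := hψ.exists_lor_eq hpar hA
  refine ⟨√|c - m ^ 2 / e|, fun y ν hν => ?_⟩
  obtain ⟨h1, h2, h3⟩ := hce y
  have hH := hψ.isNormalAt_meanCurv y
  rw [abs_lor_eq_sqrt (hψ.gramDet_diff_pos y).ne' (hne y) (hA y _) (hA y _) (hν.normal _)
    (hν.normal _) (hH _) (hH _) (hQ y ν hν.tangent) hν.unit, h1, h2, h3]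

end Global

/-! ### Hyperplanes and central quadrics as totally umbilical hyperquadrics -/

section Quadrics

/-- The Lorentzian product as a bilinear form. -/
noncomputable def lorForm : LinearMap.BilinForm ℝ L4 :=
  LinearMap.mk₂ ℝ lor lor_add_left lor_smul_left lor_add_right lor_smul_right

theorem lorForm_apply (x y : L4) : lorForm x y = lor x y := rfl

/-- The affine hyperplane `⟨n, x⟩ = c` as a hyperquadric. -/
noncomputable def Hyperquadric.ofHyperplane (n : L4) (c : ℝ) : Hyperquadric where
  form := 0
  symm _ _ := rfl
  lin := lorForm n
  const := -c

/-- The hyperquadric `⟨x - a, x - a⟩ = ρ`. -/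
noncomputable def Hyperquadric.ofCentre (a : L4) (ρ : ℝ) : Hyperquadric where
  form := lorForm
  symm := lor_comm
  lin := (-2 : ℝ) • lorForm a
  const := lor a a - ρ

theorem Hyperquadric.deriv_ofHyperplane (n : L4) (c : ℝ) (x v : L4) :
    (Hyperquadric.ofHyperplane n c).deriv x v = lor n v := by
  simp [Hyperquadric.deriv, Hyperquadric.ofHyperplane, lorForm_apply]

theorem Hyperquadric.deriv_ofCentre (a : L4) (ρ : ℝ) (x v : L4) :
    (Hyperquadric.ofCentre a ρ).deriv x v = 2 * lor (x - a) v := by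
  simp [Hyperquadric.deriv, Hyperquadric.ofCentre, lorForm_apply, lor_sub_left]
  ring

theorem Hyperquadric.locus_ofHyperplane {n : L4} (hn : n ≠ 0) (c : ℝ) :
    (Hyperquadric.ofHyperplane n c).locus = hyperplane n c := by
  ext x
  have h : ∃ v, (Hyperquadric.ofHyperplane n c).deriv x v ≠ 0 := by
    by_contra! h
    exact hn (eq_zero_of_lor_eq_zero fun v => by rw [← Hyperquadric.deriv_ofHyperplane n c x, h v])
  have e : (Hyperquadric.ofHyperplane n c).eval x = lor n x - c := by
    simp [Hyperquadric.eval, Hyperquadric.ofHyperplane, lorForm_apply]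
    ring
  simp only [Hyperquadric.locus, hyperplane, mem_ofPred_eq, h, and_true, e, sub_eq_zero]

theorem Hyperquadric.locus_ofCentre (a : L4) (ρ : ℝ) :
    (Hyperquadric.ofCentre a ρ).locus = centralQuadric a ρ := by
  ext x
  have h : (∃ v, (Hyperquadric.ofCentre a ρ).deriv x v ≠ 0) ↔ x ≠ a := by
    rw [← not_iff_not]
    push Not
    simp only [Hyperquadric.deriv_ofCentre]
    refine ⟨fun h => sub_eq_zero.1 (eq_zero_of_lor_eq_zero fun v => by linarith [h v]), ?_⟩
    rintro rfl v
    simp [lor_zero_left]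
  have e : (Hyperquadric.ofCentre a ρ).eval x = lor (x - a) (x - a) - ρ := by
    simp [Hyperquadric.eval, Hyperquadric.ofCentre, lorForm_apply, lor_sub_left, lor_sub_right,
      lor_comm x a]
    ring
  simp only [Hyperquadric.locus, centralQuadric, mem_ofPred_eq, h, e, sub_eq_zero]
  exact and_comm

theorem Hyperquadric.isTotallyUmbilical_ofHyperplane (n : L4) (c : ℝ) :
    (Hyperquadric.ofHyperplane n c).IsTotallyUmbilical := fun _ _ =>
  ⟨0, fun v w _ _ => by simp [Hyperquadric.ofHyperplane]⟩

theorem Hyperquadric.isTotallyUmbilical_ofCentre (a : L4) (ρ : ℝ) :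
    (Hyperquadric.ofCentre a ρ).IsTotallyUmbilical := fun _ _ => ⟨2, fun _ _ _ _ => rfl⟩

end Quadrics

end Minkowski

/-! ### The main theorem -/

open Minkowski in
theorem mainTheorem4 {S : Type*} [TopologicalSpace S] [ChartedSpace Minkowski.Plane S]
    [IsManifold (𝓡 2) ∞ S] [ConnectedSpace S]
    (ψ : S → Minkowski.L4) (hψ : Minkowski.IsSpacelike ψ)
    (hpar : Minkowski.HasParallelMeanCurv ψ) (hmax : ¬ Minkowski.IsMaximal ψ) :
    ∃ Q : Minkowski.Hyperquadric,
      Q.IsTotallyUmbilical ∧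
      ((∃ n : Minkowski.L4, n ≠ 0 ∧ ∃ c : ℝ, Q.locus = Minkowski.hyperplane n c) ∨
        ∃ (a : Minkowski.L4) (ρ : ℝ), Q.locus = Minkowski.centralQuadric a ρ) ∧
      (∀ x : S, ψ x ∈ Q.locus) ∧
      Minkowski.HasConstantMeanCurvIn ψ Q := by
  obtain ⟨A, m, hAm, hA⟩ := hψ.exists_umbilical hpar hmax
  obtain ⟨c, e, hce⟩ := hψ.exists_lor_eq hpar hA
  by_cases hm : m = 0
  · subst hm
    have hA0 : A ≠ 0 := by simpa using hAm
    have hconst : IsLocallyConstant fun y => lor A (ψ y) := by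
      rw [IsLocallyConstant.iff_eventually_eq]
      intro p
      have hf := hψ.spacelikePatch p
      refine eventually_eq_of_pd_eq_zero (contDiffOn_lor (contDiffOn_const (c := A)) hf.smooth)
        (fun x hx i => ?_) fun y hy => by simp [hy]
      have hn := (hψ.isNormalAt_iff ((chartAt Plane p).map_target hx)).1
        (hA ((chartAt Plane p).symm x))
      rw [zero_smul, sub_zero, (chartAt Plane p).right_inv hx] at hn
      rw [pd_lor (differentiableAt_const A) (differentiableAt_of_contDiffOn hf.smooth hf.isOpen hx),
        pd_const, lor_zero_left, zero_add, lor_comm]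
      exact isTangent_pd _ x i A hn
    obtain ⟨p⟩ := (inferInstance : Nonempty S)
    refine ⟨Hyperquadric.ofHyperplane A (lor A (ψ p)),
      Hyperquadric.isTotallyUmbilical_ofHyperplane _ _,
      Or.inl ⟨A, hA0, _, Hyperquadric.locus_ofHyperplane hA0 _⟩, fun x => ?_,
      hψ.hasConstantMeanCurvIn hpar hA (fun y => by simpa using hA0) fun y v hv => ?_⟩
    · rw [Hyperquadric.locus_ofHyperplane hA0]
      exact hconst.apply_eq_of_preconnectedSpace x p
    · rw [Hyperquadric.deriv_ofHyperplane] at hv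
      simpa using hv
  -- Since `⟨H, A - mψ⟩ = m ≠ 0`, the surface avoids the centre `A / m`, which is the vertex if the
  -- quadric is a light cone.
  · have hne : ∀ y, A - m • ψ y ≠ 0 := fun y h0 => by
      have := (hce y).2.2
      rw [h0, lor_zero_right] at this
      exact hm this.symm
    have hcentre : ∀ y, ψ y - m⁻¹ • A = (-m⁻¹) • (A - m • ψ y) := fun y => by
      rw [smul_sub, smul_smul, neg_mul, inv_mul_cancel₀ hm]
      module
    -- From `ψ - A/m = -(A - mψ)/m`, the constant square `e` of `A - mψ` gives `ρ = e / m²`.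
    refine ⟨Hyperquadric.ofCentre (m⁻¹ • A) ((-m⁻¹) * (-m⁻¹ * e)),
      Hyperquadric.isTotallyUmbilical_ofCentre _ _,
      Or.inr ⟨_, _, Hyperquadric.locus_ofCentre _ _⟩, fun x => ?_,
      hψ.hasConstantMeanCurvIn hpar hA hne fun y v hv => ?_⟩
    · rw [Hyperquadric.locus_ofCentre]
      refine ⟨sub_ne_zero.1 ?_, ?_⟩
      · rw [hcentre]
        exact smul_ne_zero (neg_ne_zero.2 (inv_ne_zero hm)) (hne x)
      · rw [hcentre, lor_smul_left, lor_smul_right, (hce x).2.1]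
    · rw [Hyperquadric.deriv_ofCentre, hcentre, lor_smul_left] at hv
      have h2 : -m⁻¹ ≠ 0 := neg_ne_zero.2 (inv_ne_zero hm)
      simpa [hm] using hv
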